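/- Let $\mathbb T=[-\pi,\pi]$ with endpoints identified, $\hat u(k)=\frac1{2\pi}\int_{\mathbb T}u(x)e^{-ikx}dx$, $\langle u\rangle=\hat u(0)$, $\|u\|_{\dot A}=\sum_{k}|\hat u(k)|$, $\|u\|_{\dot H^s}^2=\sum_k|k|^{2s}|\hat u(k)|^2$, and let $\dot H^s(\mathbb T)$ be the space of zero mean functions $u\in L^2(\mathbb T)$ with $\|u\|_{\dot H^s}<\infty$. Put $\mathcal E_0(u,v)=\|u\|_{\dot A}+\|v\|_{\dot A}$ and $E_s(u,v)=\|u\|_{\dot H^s}^2+\|v\|_{\dot H^s}^2$. Let $\rho,\mu>0$ and let either $\zeta=1$, $\mathscr D=\partial_x$ (gravity driven flow) or $\zeta=3$, $\mathscr D=-\partial_x^3$ (capillary driven flow). For initial film thicknesses $f_0,g_0$ put $F=\langle f_0\rangle$, $G=\langle g_0\rangle$, $\bar f_0=f_0-F$, $\bar g_0=g_0-G$, $e=\mathcal E_0(\bar f_0,\bar g_0)$. Consider the two-phase thin film Stokes system $$\partial_t\bar f=\partial_x\big[(2\rho f^3+3f^2g)\mathscr D\bar f+(2f^3+3f^2g)\mathscr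 D\bar g\big],$$ $$\partial_t\bar g=\partial_x\big[(2\mu g^3+3\rho f^2g+6fg^2)\mathscr D\bar f+(2\mu g^3+3f^2g+6fg^2)\mathscr D\bar g\big],$$ where $f=F+\bar f$, $g=G+\bar g$. Writing $J_1,J_2$ for the expressions in square brackets, a pair $(\bar f,\bar g)\in (L^1(0,T;W^{\zeta,1}(\mathbb T)))^2$ with $J_1,J_2\in L^1((0,T)\times\mathbb T)$ is a weak solution on $[0,T)$ with initial datum $(\bar f_0,\bar g_0)$ if $$\int_{\mathbb T}\bar f_0\phi(0)\,dx+\int_0^T\!\!\int_{\mathbb T}\bar f\,\partial_t\phi\,dx\,dt=\int_0^T\!\!\int_{\mathbb T}J_1\,\partial_x\phi\,dx\,dt,\qquad \int_{\mathbb T}\bar g_0\psi(0)\,dx+\int_0^T\!\!\int_{\mathbb T}\bar g\,\partial_t\psi\,dx\,dt=\int_0^T\!\!\int_{\mathbb T}J_2\,\partial_x\psi\,dx\,dt$$ for all $\phi,\psi\in C_c^\infty([0,T)\times\mathbb T)$. Define $$\Sigma_1=2\rho F^3+3F^2G(1-\rho)-(2\mu G^3+6FG^2)-e\big[(78+20\rho+14\mu)e^2+(F(36\rho+84)+(81+30\mu+9\rho)G)e\big]-e\big[(18\mu+18)G^2+(18\rho+18)F^2+(12\rho+60)FG\big],$$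 $$\Sigma_2=2\mu G^3+6FG^2-2F^3-e\big[(14\mu+15\rho+83)e^2+((30\mu+6\rho+84)G+(96+24\rho)F)e\big]-e\big[(18\mu+18)G^2+(27+9\rho)F^2+(6\rho+66)FG\big],$$ $$\mathscr C_1=\tfrac12e^2(23+5\rho+4\mu)+\tfrac12e\big(F(36+12\rho)+G(33+3\rho+4\mu)\big)+\tfrac12\big(F^2(15+9\rho)+G^2(12+12\mu)+FG(42+6\rho)\big),$$ $$\mathscr C_3=e^2\big(32+\tfrac{55}8\rho+\tfrac{15}2\mu\big)+e\big(F(66+18\rho)+G(36+\tfrac{21}2\rho+18\mu)\big)+F^2\big(\tfrac{57}4+\tfrac{39}4\rho\big)+G^2\big(\tfrac{27}2+\tfrac{15}2\mu\big)+FG\big(\tfrac{81}2+\tfrac{15}2\rho\big).$$ Theorem. Let $\bar f_0,\bar g_0\in\dot H^{(\zeta+1)/2}(\mathbb T)$ with $e<\min\{F,G\}$, $\min\{\Sigma_1,\Sigma_2\}>0$ and $$(2\rho-1)F^3-\tfrac32(\rho-1)F^2G-3FG^2-\mu G^3-e\,\mathscr C_\zeta>0,\qquad \mu G^3+3FG^2-\tfrac32(\rho-1)F^2G-F^3-e\,\mathscr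 C_\zeta>0.$$ Then there is a global weak solution $(\bar f,\bar g)$ with initial datum $(\bar f_0,\bar g_0)$ which for every $T>0$ lies in $$\Big(L^\infty([0,T]\times\mathbb T)\cap L^{\frac{\zeta+1}\zeta}(0,T;W^{\zeta,\infty}(\mathbb T))\cap L^1(0,T;C^{\zeta+\alpha}(\mathbb T))\cap\mathcal M(0,T;W^{\zeta+1,\infty}(\mathbb T))\cap L^2(0,T;\dot H^{(\zeta+1)/2}(\mathbb T))\Big)^2\quad(0\le\alpha<\tfrac12)$$ ($\mathcal M(0,T;X)$ denotes the $X$-valued measures on $[0,T]$ of finite total variation) and satisfies $\|\bar f(T)\|_{L^\infty}+\|\bar g(T)\|_{L^\infty}\le e\cdot\exp(-\varepsilon T)$ for all $T>0$ with some $\varepsilon>0$ independent of $T$, and which moreover satisfies, for all $T>0$, $$(\bar f,\bar g)\in\Big(C([0,T];\dot H^{(\zeta+1)/2}(\mathbb T))\cap L^2(0,T;\dot H^{\zeta+1}(\mathbb T))\Big)^2,$$ (i) $E_{(\zeta+1)/2}(\bar f(T),\bar g(T))+c_1\int_0^TE_{\zeta+1}(\bar f(s),\bar g(s))\,ds\le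 c_2$, (ii) $E_s(\bar f(T),\bar g(T))\le c_3\exp(-cT)$ for all $0\le s<(\zeta+1)/2$, with positive constants $c_1,c_2,c_3$ depending only on $f_0,g_0,\mu,\rho,\zeta$ and $c$ depending only on these and on $s$. -/

import Mathlib

open MeasureTheory Set Filter Topology
open scoped ENNReal ContDiff BoundedContinuousFunction

namespace ThinFilm

noncomputable section

/-! ### Functions on the torus

The torus `𝕋 = [-π, π]` with endpoints identified.  A function on `𝕋` is a `2π`-periodic function
on the real line. -/

/-- The measure on one period, i.e. Lebesgue measure on `𝕋`. -/
def torusMeasure : Measure ℝ := volume.restrict (Ioc (-Real.pi) Real.pi)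

/-- The mean value `⟨u⟩ = (1 / 2π) ∫_𝕋 u`. -/
def mean (u : ℝ → ℝ) : ℝ := (1 / (2 * Real.pi)) * ∫ x in (-Real.pi)..Real.pi, u x

/-- The zero mean part `u - ⟨u⟩`. -/
def fluct (u : ℝ → ℝ) : ℝ → ℝ := fun x => u x - mean u

/-- The Fourier coefficient `û(k) = (1 / 2π) ∫_{-π}^{π} u(x) e^{-ikx} dx`. -/
def fc (u : ℝ → ℝ) (k : ℤ) : ℂ :=
  fourierCoeffOn (neg_lt_self Real.pi_pos) (fun x => (u x : ℂ)) k

/-- The Wiener norm `‖u‖_{Ȧ} = ∑ₖ |û(k)|`. -/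
def wienerNorm (u : ℝ → ℝ) : ℝ := ∑' k : ℤ, ‖fc u k‖

/-- The square `‖u‖²_{Ḣ^α} = ∑ₖ |k|^{2α} |û(k)|²`. -/
def hSq (α : ℝ) (u : ℝ → ℝ) : ℝ := ∑' k : ℤ, |(k : ℝ)| ^ (2 * α) * ‖fc u k‖ ^ 2

/-- Membership in `Ḣ^α(𝕋)`: square integrable, of zero mean, with finite `Ḣ^α` norm. -/
def MemHdot (α : ℝ) (u : ℝ → ℝ) : Prop :=
  Function.Periodic u (2 * Real.pi) ∧ MemLp u 2 torusMeasure ∧ mean u = 0 ∧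
    Summable fun k : ℤ => |(k : ℝ)| ^ (2 * α) * ‖fc u k‖ ^ 2

/-- `𝓔₀(u, v) = ‖u‖_{Ȧ} + ‖v‖_{Ȧ}`. -/
def calE₀ (u v : ℝ → ℝ) : ℝ := wienerNorm u + wienerNorm v

/-- `E_s(u, v) = ‖u‖²_{Ḣ^s} + ‖v‖²_{Ḣ^s}`. -/
def E (s : ℝ) (u v : ℝ → ℝ) : ℝ := hSq s u + hSq s v

/-- `v` is the `n`-th weak derivative of `u` on `𝕋`. -/
def HasWeakDeriv (n : ℕ) (u v : ℝ → ℝ) : Prop :=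
  Integrable u torusMeasure ∧ Integrable v torusMeasure ∧
    ∀ φ : ℝ → ℝ, ContDiff ℝ ∞ φ → Function.Periodic φ (2 * Real.pi) →
      ∫ x in (-Real.pi)..Real.pi, u x * iteratedDeriv n φ x =
        (-1) ^ n * ∫ x in (-Real.pi)..Real.pi, v x * φ x

/-! ### Spaces of time dependent functions -/

/-- `u ∈ L^∞([0,T] × 𝕋)`. -/
def MemLinfty (T : ℝ) (u : ℝ → ℝ → ℝ) : Prop :=
  MemLp (Function.uncurry u) ⊤ ((volume.restrict (Ioo 0 T)).prod torusMeasure)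

/-- `u ∈ L^q(0,T; W^{n,∞}(𝕋))` in the sense of Bochner: the `L^∞(𝕋)`-valued functions `u` and
`∂ₓⁿ u` are `L^q` functions of time. -/
def MemLqWinfty (T : ℝ) (q : ℝ≥0∞) (n : ℕ) (u : ℝ → ℝ → ℝ) : Prop :=
  ∃ U V : ℝ → Lp ℝ ⊤ torusMeasure,
    MemLp U q (volume.restrict (Ioo 0 T)) ∧ MemLp V q (volume.restrict (Ioo 0 T)) ∧
      ∀ᵐ t ∂(volume.restrict (Ioo 0 T)),
        u t =ᵐ[torusMeasure] (U t : ℝ → ℝ) ∧ HasWeakDeriv n (U t) (V t)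

/-- `u ∈ L¹(0,T; C^{n+α}(𝕋))` in the sense of Bochner.  The space `C^{n+α}` is normed by the
sup norms of the derivatives of order at most `n` and of the Hölder quotient
`(w⁽ⁿ⁾(x) - w⁽ⁿ⁾(y)) / |x - y|^α`, `x ≠ y`. -/
def MemL1Holder (T : ℝ) (n : ℕ) (α : ℝ) (u : ℝ → ℝ → ℝ) : Prop :=
  ∃ (W : ℝ → ℝ → ℝ) (U : ℕ → ℝ → (ℝ →ᵇ ℝ)) (V : ℝ → ({p : ℝ × ℝ // p.1 ≠ p.2} →ᵇ ℝ)),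
    (∀ j ≤ n, MemLp (U j) 1 (volume.restrict (Ioo 0 T))) ∧
    MemLp V 1 (volume.restrict (Ioo 0 T)) ∧
    ∀ᵐ t ∂(volume.restrict (Ioo 0 T)),
      u t =ᵐ[torusMeasure] W t ∧ Function.Periodic (W t) (2 * Real.pi) ∧ ContDiff ℝ n (W t) ∧
      (∀ j ≤ n, ∀ x, U j t x = iteratedDeriv j (W t) x) ∧
      ∀ p : {p : ℝ × ℝ // p.1 ≠ p.2},
        V t p = (iteratedDeriv n (W t) p.1.1 - iteratedDeriv n (W t) p.1.2)
          / |p.1.1 - p.1.2| ^ α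

/-- `u ∈ 𝓜(0,T; W^{n,∞}(𝕋))`: the vector measure `B ↦ ∫_B u(t) dt` on `[0,T]` takes values in
`W^{n,∞}(𝕋)`, is countably additive there, and has finite total variation. -/
def MemMeasWinfty (T : ℝ) (n : ℕ) (u : ℝ → ℝ → ℝ) : Prop :=
  ∃ ν₀ ν₁ : VectorMeasure ℝ (Lp ℝ ⊤ torusMeasure),
    ν₀.variation (Icc 0 T) < ⊤ ∧ ν₁.variation (Icc 0 T) < ⊤ ∧
    ∀ B : Set ℝ, MeasurableSet B → B ⊆ Icc 0 T →
      (fun x => ∫ t in B, u t x) =ᵐ[torusMeasure] (ν₀ B : ℝ → ℝ) ∧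
      HasWeakDeriv n (ν₀ B) (ν₁ B)

/-- `u ∈ L²(0,T; Ḣ^α(𝕋))`. -/
def MemL2Hdot (T α : ℝ) (u : ℝ → ℝ → ℝ) : Prop :=
  (∀ k : ℤ, AEStronglyMeasurable (fun t => fc (u t) k) (volume.restrict (Ioo 0 T))) ∧
    (∀ᵐ t ∂(volume.restrict (Ioo 0 T)), MemHdot α (u t)) ∧
    IntegrableOn (fun t => hSq α (u t)) (Ioo 0 T)

/-- `u ∈ C([0,T]; Ḣ^α(𝕋))`. -/
def MemCHdot (T α : ℝ) (u : ℝ → ℝ → ℝ) : Prop :=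
  (∀ t ∈ Icc 0 T, MemHdot α (u t)) ∧
    ∀ t₀ ∈ Icc 0 T,
      Tendsto (fun t => hSq α (fun x => u t x - u t₀ x)) (𝓝[Icc 0 T] t₀) (𝓝 0)

/-! ### The thin film Stokes system -/

/-- The two driving mechanisms. -/
inductive Flow
  | gravity
  | capillary

/-- `ζ = 1` for gravity driven flow, `ζ = 3` for capillary driven flow. -/
def Flow.zeta : Flow → ℕ
  | gravity => 1
  | capillary => 3

/-- The sign in `𝒟 = ∂ₓ` (gravity driven flow) and `𝒟 = -∂ₓ³` (capillary driven flow), so that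
`𝒟 = sign · ∂ₓ^ζ`. -/
def Flow.sign : Flow → ℝ
  | gravity => 1
  | capillary => -1

/-- `(F + f)³ - F³`. -/
def cub (F f : ℝ) : ℝ := f ^ 3 + 3 * f ^ 2 * F + 3 * f * F ^ 2

/-- `(F + f)² (G + g) - F² G`. -/
def mix (F G f g : ℝ) : ℝ :=
  f ^ 2 * g + 2 * f * g * F + f ^ 2 * G + g * F ^ 2 + 2 * f * F * G

/-- The flux of the first equation, at the values `f, g` of the unknowns and `a = 𝒟f`, `b = 𝒟g`;
here `F, G` are the means of the initial layer thicknesses. -/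
def flux₁ (ρ F G f g a b : ℝ) : ℝ :=
  (2 * ρ * F ^ 3 + 3 * F ^ 2 * G) * a + (2 * F ^ 3 + 3 * F ^ 2 * G) * b
    + (3 * mix F G f g + 2 * ρ * cub F f) * a
    + (3 * mix F G f g + 2 * cub F f) * b

/-- The flux of the second equation. -/
def flux₂ (ρ μ F G f g a b : ℝ) : ℝ :=
  (2 * μ * G ^ 3 + 3 * ρ * F ^ 2 * G + 6 * F * G ^ 2) * a
    + (2 * μ * G ^ 3 + 3 * F ^ 2 * G + 6 * F * G ^ 2) * b
    + (2 * μ * cub G g + 3 * ρ * mix F G f g + 6 * mix G F g f) * a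
    + (2 * μ * cub G g + 3 * mix F G f g + 6 * mix G F g f) * b

/-- Test functions in `C_c^∞([0,T) × 𝕋)`, as restrictions of smooth functions on `ℝ × 𝕋`. -/
def IsTest (T : ℝ) (φ : ℝ → ℝ → ℝ) : Prop :=
  ContDiff ℝ ∞ (Function.uncurry φ) ∧ (∀ t, Function.Periodic (φ t) (2 * Real.pi)) ∧
    ∃ T' < T, ∀ t ≥ T', ∀ x, φ t x = 0

/-- The distributional form on `[0,T) × 𝕋` of `∂ₜ u = ∂ₓ J`, `u(0) = u₀`. -/
def WeakConservationLaw (T : ℝ) (u₀ : ℝ → ℝ) (u J : ℝ → ℝ → ℝ) : Prop :=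
  ∀ φ : ℝ → ℝ → ℝ, IsTest T φ →
    (∫ x in (-Real.pi)..Real.pi, u₀ x * φ 0 x)
      + (∫ t in (0 : ℝ)..T, ∫ x in (-Real.pi)..Real.pi, u t x * deriv (fun s => φ s x) t)
      = ∫ t in (0 : ℝ)..T, ∫ x in (-Real.pi)..Real.pi, J t x * deriv (φ t) x

/-- `(f, g)` is a weak solution on `[0,T)` of the system
`∂ₜ f = ∂ₓ (flux₁)`, `∂ₜ g = ∂ₓ (flux₂)` with initial datum `(f₀, g₀)`.  The functions `f, g` and
their weak derivatives `f', g'` of order `ζ` are integrable on `(0,T) × 𝕋`, that is,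
`f, g ∈ L¹(0,T; W^{ζ,1}(𝕋))`. -/
def IsWeakSolution (flow : Flow) (ρ μ F G T : ℝ) (f₀ g₀ : ℝ → ℝ) (f g : ℝ → ℝ → ℝ) : Prop :=
  (∀ t, Function.Periodic (f t) (2 * Real.pi)) ∧ (∀ t, Function.Periodic (g t) (2 * Real.pi)) ∧
  ∃ f' g' : ℝ → ℝ → ℝ,
    (∀ u ∈ ({f, g, f', g'} : Set (ℝ → ℝ → ℝ)),
      Integrable (Function.uncurry u) ((volume.restrict (Ioo 0 T)).prod torusMeasure)) ∧
    (∀ᵐ t ∂(volume.restrict (Ioo 0 T)),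
      HasWeakDeriv flow.zeta (f t) (f' t) ∧ HasWeakDeriv flow.zeta (g t) (g' t)) ∧
    (∀ J ∈ ({fun t x => flux₁ ρ F G (f t x) (g t x) (flow.sign * f' t x) (flow.sign * g' t x),
        fun t x => flux₂ ρ μ F G (f t x) (g t x) (flow.sign * f' t x) (flow.sign * g' t x)} :
          Set (ℝ → ℝ → ℝ)),
      Integrable (Function.uncurry J) ((volume.restrict (Ioo 0 T)).prod torusMeasure)) ∧
    WeakConservationLaw T f₀ f
      (fun t x => flux₁ ρ F G (f t x) (g t x) (flow.sign * f' t x) (flow.sign * g' t x)) ∧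
    WeakConservationLaw T g₀ g
      (fun t x => flux₂ ρ μ F G (f t x) (g t x) (flow.sign * f' t x) (flow.sign * g' t x))

/-- The regularity class
`L^∞([0,T]×𝕋) ∩ L^{(ζ+1)/ζ}(0,T; W^{ζ,∞}) ∩ L¹(0,T; C^{ζ+α}) ∩ 𝓜(0,T; W^{ζ+1,∞})
∩ L²(0,T; Ḣ^{(ζ+1)/2})` for all `α ∈ [0, 1/2)`. -/
def WeakRegularity (flow : Flow) (T : ℝ) (u : ℝ → ℝ → ℝ) : Prop :=
  MemLinfty T u ∧
  MemLqWinfty T (ENNReal.ofReal (((flow.zeta : ℝ) + 1) / flow.zeta)) flow.zeta u ∧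
  (∀ α : ℝ, 0 ≤ α → α < 1 / 2 → MemL1Holder T flow.zeta α u) ∧
  MemMeasWinfty T (flow.zeta + 1) u ∧
  MemL2Hdot T (((flow.zeta : ℝ) + 1) / 2) u

/-! ### The constants in the smallness conditions

In the following, `F = ⟨f₀⟩`, `G = ⟨g₀⟩` and `e = 𝓔₀(f̄₀, ḡ₀)`. -/

/-- The constant `Σ₁`. -/
def Sigma₁ (ρ μ F G e : ℝ) : ℝ :=
  2 * ρ * F ^ 3 + 3 * F ^ 2 * G * (1 - ρ) - (2 * μ * G ^ 3 + 6 * F * G ^ 2)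
    - e * ((78 + 20 * ρ + 14 * μ) * e ^ 2
        + (F * (36 * ρ + 84) + (81 + 30 * μ + 9 * ρ) * G) * e)
    - e * ((18 * μ + 18) * G ^ 2 + (18 * ρ + 18) * F ^ 2 + (12 * ρ + 60) * G * F)

/-- The constant `Σ₂`. -/
def Sigma₂ (ρ μ F G e : ℝ) : ℝ :=
  2 * μ * G ^ 3 + 6 * F * G ^ 2 - 2 * F ^ 3
    - e * ((14 * μ + 15 * ρ + 83) * e ^ 2
        + ((30 * μ + 6 * ρ + 84) * G + (96 + 24 * ρ) * F) * e)
    - e * ((18 * μ + 18) * G ^ 2 + (27 + 9 * ρ) * F ^ 2 + (6 * ρ + 66) * F * G)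

/-- The constants `𝒞₁` (gravity driven flow) and `𝒞₃` (capillary driven flow). -/
def scrC (flow : Flow) (ρ μ F G e : ℝ) : ℝ :=
  match flow with
  | .gravity =>
      1 / 2 * e ^ 2 * (23 + 5 * ρ + 4 * μ)
        + 1 / 2 * e * (F * (36 + 12 * ρ) + G * (33 + 3 * ρ + 4 * μ))
        + 1 / 2 * (F ^ 2 * (15 + 9 * ρ) + G ^ 2 * (12 + 12 * μ) + F * G * (42 + 6 * ρ))
  | .capillary =>
      e ^ 2 * (32 + 55 / 8 * ρ + 15 / 2 * μ)
        + e * (F * (66 + 18 * ρ) + G * (36 + 21 / 2 * ρ + 18 * μ))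
        + (F ^ 2 * (57 / 4 + 39 / 4 * ρ) + G ^ 2 * (27 / 2 + 15 / 2 * μ)
          + F * G * (81 / 2 + 15 / 2 * ρ))

end

end ThinFilm

/-!
# Global weak solutions of the two-phase thin film Stokes system

Let `f`, `g` be the fluctuations of the film thicknesses, with the Wiener norm `‖f‖ = ∑ |f̂(k)|`.  The
fluxes are `J = (A + N(f, g)) (𝒟f, 𝒟g)` with a constant matrix `A` and a matrix `N` of polynomials without
constant term, and the spatial derivative of the linear part multiplies the mode `k` by `-|k|^{ζ+1} A`.

**Decay of the Wiener norm.**  Expanding `N` in the Wiener algebra, with `Maj` recording a bound for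
the norm together with a bound for the norm of the derivative, and interpolating the products of
intermediate derivatives (`Supp.wt_mul_wt`), the nonlinear terms are bounded by multiples of the norms
of `f` and `g` with weight `|k|^{ζ+1}`.  The quantities `Σ₁` and `Σ₂` are lower bounds for what remains
of the columns of `A` after the off-diagonal entry and the nonlinear terms have been subtracted from the
diagonal entry (`wt_nl_le`).  Hence, for `Σ₁, Σ₂ > 0`, an explicit Euler step decreases `‖f‖ + ‖g‖`
(`norm_euler_step_le`).  This gives exponential decay, and it gives a bound for the weighted norm in
`L¹` in time (`integral_wt_le`).

**The Sobolev energy.**  The same dominance of the diagonal shows that a suitably weighted sum of the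
energies of order `(ζ + 1) / 2` is dissipated, up to a Gronwall factor that is the weighted Wiener norm
and therefore integrable (`exists_energy_dissipation`, `exists_energy_bound`).  The energy bound holds
even if every mode is evaluated at a time of its own, so the tails of the energy series are small
uniformly in time; that is what makes the limit continuous with values in the Sobolev space.

**Compactness.**  The estimates hold for the Galerkin truncation, an ordinary differential equation on
the Wiener algebra (`exists_isGalerkin`), uniformly in the number of modes.  The modes are
equicontinuous in time (`exists_equicontinuous`), and the energy bound controls the tails of the
absolutely convergent Fourier series, so that a subsequence converges in the Wiener norm at every time
(`exists_path`), and the equations of the modes pass to the limit (`exists_solution`).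

**Physical space.**  Summing the equations of the modes against the Fourier coefficients of a test
function gives the weak formulation (`weakConservationLaw`).  Membership in the function spaces follows
by mapping sequences in the Wiener algebra to these spaces by continuous linear synthesis operators
(`synth`), under which Bochner integrability is preserved.  Decay of the lower Sobolev energies follows
from the decay of the Wiener norm and the energy bound by splitting the frequencies (`hSq_le_exp`).
-/

namespace ThinFilm

noncomputable section

/-! ### Characters -/

/-- The character `x ↦ e^{ikx}`. -/
def chr (k : ℤ) (x : ℝ) : ℂ := Complex.exp (Complex.I * k * x)

lemma norm_chr (k : ℤ) (x : ℝ) : ‖chr k x‖ = 1 := by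
  have : Complex.I * k * x = ((k * x : ℝ) : ℂ) * Complex.I := by push_cast; ring
  rw [chr, this, Complex.norm_exp_ofReal_mul_I]

lemma chr_add (j k : ℤ) (x : ℝ) : chr (j + k) x = chr j x * chr k x := by
  rw [chr, chr, chr, ← Complex.exp_add]; congr 1; push_cast; ring

@[simp] lemma chr_zero (x : ℝ) : chr 0 x = 1 := by simp [chr]

lemma chr_neg (k : ℤ) (x : ℝ) : chr (-k) x = (starRingEnd ℂ) (chr k x) := by
  rw [chr, chr, ← Complex.exp_conj]; congr 1; simp

lemma hasDerivAt_chr (k : ℤ) (x : ℝ) : HasDerivAt (chr k) (Complex.I * k * chr k x) x := by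
  have h : HasDerivAt (fun y : ℝ => Complex.I * k * (y : ℂ)) (Complex.I * k) x := by
    simpa using (Complex.ofRealCLM.hasDerivAt (x := x)).const_mul (Complex.I * (k : ℂ))
  rw [mul_comm (Complex.I * (k : ℂ))]
  exact h.cexp

lemma contDiff_chr (k : ℤ) {n : WithTop ℕ∞} : ContDiff ℝ n (chr k) :=
  ((contDiff_const.mul Complex.ofRealCLM.contDiff).cexp :
    ContDiff ℝ n fun y : ℝ => Complex.exp (Complex.I * k * Complex.ofRealCLM y))

@[fun_prop] lemma continuous_chr (k : ℤ) : Continuous (chr k) := (contDiff_chr k (n := 0)).continuous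

lemma chr_periodic (k : ℤ) : Function.Periodic (chr k) (2 * Real.pi) := by
  intro x
  rw [chr, chr]
  have : Complex.I * k * ((x + 2 * Real.pi : ℝ) : ℂ)
      = Complex.I * k * x + k * (2 * Real.pi * Complex.I) := by push_cast; ring
  rw [this, Complex.exp_add, Complex.exp_int_mul_two_pi_mul_I, mul_one]

lemma integral_chr (k : ℤ) :
    ∫ x in (-Real.pi)..Real.pi, chr k x = if k = 0 then (2 * Real.pi : ℂ) else 0 := by
  split_ifs with h
  · subst h; simp; ring
  · have hk : Complex.I * (k : ℂ) ≠ 0 := mul_ne_zero Complex.I_ne_zero (by exact_mod_cast h)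
    have : ∀ x ∈ uIcc (-Real.pi) Real.pi,
        HasDerivAt (fun y => (Complex.I * (k : ℂ))⁻¹ * chr k y) (chr k x) x := by
      intro x _
      have := (hasDerivAt_chr k x).const_mul (Complex.I * (k : ℂ))⁻¹
      rwa [← mul_assoc, inv_mul_cancel₀ hk, one_mul] at this
    rw [intervalIntegral.integral_eq_sub_of_hasDerivAt this
      ((continuous_chr k).intervalIntegrable _ _)]
    have hp := chr_periodic k (-Real.pi)
    rw [show -Real.pi + 2 * Real.pi = Real.pi by ring] at hp
    rw [hp, sub_self]

/-! ### The Wiener algebra -/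

/-- The Wiener algebra `A(𝕋)`: absolutely summable families of Fourier coefficients, with the
`ℓ¹` norm and convolution as multiplication. -/
def Wiener : Type := lp (fun _ : ℤ => ℂ) 1

namespace Wiener

instance : NormedAddCommGroup Wiener := inferInstanceAs (NormedAddCommGroup (lp (fun _ : ℤ => ℂ) 1))
instance : NormedSpace ℂ Wiener := inferInstanceAs (NormedSpace ℂ (lp (fun _ : ℤ => ℂ) 1))
instance : CompleteSpace Wiener := inferInstanceAs (CompleteSpace (lp (fun _ : ℤ => ℂ) 1))

/-- The `k`-th Fourier coefficient. -/
def coeff (u : Wiener) (k : ℤ) : ℂ := (show lp (fun _ : ℤ => ℂ) 1 from u) k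

instance : CoeFun Wiener fun _ => ℤ → ℂ := ⟨coeff⟩

/-- The element of the Wiener algebra with given absolutely summable coefficients. -/
def of (c : ℤ → ℂ) (h : Summable fun k => ‖c k‖) : Wiener :=
  ⟨c, memℓp_gen (by simpa using h)⟩

@[simp] lemma of_apply (c : ℤ → ℂ) (h : Summable fun k => ‖c k‖) (k : ℤ) : of c h k = c k := rfl

@[ext] lemma ext {u v : Wiener} (h : ∀ k, u k = v k) : u = v := Subtype.ext (funext h)

@[simp] lemma add_apply (u v : Wiener) (k : ℤ) : (u + v) k = u k + v k := rfl
@[simp] lemma sub_apply (u v : Wiener) (k : ℤ) : (u - v) k = u k - v k := rfl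
@[simp] lemma zero_apply (k : ℤ) : (0 : Wiener) k = 0 := rfl
@[simp] lemma smul_apply (c : ℂ) (u : Wiener) (k : ℤ) : (c • u) k = c * u k := rfl
@[simp] lemma real_smul_apply (c : ℝ) (u : Wiener) (k : ℤ) : (c • u) k = c * u k := rfl

lemma norm_def (u : Wiener) : ‖u‖ = ∑' k, ‖u k‖ := by
  have := lp.norm_eq_tsum_rpow (p := 1) (by norm_num) (show lp (fun _ : ℤ => ℂ) 1 from u)
  simp only [ENNReal.toReal_one, Real.rpow_one, div_one] at this
  exact this

lemma summable_norm (u : Wiener) : Summable fun k => ‖u k‖ := by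
  have := (lp.memℓp (show lp (fun _ : ℤ => ℂ) 1 from u)).summable (by norm_num)
  simp only [ENNReal.toReal_one, Real.rpow_one] at this
  exact this

lemma sum_norm_le (u : Wiener) (S : Finset ℤ) : ∑ k ∈ S, ‖u k‖ ≤ ‖u‖ := by
  rw [norm_def]; exact u.summable_norm.sum_le_tsum S fun _ _ => norm_nonneg _

lemma norm_apply_le (u : Wiener) (k : ℤ) : ‖u k‖ ≤ ‖u‖ := by
  simpa using u.sum_norm_le {k}

/-- The `k`-th coefficient as a continuous linear functional. -/
def coeffL (k : ℤ) : Wiener →L[ℂ] ℂ :=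
  LinearMap.mkContinuous ⟨⟨fun u => u k, fun _ _ => rfl⟩, fun _ _ => rfl⟩ 1
    fun u => by rw [one_mul]; exact u.norm_apply_le k

@[simp] lemma coeffL_apply (k : ℤ) (u : Wiener) : coeffL k u = u k := rfl

/-- The function with given Fourier coefficients. -/
def ev (u : Wiener) (x : ℝ) : ℂ := ∑' k, u k * chr k x

lemma summable_norm_ev (u : Wiener) (x : ℝ) : Summable fun k => ‖u k * chr k x‖ := by
  simpa [norm_chr] using u.summable_norm

lemma summable_ev (u : Wiener) (x : ℝ) : Summable fun k => u k * chr k x :=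
  (u.summable_norm_ev x).of_norm

lemma norm_ev_le (u : Wiener) (x : ℝ) : ‖ev u x‖ ≤ ‖u‖ := by
  rw [norm_def]
  refine (norm_tsum_le_tsum_norm (u.summable_norm_ev x)).trans_eq ?_
  simp [norm_chr]

@[simp] lemma ev_add (u v : Wiener) (x : ℝ) : ev (u + v) x = ev u x + ev v x := by
  rw [ev, ev, ev, ← (u.summable_ev x).tsum_add (v.summable_ev x)]
  simp [add_mul]

@[simp] lemma ev_smul (c : ℂ) (u : Wiener) (x : ℝ) : ev (c • u) x = c * ev u x := by
  rw [ev, ev, ← tsum_mul_left]; simp [mul_assoc]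

lemma continuous_ev (u : Wiener) : Continuous (ev u) :=
  continuous_tsum (fun k => by fun_prop) u.summable_norm fun k x => by simp [norm_chr]

lemma ev_periodic (u : Wiener) : Function.Periodic (ev u) (2 * Real.pi) := fun x => by
  simp only [ev, chr_periodic _ x]

/-- Integration of a function in the Wiener algebra against a continuous function, term by term. -/
lemma hasSum_integral_ev_mul (u : Wiener) {ψ : ℝ → ℂ} (hψ : Continuous ψ) :
    HasSum (fun k => u k * ∫ x in (-Real.pi)..Real.pi, chr k x * ψ x)
      (∫ x in (-Real.pi)..Real.pi, ev u x * ψ x) := by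
  obtain ⟨C, hC⟩ := (isCompact_uIcc (a := -Real.pi) (b := Real.pi)).exists_bound_of_continuousOn
    hψ.continuousOn
  have := intervalIntegral.hasSum_integral_of_dominated_convergence
    (μ := volume) (a := -Real.pi) (b := Real.pi) (F := fun k x => u k * chr k x * ψ x)
    (f := fun x => ev u x * ψ x) (fun k _ => ‖u k‖ * C)
    (fun k => (by fun_prop : Continuous fun x => u k * chr k x * ψ x).aestronglyMeasurable)
    (fun k => Eventually.of_forall fun x hx => by
      rw [norm_mul, norm_mul, norm_chr, mul_one]
      exact mul_le_mul_of_nonneg_left (hC x (uIoc_subset_uIcc hx)) (norm_nonneg _))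
    (Eventually.of_forall fun x _ => u.summable_norm.mul_right C)
    (by simp)
    (Eventually.of_forall fun x _ => (u.summable_ev x).hasSum.mul_right (ψ x))
  simpa only [mul_assoc, intervalIntegral.integral_const_mul] using this

lemma integral_ev_mul_chr (u : Wiener) (j : ℤ) :
    ∫ x in (-Real.pi)..Real.pi, ev u x * chr (-j) x = 2 * Real.pi * u j := by
  have h := u.hasSum_integral_ev_mul (continuous_chr (-j))
  have h2 : ∀ k, u k * ∫ x in (-Real.pi)..Real.pi, chr k x * chr (-j) x
      = if k = j then 2 * Real.pi * u j else 0 := by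
    intro k
    simp_rw [← chr_add, integral_chr]
    by_cases hk : k = j
    · subst hk; simp; ring
    · have : k + -j ≠ 0 := by omega
      simp [hk, this]
  simp_rw [h2] at h
  exact h.unique (hasSum_ite_eq j _)

lemma ev_injective {u v : Wiener} (h : ∀ x, ev u x = ev v x) : u = v := by
  ext j
  have := integral_ev_mul_chr u j
  rw [show (fun x => ev u x * chr (-j) x) = fun x => ev v x * chr (-j) x by
    funext x; rw [h x], integral_ev_mul_chr] at this
  have hpi : (2 * Real.pi : ℂ) ≠ 0 := by
    exact_mod_cast (by positivity : (2 * Real.pi : ℝ) ≠ 0)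
  exact (mul_left_cancel₀ hpi this).symm

/-- The bijection `(k, j) ↦ (j, k - j)` behind convolutions. -/
def convEquiv : ℤ × ℤ ≃ ℤ × ℤ where
  toFun p := (p.2, p.1 - p.2)
  invFun p := (p.1 + p.2, p.1)
  left_inv p := by ext <;> simp
  right_inv p := by ext <;> simp

lemma summable_conv {p q : ℤ → ℝ} (hp : Summable p) (hq : Summable q) (hp0 : 0 ≤ p) (hq0 : 0 ≤ q) :
    Summable fun x : ℤ × ℤ => p x.2 * q (x.1 - x.2) :=
  (convEquiv.summable_iff (f := fun x : ℤ × ℤ => p x.1 * q x.2)).2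
    (hp.mul_of_nonneg hq hp0 hq0)

lemma hasSum_conv {p q : ℤ → ℝ} (hp : Summable p) (hq : Summable q) (hp0 : 0 ≤ p) (hq0 : 0 ≤ q) :
    HasSum (fun k => ∑' j, p j * q (k - j)) ((∑' k, p k) * ∑' k, q k) := by
  have h1 := hp.mul_of_nonneg hq hp0 hq0
  have h2 : (∑' k, p k) * ∑' k, q k = ∑' x : ℤ × ℤ, p x.2 * q (x.1 - x.2) := by
    rw [hp.tsum_mul_tsum hq h1]
    exact (convEquiv.tsum_eq (fun x : ℤ × ℤ => p x.1 * q x.2)).symm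
  rw [h2]
  have h3 := summable_conv hp hq hp0 hq0
  exact h3.hasSum.prod_fiberwise fun k => (h3.prod_factor k).hasSum

lemma summable_conv_norm (u v : Wiener) (k : ℤ) : Summable fun j => ‖u j‖ * ‖v (k - j)‖ :=
  (summable_conv u.summable_norm v.summable_norm (fun _ => norm_nonneg _)
    (fun _ => norm_nonneg _)).prod_factor k

lemma norm_conv_le (u v : Wiener) (k : ℤ) :
    ‖∑' j, u j * v (k - j)‖ ≤ ∑' j, ‖u j‖ * ‖v (k - j)‖ := by
  have := summable_conv_norm u v k
  simp_rw [← norm_mul] at this ⊢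
  exact norm_tsum_le_tsum_norm this

instance : Mul Wiener := ⟨fun u v => of (fun k => ∑' j, u j * v (k - j))
  (.of_nonneg_of_le (fun _ => norm_nonneg _) (norm_conv_le u v)
    (hasSum_conv u.summable_norm v.summable_norm (fun _ => norm_nonneg _)
      (fun _ => norm_nonneg _)).summable)⟩

lemma mul_apply (u v : Wiener) (k : ℤ) : (u * v) k = ∑' j, u j * v (k - j) := rfl

instance : One Wiener := ⟨of (fun k => if k = 0 then 1 else 0)
  (summable_of_ne_finset_zero (s := {0}) fun k hk => by simp_all)⟩

lemma one_apply (k : ℤ) : (1 : Wiener) k = if k = 0 then 1 else 0 := rfl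

@[simp] lemma ev_one (x : ℝ) : ev 1 x = 1 := by
  rw [ev, tsum_eq_single 0 (fun k hk => by simp [one_apply, hk])]; simp [one_apply]

lemma tsum_conv_complex {p q : ℤ → ℂ} (hp : Summable fun k => ‖p k‖)
    (hq : Summable fun k => ‖q k‖) :
    ∑' k, ∑' j, p j * q (k - j) = (∑' k, p k) * ∑' k, q k := by
  have h1 : Summable fun x : ℤ × ℤ => p x.1 * q x.2 := summable_mul_of_summable_norm hp hq
  have h2 : Summable fun x : ℤ × ℤ => p x.2 * q (x.1 - x.2) :=
    (convEquiv.summable_iff (f := fun x : ℤ × ℤ => p x.1 * q x.2)).2 h1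
  rw [tsum_mul_tsum_of_summable_norm hp hq, ← h2.tsum_prod' fun k => h2.prod_factor k]
  exact convEquiv.tsum_eq (fun x : ℤ × ℤ => p x.1 * q x.2)

@[simp] lemma ev_mul (u v : Wiener) (x : ℝ) : ev (u * v) x = ev u x * ev v x := by
  rw [ev, ev, ev, ← tsum_conv_complex (u.summable_norm_ev x) (v.summable_norm_ev x)]
  refine tsum_congr fun k => ?_
  rw [mul_apply, ← tsum_mul_right]
  refine tsum_congr fun j => ?_
  have : chr k x = chr j x * chr (k - j) x := by rw [← chr_add]; congr 1; ring
  rw [this]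
  ring

instance : NormedCommRing Wiener :=
  { (inferInstance : NormedAddCommGroup Wiener) with
    left_distrib := fun u v w => ev_injective fun x => by simp [mul_add]
    right_distrib := fun u v w => ev_injective fun x => by simp [add_mul]
    zero_mul := fun u => by ext k; simp [mul_apply]
    mul_zero := fun u => by ext k; simp [mul_apply]
    mul_assoc := fun u v w => ev_injective fun x => by simp [mul_assoc]
    one_mul := fun u => ev_injective fun x => by simp
    mul_one := fun u => ev_injective fun x => by simp
    mul_comm := fun u v => ev_injective fun x => by simp [mul_comm]
    norm_mul_le := fun u v => by
      have h := hasSum_conv u.summable_norm v.summable_norm (fun _ => norm_nonneg _)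
        (fun _ => norm_nonneg _)
      rw [norm_def, norm_def u, norm_def v, ← h.tsum_eq]
      exact (u * v).summable_norm.tsum_le_tsum (norm_conv_le u v) h.summable }

instance : NormedAlgebra ℂ Wiener :=
  { (inferInstance : NormedSpace ℂ Wiener),
    Algebra.ofModule (fun c u v => ev_injective fun x => by simp [mul_assoc])
      (fun c u v => ev_injective fun x => by simp; ring) with
    norm_smul_le := fun c u => (norm_smul_le c u) }

/-- Evaluation is a ring homomorphism. -/
def evHom (x : ℝ) : Wiener →+* ℂ where
  toFun u := ev u x
  map_one' := ev_one x
  map_mul' u v := ev_mul u v x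
  map_zero' := by simp [ev]
  map_add' u v := ev_add u v x

/-- The constant functions. -/
def const : ℝ →+* Wiener := (algebraMap ℂ Wiener).comp Complex.ofRealHom

lemma const_eq (c : ℝ) : const c = (c : ℂ) • (1 : Wiener) := Algebra.algebraMap_eq_smul_one _

lemma const_mul_apply (c : ℝ) (u : Wiener) (k : ℤ) : (const c * u) k = c * u k := by
  rw [const_eq, smul_mul_assoc, one_mul, smul_apply]

@[simp] lemma ev_const (c x : ℝ) : ev (const c) x = c := by
  rw [const_eq, ev_smul, ev_one, mul_one]

end Wiener

/-! ### Truncated Fourier multipliers and weighted norms -/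

/-- The frequencies `|k| ≤ n`. -/
def modes (n : ℕ) : Finset ℤ := Finset.Icc (-n) n

lemma mem_modes {n : ℕ} {k : ℤ} : k ∈ modes n ↔ |k| ≤ n := by
  rw [modes, Finset.mem_Icc, abs_le]

lemma modes_mono {n N : ℕ} (h : n ≤ N) : modes n ⊆ modes N := fun k hk => by
  rw [mem_modes] at *; exact hk.trans (by exact_mod_cast h)

lemma abs_le_of_mem_modes {n : ℕ} {k : ℤ} (h : k ∈ modes n) : |(k : ℝ)| ≤ n := by
  exact_mod_cast mem_modes.1 h

lemma natAbs_mem_modes (k : ℤ) : k ∈ modes k.natAbs := mem_modes.2 (by simp)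

lemma tendsto_modes : Tendsto modes atTop atTop := by
  refine tendsto_atTop_finset_of_monotone (fun _ _ h => modes_mono h) fun k =>
    ⟨k.natAbs, natAbs_mem_modes k⟩

namespace Wiener

/-- The Fourier multiplier with symbol `c`, truncated to the frequencies `|k| ≤ n`. -/
def cut (n : ℕ) (c : ℤ → ℂ) : Wiener →L[ℂ] Wiener :=
  have key : ∀ (u : Wiener) (k : ℤ), ‖if k ∈ modes n then c k * u k else 0‖
      ≤ (∑ k ∈ modes n, ‖c k‖) * ‖u k‖ := fun u k => by
    split_ifs with h
    · rw [norm_mul]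
      exact mul_le_mul_of_nonneg_right
        (Finset.single_le_sum (f := fun k => ‖c k‖) (fun _ _ => norm_nonneg _) h) (norm_nonneg _)
    · rw [norm_zero]; positivity
  LinearMap.mkContinuous
    { toFun := fun u => of (fun k => if k ∈ modes n then c k * u k else 0)
        (.of_nonneg_of_le (fun _ => norm_nonneg _) (key u) (u.summable_norm.mul_left _))
      map_add' := fun u v => by
        ext k; simp only [of_apply, add_apply]; split_ifs <;> ring
      map_smul' := fun a u => by
        ext k; simp only [of_apply, smul_apply, RingHom.id_apply]; split_ifs <;> ring }
    (∑ k ∈ modes n, ‖c k‖) fun u => by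
      rw [norm_def, norm_def, ← tsum_mul_left]
      exact (Wiener.summable_norm _).tsum_le_tsum (key u) (u.summable_norm.mul_left _)

lemma cut_apply (n : ℕ) (c : ℤ → ℂ) (u : Wiener) (k : ℤ) :
    cut n c u k = if k ∈ modes n then c k * u k else 0 := rfl

/-- The coefficients of `u` vanish at the frequencies `|k| > n`. -/
def Supp (n : ℕ) (u : Wiener) : Prop := ∀ k ∉ modes n, u k = 0

lemma supp_cut (n : ℕ) (c : ℤ → ℂ) (u : Wiener) : Supp n (cut n c u) := fun k hk => by
  simp [cut_apply, hk]

lemma Supp.norm_eq {n : ℕ} {u : Wiener} (h : Supp n u) : ‖u‖ = ∑ k ∈ modes n, ‖u k‖ := by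
  rw [norm_def, tsum_eq_sum fun k hk => by simp [h k hk]]

/-- `∑ₖ |k|^s |û(k)| < ∞`. -/
def WS (s : ℕ) (u : Wiener) : Prop := Summable fun k : ℤ => |(k : ℝ)| ^ s * ‖u k‖

/-- The norm `∑ₖ |k|^s |û(k)|`. -/
def wt (s : ℕ) (u : Wiener) : ℝ := ∑' k : ℤ, |(k : ℝ)| ^ s * ‖u k‖

lemma wt_nonneg (s : ℕ) (u : Wiener) : 0 ≤ wt s u := tsum_nonneg fun _ => by positivity

lemma Supp.ws {n : ℕ} {u : Wiener} (h : Supp n u) (s : ℕ) : WS s u :=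
  summable_of_ne_finset_zero (s := modes n) fun k hk => by simp [h k hk]

lemma Supp.wt_eq {n : ℕ} {u : Wiener} (h : Supp n u) (s : ℕ) :
    wt s u = ∑ k ∈ modes n, |(k : ℝ)| ^ s * ‖u k‖ :=
  tsum_eq_sum fun k hk => by simp [h k hk]

/-- A pair of majorants: `p` for the norm of `u` and `q` for the norm `∑ₖ |k| |û(k)|` of its
derivative.  Such pairs multiply like the dual numbers `p + ε q`. -/
structure Maj (u : Wiener) (p q : ℝ) : Prop where
  norm_le : ‖u‖ ≤ p
  ws : WS 1 u
  wt_le : wt 1 u ≤ q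

namespace Maj

variable {u v : Wiener} {p q p' q' : ℝ}

lemma nonneg (h : Maj u p q) : 0 ≤ p := (norm_nonneg u).trans h.norm_le
lemma nonneg' (h : Maj u p q) : 0 ≤ q := (wt_nonneg 1 u).trans h.wt_le

lemma mono (h : Maj u p q) (hp : p ≤ p') (hq : q ≤ q') : Maj u p' q' :=
  ⟨h.norm_le.trans hp, h.ws, h.wt_le.trans hq⟩

lemma congr (h : Maj u p q) (huv : u = v) (hp : p = p') (hq : q = q') : Maj v p' q' := by
  subst huv hp hq; exact h

lemma add (h : Maj u p q) (h' : Maj v p' q') : Maj (u + v) (p + p') (q + q') := by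
  have hb : ∀ k : ℤ, |(k : ℝ)| ^ 1 * ‖(u + v) k‖
      ≤ |(k : ℝ)| ^ 1 * ‖u k‖ + |(k : ℝ)| ^ 1 * ‖v k‖ := fun k => by
    rw [← mul_add]; exact mul_le_mul_of_nonneg_left (norm_add_le _ _) (by positivity)
  have hs : WS 1 (u + v) := .of_nonneg_of_le (fun k => by positivity) hb (h.ws.add h'.ws)
  refine ⟨(norm_add_le _ _).trans (add_le_add h.norm_le h'.norm_le), hs, ?_⟩
  calc wt 1 (u + v) ≤ wt 1 u + wt 1 v := by
        rw [wt, wt, wt, ← h.ws.tsum_add h'.ws]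
        exact hs.tsum_le_tsum hb (h.ws.add h'.ws)
    _ ≤ q + q' := add_le_add h.wt_le h'.wt_le

lemma mul (h : Maj u p q) (h' : Maj v p' q') : Maj (u * v) (p * p') (q * p' + p * q') := by
  have h1 := hasSum_conv h.ws v.summable_norm (fun k => by positivity) (fun k => by positivity)
  have h2 := hasSum_conv u.summable_norm h'.ws (fun k => by positivity) (fun k => by positivity)
  have s1 := fun k => (summable_conv h.ws v.summable_norm (fun k => by positivity)
    (fun k => by positivity)).prod_factor k
  have s2 := fun k => (summable_conv u.summable_norm h'.ws (fun k => by positivity)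
    (fun k => by positivity)).prod_factor k
  have h3 := h1.add h2
  have hb : ∀ k : ℤ, |(k : ℝ)| ^ 1 * ‖(u * v) k‖
      ≤ (∑' j : ℤ, |(j : ℝ)| ^ 1 * ‖u j‖ * ‖v (k - j)‖)
        + ∑' j : ℤ, ‖u j‖ * (|((k - j : ℤ) : ℝ)| ^ 1 * ‖v (k - j)‖) := fun k => by
    rw [← (s1 k).tsum_add (s2 k)]
    refine (mul_le_mul_of_nonneg_left (norm_conv_le u v k) (by positivity)).trans ?_
    rw [← tsum_mul_left]
    refine ((summable_conv_norm u v k).mul_left _).tsum_le_tsum (fun j => ?_)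
      ((s1 k).add (s2 k))
    have : |(k : ℝ)| ≤ |(j : ℝ)| + |((k - j : ℤ) : ℝ)| := by
      have := abs_add_le (j : ℝ) ((k - j : ℤ) : ℝ)
      push_cast at this ⊢
      simpa using this
    calc |(k : ℝ)| ^ 1 * (‖u j‖ * ‖v (k - j)‖)
        ≤ (|(j : ℝ)| + |((k - j : ℤ) : ℝ)|) * (‖u j‖ * ‖v (k - j)‖) := by
          rw [pow_one]; exact mul_le_mul_of_nonneg_right this (by positivity)
      _ = _ := by ring
  have hs : WS 1 (u * v) := .of_nonneg_of_le (fun k => by positivity) hb h3.summable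
  refine ⟨(norm_mul_le u v).trans (mul_le_mul h.norm_le h'.norm_le (norm_nonneg _) h.nonneg),
    hs, ?_⟩
  calc wt 1 (u * v) ≤ wt 1 u * ‖v‖ + ‖u‖ * wt 1 v := by
        rw [norm_def, norm_def, wt, wt, wt, ← h3.tsum_eq]
        exact hs.tsum_le_tsum hb h3.summable
    _ ≤ q * p' + p * q' := add_le_add
        (mul_le_mul h.wt_le h'.norm_le (norm_nonneg _) h.nonneg')
        (mul_le_mul h.norm_le h'.wt_le (wt_nonneg _ _) h.nonneg)

lemma const_mul {c : ℝ} (hc : 0 ≤ c) (h : Maj u p q) : Maj (const c * u) (c * p) (c * q) := by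
  have he : ∀ k : ℤ, |(k : ℝ)| ^ 1 * ‖(const c * u) k‖ = c * (|(k : ℝ)| ^ 1 * ‖u k‖) := fun k => by
    rw [const_mul_apply, norm_mul, Complex.norm_real, Real.norm_of_nonneg hc]; ring
  refine ⟨?_, (h.ws.mul_left c).congr fun k => (he k).symm, ?_⟩
  · rw [const_eq, smul_mul_assoc, one_mul, norm_smul, Complex.norm_real, Real.norm_of_nonneg hc]
    exact mul_le_mul_of_nonneg_left h.norm_le hc
  · rw [wt]; simp_rw [he]; rw [tsum_mul_left]
    exact mul_le_mul_of_nonneg_left h.wt_le hc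

end Maj

lemma Supp.maj {n : ℕ} {u : Wiener} (h : Supp n u) : Maj u ‖u‖ (wt 1 u) := ⟨le_rfl, h.ws 1, le_rfl⟩

end Wiener

/-! ### The nonlinearity -/

section Polynomials

variable {R S : Type*} [CommRing R] [CommRing S]

/-- `(F + f)³ - F³` in a commutative ring. -/
def cubic (F f : R) : R := f ^ 3 + 3 * f ^ 2 * F + 3 * f * F ^ 2

/-- `(F + f)² (G + g) - F² G` in a commutative ring. -/
def mixed (F G f g : R) : R :=
  f ^ 2 * g + 2 * f * g * F + f ^ 2 * G + g * F ^ 2 + 2 * f * F * G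

/-- The nonlinear part of the coefficient of `𝒟f` in the first flux. -/
def n₁₁ (ρ F G f g : R) : R := 3 * mixed F G f g + 2 * ρ * cubic F f

/-- The nonlinear part of the coefficient of `𝒟g` in the first flux. -/
def n₁₂ (F G f g : R) : R := 3 * mixed F G f g + 2 * cubic F f

/-- The nonlinear part of the coefficient of `𝒟f` in the second flux. -/
def n₂₁ (ρ μ F G f g : R) : R :=
  2 * μ * cubic G g + 3 * ρ * mixed F G f g + 6 * mixed G F g f

/-- The nonlinear part of the coefficient of `𝒟g` in the second flux. -/
def n₂₂ (μ F G f g : R) : R := 2 * μ * cubic G g + 3 * mixed F G f g + 6 * mixed G F g f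

lemma map_n₁₁ (φ : R →+* S) (ρ F G f g : R) :
    φ (n₁₁ ρ F G f g) = n₁₁ (φ ρ) (φ F) (φ G) (φ f) (φ g) := by
  simp [n₁₁, mixed, cubic, map_ofNat]

lemma map_n₁₂ (φ : R →+* S) (F G f g : R) :
    φ (n₁₂ F G f g) = n₁₂ (φ F) (φ G) (φ f) (φ g) := by
  simp [n₁₂, mixed, cubic, map_ofNat]

lemma map_n₂₁ (φ : R →+* S) (ρ μ F G f g : R) :
    φ (n₂₁ ρ μ F G f g) = n₂₁ (φ ρ) (φ μ) (φ F) (φ G) (φ f) (φ g) := by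
  simp [n₂₁, mixed, cubic, map_ofNat]

lemma map_n₂₂ (φ : R →+* S) (μ F G f g : R) :
    φ (n₂₂ μ F G f g) = n₂₂ (φ μ) (φ F) (φ G) (φ f) (φ g) := by
  simp [n₂₂, mixed, cubic, map_ofNat]

end Polynomials

/-- The directional derivative of `cubic F` at `f` in the direction `f'`. -/
def dcubic (F f f' : ℝ) : ℝ := (3 * f ^ 2 + 6 * f * F + 3 * F ^ 2) * f'

/-- The directional derivative of `mixed F G` at `(f, g)` in the direction `(f', g')`. -/
def dmixed (F G f g f' g' : ℝ) : ℝ :=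
  (2 * f * g + 2 * g * F + 2 * f * G + 2 * F * G) * f' + (f ^ 2 + 2 * f * F + F ^ 2) * g'

/-- The parameters of the system: the physical constants and the mean thicknesses. -/
structure Par where
  (ρ μ F G : ℝ)

namespace Par

variable (P : Par)

/-- The coefficient of `𝒟f` in the linear part of the first flux. -/
def a₁₁ : ℝ := 2 * P.ρ * P.F ^ 3 + 3 * P.F ^ 2 * P.G
/-- The coefficient of `𝒟g` in the linear part of the first flux. -/
def a₁₂ : ℝ := 2 * P.F ^ 3 + 3 * P.F ^ 2 * P.G
/-- The coefficient of `𝒟f` in the linear part of the second flux. -/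
def a₂₁ : ℝ := 2 * P.μ * P.G ^ 3 + 3 * P.ρ * P.F ^ 2 * P.G + 6 * P.F * P.G ^ 2
/-- The coefficient of `𝒟g` in the linear part of the second flux. -/
def a₂₂ : ℝ := 2 * P.μ * P.G ^ 3 + 3 * P.F ^ 2 * P.G + 6 * P.F * P.G ^ 2

/-- Positivity of the parameters. -/
structure Pos : Prop where
  ρ : 0 < P.ρ
  μ : 0 < P.μ
  F : 0 < P.F
  G : 0 < P.G

open Wiener

/-- The polynomial `n₁₁` on the Wiener algebra, with the parameters of the system. -/
def w₁₁ (f g : Wiener) : Wiener := n₁₁ (const P.ρ) (const P.F) (const P.G) f g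
/-- The polynomial `n₁₂` on the Wiener algebra. -/
def w₁₂ (f g : Wiener) : Wiener := n₁₂ (const P.F) (const P.G) f g
/-- The polynomial `n₂₁` on the Wiener algebra. -/
def w₂₁ (f g : Wiener) : Wiener :=
  n₂₁ (const P.ρ) (const P.μ) (const P.F) (const P.G) f g
/-- The polynomial `n₂₂` on the Wiener algebra. -/
def w₂₂ (f g : Wiener) : Wiener := n₂₂ (const P.μ) (const P.F) (const P.G) f g

/-- The nonlinear part of the first flux; `a` and `b` stand for `𝒟f` and `𝒟g`. -/
def nl₁ (f g a b : Wiener) : Wiener := P.w₁₁ f g * a + P.w₁₂ f g * b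
/-- The nonlinear part of the second flux. -/
def nl₂ (f g a b : Wiener) : Wiener := P.w₂₁ f g * a + P.w₂₂ f g * b

/-- The first flux; `a` and `b` stand for `𝒟f` and `𝒟g`. -/
def J₁ (f g a b : Wiener) : Wiener := const P.a₁₁ * a + const P.a₁₂ * b + P.nl₁ f g a b
/-- The second flux. -/
def J₂ (f g a b : Wiener) : Wiener := const P.a₂₁ * a + const P.a₂₂ * b + P.nl₂ f g a b

variable {P}

lemma Pos.a₁₁ (h : P.Pos) : 0 < P.a₁₁ := by
  have := h.ρ; have := h.F; have := h.G; unfold Par.a₁₁; positivity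
lemma Pos.a₁₂ (h : P.Pos) : 0 < P.a₁₂ := by
  have := h.F; have := h.G; unfold Par.a₁₂; positivity
lemma Pos.a₂₁ (h : P.Pos) : 0 < P.a₂₁ := by
  have := h.ρ; have := h.μ; have := h.F; have := h.G; unfold Par.a₂₁; positivity
lemma Pos.a₂₂ (h : P.Pos) : 0 < P.a₂₂ := by
  have := h.μ; have := h.F; have := h.G; unfold Par.a₂₂; positivity

section Majorants

variable {f g : Wiener} {a b a' b' : ℝ}

lemma maj_cubic {F : ℝ} (hF : 0 ≤ F) (hf : Maj f a a') :
    Maj (cubic (const F) f) (cubic F a) (dcubic F a a') := by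
  refine (((hf.mul hf).mul hf).add ((((hf.mul hf).const_mul (c := 3 * F) (by positivity))).add
    (hf.const_mul (c := 3 * F ^ 2) (by positivity)))).congr ?_ ?_ ?_
  · simp only [cubic, map_mul, map_pow, map_ofNat]; ring
  · simp only [cubic]; ring
  · simp only [dcubic]; ring

lemma maj_mixed {F G : ℝ} (hF : 0 ≤ F) (hG : 0 ≤ G) (hf : Maj f a a') (hg : Maj g b b') :
    Maj (mixed (const F) (const G) f g) (mixed F G a b) (dmixed F G a b a' b') := by
  refine (((hf.mul hf).mul hg).add (((hf.mul hg).const_mul (c := 2 * F) (by positivity)).add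
    (((hf.mul hf).const_mul hG).add ((hg.const_mul (c := F ^ 2) (by positivity)).add
    (hf.const_mul (c := 2 * F * G) (by positivity)))))).congr ?_ ?_ ?_
  · simp only [mixed, map_mul, map_pow, map_ofNat]; ring
  · simp only [mixed]; ring
  · simp only [dmixed]; ring

lemma maj_w₁₁ (h : P.Pos) (hf : Maj f a a') (hg : Maj g b b') :
    Maj (P.w₁₁ f g) (n₁₁ P.ρ P.F P.G a b)
      (3 * dmixed P.F P.G a b a' b' + 2 * P.ρ * dcubic P.F a a') := by
  have hρ := h.ρ
  refine (((maj_mixed h.F.le h.G.le hf hg).const_mul (c := 3) (by norm_num)).add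
    ((maj_cubic h.F.le hf).const_mul (c := 2 * P.ρ) (by positivity))).congr ?_ ?_ ?_
  · simp only [w₁₁, n₁₁, map_mul, map_ofNat]
  · simp only [n₁₁]
  · ring

lemma maj_w₁₂ (h : P.Pos) (hf : Maj f a a') (hg : Maj g b b') :
    Maj (P.w₁₂ f g) (n₁₂ P.F P.G a b)
      (3 * dmixed P.F P.G a b a' b' + 2 * dcubic P.F a a') := by
  refine (((maj_mixed h.F.le h.G.le hf hg).const_mul (c := 3) (by norm_num)).add
    ((maj_cubic h.F.le hf).const_mul (c := 2) (by positivity))).congr ?_ ?_ ?_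
  · simp only [w₁₂, n₁₂, map_ofNat]
  · simp only [n₁₂]
  · ring

lemma maj_w₂₁ (h : P.Pos) (hf : Maj f a a') (hg : Maj g b b') :
    Maj (P.w₂₁ f g) (n₂₁ P.ρ P.μ P.F P.G a b)
      (2 * P.μ * dcubic P.G b b' + 3 * P.ρ * dmixed P.F P.G a b a' b'
        + 6 * dmixed P.G P.F b a b' a') := by
  have hρ := h.ρ
  have hμ := h.μ
  refine ((((maj_cubic h.G.le hg).const_mul (c := 2 * P.μ) (by positivity)).add
    ((maj_mixed h.F.le h.G.le hf hg).const_mul (c := 3 * P.ρ) (by positivity))).add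
    ((maj_mixed h.G.le h.F.le hg hf).const_mul (c := 6) (by norm_num))).congr ?_ ?_ ?_
  · simp only [w₂₁, n₂₁, map_mul, map_ofNat]
  · simp only [n₂₁]
  · ring

lemma maj_w₂₂ (h : P.Pos) (hf : Maj f a a') (hg : Maj g b b') :
    Maj (P.w₂₂ f g) (n₂₂ P.μ P.F P.G a b)
      (2 * P.μ * dcubic P.G b b' + 3 * dmixed P.F P.G a b a' b'
        + 6 * dmixed P.G P.F b a b' a') := by
  have hμ := h.μ
  refine ((((maj_cubic h.G.le hg).const_mul (c := 2 * P.μ) (by positivity)).add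
    ((maj_mixed h.F.le h.G.le hf hg).const_mul (c := 3) (by positivity))).add
    ((maj_mixed h.G.le h.F.le hg hf).const_mul (c := 6) (by norm_num))).congr ?_ ?_ ?_
  · simp only [w₂₂, n₂₂, map_mul, map_ofNat]
  · simp only [n₂₂]
  · ring

end Majorants

end Par

/-! ### The dissipation of the Wiener norm -/

/-- The interpolation inequality `‖u‖₁ ‖v‖ₘ ≤ ‖u‖ₘ₊₁ ‖v‖₀ + ‖u‖₀ ‖v‖ₘ₊₁` for two different
sequences. -/
lemma sum_mul_sum_le_of_ne {ι : Type*} (S : Finset ι) (x p q : ι → ℝ) (hx : ∀ i, 0 ≤ x i)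
    (hp : ∀ i, 0 ≤ p i) (hq : ∀ i, 0 ≤ q i) (m : ℕ) :
    (∑ i ∈ S, x i ^ 1 * p i) * ∑ i ∈ S, x i ^ m * q i
      ≤ (∑ i ∈ S, x i ^ (m + 1) * p i) * (∑ i ∈ S, q i)
        + (∑ i ∈ S, p i) * ∑ i ∈ S, x i ^ (m + 1) * q i := by
  simp only [Finset.sum_mul_sum, ← Finset.sum_add_distrib]
  refine Finset.sum_le_sum fun i _ => Finset.sum_le_sum fun j _ => ?_
  have key : x i * x j ^ m ≤ x i ^ (m + 1) + x j ^ (m + 1) := by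
    have hi := hx i; have hj := hx j
    rcases le_total (x i) (x j) with h | h
    · calc x i * x j ^ m ≤ x j * x j ^ m := by gcongr
        _ = x j ^ (m + 1) := by ring
        _ ≤ _ := le_add_of_nonneg_left (by positivity)
    · calc x i * x j ^ m ≤ x i * x i ^ m := by gcongr
        _ = x i ^ (m + 1) := by ring
        _ ≤ _ := le_add_of_nonneg_right (by positivity)
  have := mul_le_mul_of_nonneg_right key (mul_nonneg (hp i) (hq j))
  linarith

/-- The interpolation inequality `‖u‖₁ ‖u‖ₘ ≤ ‖u‖₀ ‖u‖ₘ₊₁`, from the rearrangement inequality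
`x yᵐ + y xᵐ ≤ xᵐ⁺¹ + yᵐ⁺¹`. -/
lemma sum_mul_sum_le_self {ι : Type*} (S : Finset ι) (x p : ι → ℝ) (hx : ∀ i, 0 ≤ x i)
    (hp : ∀ i, 0 ≤ p i) (m : ℕ) :
    (∑ i ∈ S, x i ^ 1 * p i) * ∑ i ∈ S, x i ^ m * p i
      ≤ (∑ i ∈ S, p i) * ∑ i ∈ S, x i ^ (m + 1) * p i := by
  have h2 : 2 * ((∑ i ∈ S, x i ^ 1 * p i) * ∑ i ∈ S, x i ^ m * p i)
      ≤ 2 * ((∑ i ∈ S, p i) * ∑ i ∈ S, x i ^ (m + 1) * p i) := by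
    have e1 : 2 * ((∑ i ∈ S, x i ^ 1 * p i) * ∑ i ∈ S, x i ^ m * p i)
        = (∑ i ∈ S, x i ^ 1 * p i) * (∑ i ∈ S, x i ^ m * p i)
          + (∑ i ∈ S, x i ^ m * p i) * ∑ i ∈ S, x i ^ 1 * p i := by ring
    have e2 : 2 * ((∑ i ∈ S, p i) * ∑ i ∈ S, x i ^ (m + 1) * p i)
        = (∑ i ∈ S, p i) * (∑ i ∈ S, x i ^ (m + 1) * p i)
          + (∑ i ∈ S, x i ^ (m + 1) * p i) * ∑ i ∈ S, p i := by ring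
    rw [e1, e2]
    simp only [Finset.sum_mul_sum, ← Finset.sum_add_distrib]
    refine Finset.sum_le_sum fun i _ => Finset.sum_le_sum fun j _ => ?_
    have key : x i * x j ^ m + x i ^ m * x j ≤ x j ^ (m + 1) + x i ^ (m + 1) := by
      have hi := hx i; have hj := hx j
      have : 0 ≤ (x j - x i) * (x j ^ m - x i ^ m) := by
        rcases le_total (x i) (x j) with h | h
        · exact mul_nonneg (sub_nonneg.2 h) (sub_nonneg.2 (pow_le_pow_left₀ hi h m))
        · exact mul_nonneg_of_nonpos_of_nonpos (sub_nonpos.2 h)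
            (sub_nonpos.2 (pow_le_pow_left₀ hj h m))
      nlinarith [pow_succ (x j) m, pow_succ (x i) m]
    have := mul_le_mul_of_nonneg_right key (mul_nonneg (hp i) (hp j))
    nlinarith
  linarith

namespace Wiener

lemma Supp.wt_mul_wt_self {n : ℕ} {u : Wiener} (h : Supp n u) (m : ℕ) :
    wt 1 u * wt m u ≤ ‖u‖ * wt (m + 1) u := by
  rw [h.wt_eq, h.wt_eq, h.wt_eq, h.norm_eq]
  exact sum_mul_sum_le_self _ (fun k : ℤ => |(k : ℝ)|) (fun k => ‖u k‖) (fun _ => abs_nonneg _)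
    (fun _ => norm_nonneg _) m

lemma Supp.wt_mul_wt {n : ℕ} {u v : Wiener} (h : Supp n u) (h' : Supp n v) (m : ℕ) :
    wt 1 u * wt m v ≤ wt (m + 1) u * ‖v‖ + ‖u‖ * wt (m + 1) v := by
  rw [h.wt_eq, h'.wt_eq, h.wt_eq, h'.wt_eq, h.norm_eq, h'.norm_eq]
  exact sum_mul_sum_le_of_ne _ (fun k : ℤ => |(k : ℝ)|) (fun k => ‖u k‖) (fun k => ‖v k‖)
    (fun _ => abs_nonneg _) (fun _ => norm_nonneg _) (fun _ => norm_nonneg _) m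

end Wiener

open Wiener

/-- The symbol `i kᵐ`.  For `m = 1` it is the symbol of `∂ₓ`, and for `m = ζ` that of `𝒟`. -/
def dsym (m : ℕ) (k : ℤ) : ℂ := Complex.I * (k : ℂ) ^ m

lemma norm_dsym (m : ℕ) (k : ℤ) : ‖dsym m k‖ = |(k : ℝ)| ^ m := by
  simp [dsym, norm_pow, Complex.norm_intCast]

lemma dsym_mul_dsym {m : ℕ} (hm : Odd m) (k : ℤ) :
    dsym 1 k * dsym m k = -((|(k : ℝ)| ^ (m + 1) : ℝ) : ℂ) := by
  have h : |(k : ℝ)| ^ (m + 1) = (k : ℝ) ^ (m + 1) := hm.add_one.pow_abs _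
  rw [h]
  push_cast
  rw [dsym, dsym, pow_one]
  linear_combination ((k : ℂ) ^ (m + 1)) * Complex.I_mul_I

lemma Wiener.norm_cut_dsym {n m : ℕ} {f : Wiener} (hf : Supp n f) (k : ℤ) :
    ‖cut n (dsym m) f k‖ = |(k : ℝ)| ^ m * ‖f k‖ := by
  rw [cut_apply]
  split_ifs with h
  · rw [norm_mul, norm_dsym]
  · simp [hf k h]

lemma Wiener.maj_cut_dsym {n m : ℕ} {f : Wiener} (hf : Supp n f) :
    Maj (cut n (dsym m) f) (wt m f) (wt (m + 1) f) := by
  refine ⟨?_, (supp_cut n _ f).ws 1, ?_⟩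
  · rw [norm_def, wt]; simp_rw [norm_cut_dsym hf]; rfl
  · rw [wt, wt]; simp_rw [norm_cut_dsym hf]; exact le_of_eq (tsum_congr fun k => by ring)

namespace Par

variable (P : Par)

/-- The first component of the Galerkin vector field. -/
def V₁ (n m : ℕ) (f g : Wiener) : Wiener :=
  cut n (dsym 1) (P.J₁ f g (cut n (dsym m) f) (cut n (dsym m) g))

/-- The second component of the Galerkin vector field. -/
def V₂ (n m : ℕ) (f g : Wiener) : Wiener :=
  cut n (dsym 1) (P.J₂ f g (cut n (dsym m) f) (cut n (dsym m) g))

variable {P} {n m : ℕ} {f g : Wiener}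

/-- For odd `m` the linear part of the Galerkin vector field acts on the mode `k` as multiplication by
`-|k|ᵐ⁺¹`, so that the diagonal entries of the mobility matrix are dissipative. -/
lemma V₁_apply (hm : Odd m) {k : ℤ} (hk : k ∈ modes n) :
    P.V₁ n m f g k = -((P.a₁₁ * |(k : ℝ)| ^ (m + 1) : ℝ) : ℂ) * f k
      - ((P.a₁₂ * |(k : ℝ)| ^ (m + 1) : ℝ) : ℂ) * g k
      + dsym 1 k * P.nl₁ f g (cut n (dsym m) f) (cut n (dsym m) g) k := by
  have := dsym_mul_dsym hm k
  rw [V₁, cut_apply, if_pos hk, J₁, add_apply, add_apply, const_mul_apply, const_mul_apply,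
    cut_apply, cut_apply, if_pos hk, if_pos hk]
  push_cast at this ⊢
  linear_combination ((P.a₁₁ : ℂ) * f k + (P.a₁₂ : ℂ) * g k) * this

lemma V₂_apply (hm : Odd m) {k : ℤ} (hk : k ∈ modes n) :
    P.V₂ n m f g k = -((P.a₂₂ * |(k : ℝ)| ^ (m + 1) : ℝ) : ℂ) * g k
      - ((P.a₂₁ * |(k : ℝ)| ^ (m + 1) : ℝ) : ℂ) * f k
      + dsym 1 k * P.nl₂ f g (cut n (dsym m) f) (cut n (dsym m) g) k := by
  have := dsym_mul_dsym hm k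
  rw [V₂, cut_apply, if_pos hk, J₂, add_apply, add_apply, const_mul_apply, const_mul_apply,
    cut_apply, cut_apply, if_pos hk, if_pos hk]
  push_cast at this ⊢
  linear_combination ((P.a₂₁ : ℂ) * f k + (P.a₂₂ : ℂ) * g k) * this

variable (P) in
/-- The smallness conditions on the parameters and on the size `e` of the initial datum. -/
structure Adm (e : ℝ) : Prop where
  pos : P.Pos
  nonneg : 0 ≤ e
  sigma₁ : 0 < Sigma₁ P.ρ P.μ P.F P.G e
  sigma₂ : 0 < Sigma₂ P.ρ P.μ P.F P.G e

lemma maj_nl₁ (h : P.Pos) (hf : Supp n f) (hg : Supp n g) :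
    Maj (P.nl₁ f g (cut n (dsym m) f) (cut n (dsym m) g))
      (n₁₁ P.ρ P.F P.G ‖f‖ ‖g‖ * wt m f + n₁₂ P.F P.G ‖f‖ ‖g‖ * wt m g)
      (((3 * dmixed P.F P.G ‖f‖ ‖g‖ (wt 1 f) (wt 1 g) + 2 * P.ρ * dcubic P.F ‖f‖ (wt 1 f)) * wt m f
          + n₁₁ P.ρ P.F P.G ‖f‖ ‖g‖ * wt (m + 1) f)
        + ((3 * dmixed P.F P.G ‖f‖ ‖g‖ (wt 1 f) (wt 1 g) + 2 * dcubic P.F ‖f‖ (wt 1 f)) * wt m g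
          + n₁₂ P.F P.G ‖f‖ ‖g‖ * wt (m + 1) g)) :=
  ((maj_w₁₁ h hf.maj hg.maj).mul (maj_cut_dsym hf)).add
    ((maj_w₁₂ h hf.maj hg.maj).mul (maj_cut_dsym hg))

lemma maj_nl₂ (h : P.Pos) (hf : Supp n f) (hg : Supp n g) :
    Maj (P.nl₂ f g (cut n (dsym m) f) (cut n (dsym m) g))
      (n₂₁ P.ρ P.μ P.F P.G ‖f‖ ‖g‖ * wt m f + n₂₂ P.μ P.F P.G ‖f‖ ‖g‖ * wt m g)
      (((2 * P.μ * dcubic P.G ‖g‖ (wt 1 g) + 3 * P.ρ * dmixed P.F P.G ‖f‖ ‖g‖ (wt 1 f) (wt 1 g)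
          + 6 * dmixed P.G P.F ‖g‖ ‖f‖ (wt 1 g) (wt 1 f)) * wt m f
          + n₂₁ P.ρ P.μ P.F P.G ‖f‖ ‖g‖ * wt (m + 1) f)
        + ((2 * P.μ * dcubic P.G ‖g‖ (wt 1 g) + 3 * dmixed P.F P.G ‖f‖ ‖g‖ (wt 1 f) (wt 1 g)
          + 6 * dmixed P.G P.F ‖g‖ ‖f‖ (wt 1 g) (wt 1 f)) * wt m g
          + n₂₂ P.μ P.F P.G ‖f‖ ‖g‖ * wt (m + 1) g)) :=
  ((maj_w₂₁ h hf.maj hg.maj).mul (maj_cut_dsym hf)).add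
    ((maj_w₂₂ h hf.maj hg.maj).mul (maj_cut_dsym hg))

/-- The nonlinear terms are controlled by the terms of `Σ₁` and `Σ₂` with the factor `e`.  Products
of two intermediate derivatives are first interpolated between the orders `0` and `m + 1`. -/
lemma wt_nl_le {e : ℝ} (h : P.Pos) (hf : Supp n f) (hg : Supp n g) (he : ‖f‖ + ‖g‖ ≤ e) :
    wt 1 (P.nl₁ f g (cut n (dsym m) f) (cut n (dsym m) g))
      + wt 1 (P.nl₂ f g (cut n (dsym m) f) (cut n (dsym m) g))
      ≤ (P.a₁₁ - P.a₂₁ - Sigma₁ P.ρ P.μ P.F P.G e) * wt (m + 1) f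
        + (P.a₂₂ - P.a₁₂ - Sigma₂ P.ρ P.μ P.F P.G e) * wt (m + 1) g := by
  have h1 := (maj_nl₁ (m := m) h hf hg).wt_le
  have h2 := (maj_nl₂ (m := m) h hf hg).wt_le
  have hρ := h.ρ.le
  have hμ := h.μ.le
  have hF := h.F.le
  have hG := h.G.le
  have x1 := hf.wt_mul_wt_self m
  have x2 := hg.wt_mul_wt_self m
  have x3 := hf.wt_mul_wt hg m
  have x4 := hg.wt_mul_wt hf m
  have ha := norm_nonneg f
  have hb := norm_nonneg g
  have hA := wt_nonneg (m + 1) f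
  have hB := wt_nonneg (m + 1) g
  generalize wt 1 (P.nl₁ f g (cut n (dsym m) f) (cut n (dsym m) g)) = L1 at *
  generalize wt 1 (P.nl₂ f g (cut n (dsym m) f) (cut n (dsym m) g)) = L2 at *
  generalize ‖f‖ = a at *
  generalize ‖g‖ = b at *
  generalize wt 1 f = a' at *
  generalize wt 1 g = b' at *
  generalize wt m f = fm at *
  generalize wt m g = gm at *
  generalize wt (m + 1) f = A at *
  generalize wt (m + 1) g = B at *
  obtain ⟨ρ, μ, F, G⟩ := P
  simp only at *
  obtain ⟨c, hc, rfl⟩ : ∃ c, 0 ≤ c ∧ e = a + b + c := ⟨e - (a + b), by linarith, by ring⟩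
  -- the partial derivatives of the entries of the mobility matrix, summed over the columns
  obtain ⟨α, hα⟩ : ∃ α, α = (6 + 6 * ρ) / 2 * (2 * a * b + 2 * b * F + 2 * a * G + 2 * F * G)
    + 2 * ρ * (3 * a ^ 2 + 6 * a * F + 3 * F ^ 2) + 6 * (b ^ 2 + 2 * b * G + G ^ 2) := ⟨_, rfl⟩
  obtain ⟨β, hβ⟩ : ∃ β, β = (3 + 3 * ρ) * (a ^ 2 + 2 * a * F + F ^ 2)
    + 2 * μ * (3 * b ^ 2 + 6 * b * G + 3 * G ^ 2)
    + 6 * (2 * b * a + 2 * a * G + 2 * b * F + 2 * G * F) := ⟨_, rfl⟩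
  obtain ⟨γ, hγ⟩ : ∃ γ, γ = 6 * (2 * a * b + 2 * b * F + 2 * a * G + 2 * F * G)
    + 2 * (3 * a ^ 2 + 6 * a * F + 3 * F ^ 2) + 6 * (b ^ 2 + 2 * b * G + G ^ 2) := ⟨_, rfl⟩
  obtain ⟨κ, hκ⟩ : ∃ κ, κ = 6 * (a ^ 2 + 2 * a * F + F ^ 2)
    + 2 * μ * (3 * b ^ 2 + 6 * b * G + 3 * G ^ 2)
    + 6 * (2 * b * a + 2 * a * G + 2 * b * F + 2 * G * F) := ⟨_, rfl⟩
  have y1 := mul_le_mul_of_nonneg_left x1 (show 0 ≤ α by rw [hα]; positivity)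
  have y2 := mul_le_mul_of_nonneg_left x2 (show 0 ≤ κ by rw [hκ]; positivity)
  have y3 := mul_le_mul_of_nonneg_left x3 (show 0 ≤ γ by rw [hγ]; positivity)
  have y4 := mul_le_mul_of_nonneg_left x4 (show 0 ≤ β by rw [hβ]; positivity)
  -- every coefficient of the expanded difference is nonnegative, because `e = a + b + c`
  have z1 : α * a + β * b + γ * b + n₁₁ ρ F G a b + n₂₁ ρ μ F G a b
      ≤ a₁₁ ⟨ρ, μ, F, G⟩ - a₂₁ ⟨ρ, μ, F, G⟩ - Sigma₁ ρ μ F G (a + b + c) := by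
    rw [← sub_nonneg, hα, hβ, hγ, a₁₁, a₂₁, Sigma₁, n₁₁, n₂₁, mixed, mixed, cubic, cubic]
    ring_nf
    positivity
  have z2 : β * a + γ * a + κ * b + n₁₂ F G a b + n₂₂ μ F G a b
      ≤ a₂₂ ⟨ρ, μ, F, G⟩ - a₁₂ ⟨ρ, μ, F, G⟩ - Sigma₂ ρ μ F G (a + b + c) := by
    rw [← sub_nonneg, hβ, hγ, hκ, a₂₂, a₁₂, Sigma₂, n₁₂, n₂₂, mixed, mixed, cubic, cubic]
    ring_nf
    positivity
  have w1 := mul_le_mul_of_nonneg_right z1 hA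
  have w2 := mul_le_mul_of_nonneg_right z2 hB
  have key : L1 + L2 ≤ α * (a' * fm) + β * (b' * fm) + γ * (a' * gm) + κ * (b' * gm)
      + (n₁₁ ρ F G a b + n₂₁ ρ μ F G a b) * A + (n₁₂ F G a b + n₂₂ μ F G a b) * B := by
    refine (add_le_add h1 h2).trans_eq ?_
    rw [hα, hβ, hγ, hκ, dmixed, dmixed, dcubic, dcubic]
    ring
  linarith

/-- An explicit Euler step for one component.  The step is so small that the factor
`1 - τ c |k|ᵐ⁺¹` in front of each mode stays nonnegative. -/
lemma norm_add_smul_V_le {N : Wiener} {c d τ : ℝ} {v : Wiener} (hf : Supp n f) (hg : Supp n g)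
    (hN : WS 1 N) (hd : 0 ≤ d) (hτ : 0 ≤ τ) (hτ' : τ * (c * (n : ℝ) ^ (m + 1)) ≤ 1) (hc : 0 ≤ c)
    (hv : Supp n v)
    (hv' : ∀ k ∈ modes n, v k = -((c * |(k : ℝ)| ^ (m + 1) : ℝ) : ℂ) * f k
      - ((d * |(k : ℝ)| ^ (m + 1) : ℝ) : ℂ) * g k + dsym 1 k * N k) :
    ‖f + τ • v‖ ≤ ‖f‖ - τ * (c * wt (m + 1) f) + τ * (d * wt (m + 1) g) + τ * wt 1 N := by
  have hs : Supp n (f + τ • v) := fun k hk => by simp [hf k hk, hv k hk]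
  have hN' : ∑ k ∈ modes n, |(k : ℝ)| ^ 1 * ‖N k‖ ≤ wt 1 N :=
    hN.sum_le_tsum _ fun k _ => by positivity
  rw [hs.norm_eq, hf.norm_eq, hf.wt_eq, hg.wt_eq]
  calc ∑ k ∈ modes n, ‖(f + τ • v) k‖
      ≤ ∑ k ∈ modes n, (‖f k‖ - τ * (c * (|(k : ℝ)| ^ (m + 1) * ‖f k‖))
          + τ * (d * (|(k : ℝ)| ^ (m + 1) * ‖g k‖)) + τ * (|(k : ℝ)| ^ 1 * ‖N k‖)) := by
        refine Finset.sum_le_sum fun k hk => ?_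
        have hk' : |(k : ℝ)| ^ (m + 1) ≤ (n : ℝ) ^ (m + 1) :=
          pow_le_pow_left₀ (abs_nonneg _) (abs_le_of_mem_modes hk) _
        have h1 : 0 ≤ 1 - τ * (c * |(k : ℝ)| ^ (m + 1)) := by
          have : τ * (c * |(k : ℝ)| ^ (m + 1)) ≤ τ * (c * (n : ℝ) ^ (m + 1)) := by gcongr
          linarith
        have e : (f + τ • v) k = ((1 - τ * (c * |(k : ℝ)| ^ (m + 1)) : ℝ) : ℂ) * f k
            + (-((τ * (d * |(k : ℝ)| ^ (m + 1)) : ℝ) : ℂ) * g k + (τ : ℂ) * (dsym 1 k * N k)) := by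
          rw [add_apply, real_smul_apply, hv' k hk]; push_cast; ring
        rw [e]
        refine (norm_add_le _ _).trans ((add_le_add_right (norm_add_le _ _) _).trans_eq ?_)
        rw [norm_mul, norm_mul, norm_mul, norm_mul, norm_neg, Complex.norm_real, Complex.norm_real,
          Complex.norm_real, Real.norm_of_nonneg h1, Real.norm_of_nonneg (by positivity),
          Real.norm_of_nonneg hτ, norm_dsym]
        ring
    _ ≤ _ := by
        simp only [Finset.sum_add_distrib, Finset.sum_sub_distrib, ← Finset.mul_sum]
        gcongr

/-- An explicit Euler step for the Galerkin system decreases the Wiener norm. -/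
lemma norm_euler_step_le {e τ : ℝ} (h : P.Pos) (hm : Odd m) (hf : Supp n f) (hg : Supp n g)
    (he : ‖f‖ + ‖g‖ ≤ e) (hτ : 0 ≤ τ) (hτ₁ : τ * (P.a₁₁ * (n : ℝ) ^ (m + 1)) ≤ 1)
    (hτ₂ : τ * (P.a₂₂ * (n : ℝ) ^ (m + 1)) ≤ 1) :
    ‖f + τ • P.V₁ n m f g‖ + ‖g + τ • P.V₂ n m f g‖ ≤ ‖f‖ + ‖g‖
      - τ * (Sigma₁ P.ρ P.μ P.F P.G e * wt (m + 1) f + Sigma₂ P.ρ P.μ P.F P.G e * wt (m + 1) g) := by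
  have h1 := norm_add_smul_V_le (v := P.V₁ n m f g) hf hg (maj_nl₁ (m := m) h hf hg).ws h.a₁₂.le hτ hτ₁ h.a₁₁.le
    (supp_cut n _ _) fun k hk => V₁_apply hm hk
  have h2 := norm_add_smul_V_le (v := P.V₂ n m f g) hg hf (maj_nl₂ (m := m) h hf hg).ws h.a₂₁.le hτ hτ₂ h.a₂₂.le
    (supp_cut n _ _) fun k hk => V₂_apply hm hk
  have h3 := mul_le_mul_of_nonneg_left (wt_nl_le (m := m) h hf hg he) hτ
  linarith

end Par

open Wiener

/-! ### The dissipation of the Sobolev energy -/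

namespace Wiener

/-- The partial sum `∑_{|k| ≤ n} |k|^s |û(k)|²` of a Sobolev energy. -/
def en (n s : ℕ) (u : Wiener) : ℝ := ∑ k ∈ modes n, |(k : ℝ)| ^ s * ‖u k‖ ^ 2

lemma en_nonneg (n s : ℕ) (u : Wiener) : 0 ≤ en n s u := Finset.sum_nonneg fun _ _ => by positivity

end Wiener

/-- The Cauchy–Schwarz inequality for a sequence and a translate of another one. -/
lemma sum_mul_shift_le {S : Finset ℤ} {x y : ℤ → ℝ} (hy : ∀ k ∉ S, y k = 0) (j : ℤ) :
    ∑ k ∈ S, x k * y (k - j) ≤ √(∑ k ∈ S, x k ^ 2) * √(∑ k ∈ S, y k ^ 2) := by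
  refine (Real.sum_mul_le_sqrt_mul_sqrt _ _ _).trans
    (mul_le_mul_of_nonneg_left (Real.sqrt_le_sqrt ?_) (Real.sqrt_nonneg _))
  have h1 : ∑ k ∈ S, y (k - j) ^ 2 = ∑ k ∈ S.image (· - j), y k ^ 2 := by
    rw [Finset.sum_image]; intro a _ b _ hab; simpa using hab
  rw [h1, ← Finset.sum_filter_ne_zero]
  refine Finset.sum_le_sum_of_subset_of_nonneg (fun k hk => ?_) fun _ _ _ => sq_nonneg _
  by_contra h
  exact (Finset.mem_filter.1 hk).2 (by rw [hy k h]; norm_num)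

/-- Young's inequality `ℓ¹ * ℓ² → ℓ²` for the derivative of a product, in the weak form. -/
lemma Wiener.Maj.pairing_le {n : ℕ} {N w : Wiener} {p q : ℝ} (h : Maj N p q) (hw : Supp n w)
    (x : ℤ → ℝ) (hx : ∀ k, 0 ≤ x k) :
    ∑ k ∈ modes n, x k * (|(k : ℝ)| ^ 1 * ‖(N * w) k‖)
      ≤ √(∑ k ∈ modes n, x k ^ 2) * (q * √(∑ k ∈ modes n, ‖w k‖ ^ 2)
        + p * √(∑ k ∈ modes n, (|(k : ℝ)| * ‖w k‖) ^ 2)) := by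
  have s1 := fun k => (summable_conv h.ws w.summable_norm (fun k => by positivity)
    (fun k => by positivity)).prod_factor k
  have s2 := fun k => (summable_conv N.summable_norm (hw.ws 1) (fun k => by positivity)
    (fun k => by positivity)).prod_factor k
  set X := √(∑ k ∈ modes n, x k ^ 2)
  set W := √(∑ k ∈ modes n, ‖w k‖ ^ 2)
  set W' := √(∑ k ∈ modes n, (|(k : ℝ)| * ‖w k‖) ^ 2)
  have hb : ∀ k : ℤ, |(k : ℝ)| ^ 1 * ‖(N * w) k‖
      ≤ ∑' j : ℤ, (|(j : ℝ)| ^ 1 * ‖N j‖ * ‖w (k - j)‖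
        + ‖N j‖ * (|((k - j : ℤ) : ℝ)| ^ 1 * ‖w (k - j)‖)) := fun k => by
    refine (mul_le_mul_of_nonneg_left (norm_conv_le N w k) (by positivity)).trans ?_
    rw [← tsum_mul_left]
    refine ((summable_conv_norm N w k).mul_left _).tsum_le_tsum (fun j => ?_)
      ((s1 k).add (s2 k))
    have : |(k : ℝ)| ≤ |(j : ℝ)| + |((k - j : ℤ) : ℝ)| := by
      have := abs_add_le (j : ℝ) ((k - j : ℤ) : ℝ)
      push_cast at this ⊢
      simpa using this
    calc |(k : ℝ)| ^ 1 * (‖N j‖ * ‖w (k - j)‖)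
        ≤ (|(j : ℝ)| + |((k - j : ℤ) : ℝ)|) * (‖N j‖ * ‖w (k - j)‖) := by
          rw [pow_one]; exact mul_le_mul_of_nonneg_right this (by positivity)
      _ = _ := by ring
  have hX : 0 ≤ X := Real.sqrt_nonneg _
  have hW : 0 ≤ W := Real.sqrt_nonneg _
  have hW' : 0 ≤ W' := Real.sqrt_nonneg _
  calc ∑ k ∈ modes n, x k * (|(k : ℝ)| ^ 1 * ‖(N * w) k‖)
      ≤ ∑ k ∈ modes n, ∑' j : ℤ, x k * (|(j : ℝ)| ^ 1 * ‖N j‖ * ‖w (k - j)‖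
        + ‖N j‖ * (|((k - j : ℤ) : ℝ)| ^ 1 * ‖w (k - j)‖)) := by
        refine Finset.sum_le_sum fun k _ => ?_
        rw [tsum_mul_left]
        exact mul_le_mul_of_nonneg_left (hb k) (hx k)
    _ = ∑' j : ℤ, ∑ k ∈ modes n, x k * (|(j : ℝ)| ^ 1 * ‖N j‖ * ‖w (k - j)‖
        + ‖N j‖ * (|((k - j : ℤ) : ℝ)| ^ 1 * ‖w (k - j)‖)) :=
        (Summable.tsum_finsetSum fun k _ => ((s1 k).add (s2 k)).mul_left (x k)).symm
    _ ≤ ∑' j : ℤ, (|(j : ℝ)| ^ 1 * ‖N j‖ * (X * W) + ‖N j‖ * (X * W')) := by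
        refine Summable.tsum_le_tsum (fun j => ?_)
          (summable_sum fun k _ => ((s1 k).add (s2 k)).mul_left (x k))
          ((h.ws.mul_right _).add (N.summable_norm.mul_right _))
        have e : ∑ k ∈ modes n, x k * (|(j : ℝ)| ^ 1 * ‖N j‖ * ‖w (k - j)‖
            + ‖N j‖ * (|((k - j : ℤ) : ℝ)| ^ 1 * ‖w (k - j)‖))
            = |(j : ℝ)| ^ 1 * ‖N j‖ * (∑ k ∈ modes n, x k * ‖w (k - j)‖)
              + ‖N j‖ * ∑ k ∈ modes n, x k * (|((k - j : ℤ) : ℝ)| * ‖w (k - j)‖) := by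
          rw [Finset.mul_sum, Finset.mul_sum, ← Finset.sum_add_distrib]
          exact Finset.sum_congr rfl fun k _ => by ring
        rw [e]
        have t1 := sum_mul_shift_le (S := modes n) (x := x) (y := fun k => ‖w k‖)
          (fun k hk => by simp [hw k hk]) j
        have t2 := sum_mul_shift_le (S := modes n) (x := x) (y := fun k => |(k : ℝ)| * ‖w k‖)
          (fun k hk => by simp [hw k hk]) j
        exact add_le_add (mul_le_mul_of_nonneg_left t1 (by positivity))
          (mul_le_mul_of_nonneg_left t2 (by positivity))
    _ = wt 1 N * (X * W) + ‖N‖ * (X * W') := by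
        rw [(h.ws.mul_right _).tsum_add (N.summable_norm.mul_right _), tsum_mul_right,
          tsum_mul_right, norm_def, wt]
    _ ≤ q * (X * W) + p * (X * W') := by gcongr; exacts [h.wt_le, h.norm_le]
    _ = _ := by ring

namespace Par

variable {P : Par} {n m : ℕ} {f g : Wiener}

/-- The pairing of a Sobolev weight of order `m + 1` with the nonlinear part of a flux. -/
lemma pairing_nl_le {N₁ N₂ : Wiener} {p₁ p₂ q : ℝ} (h₁ : Maj N₁ p₁ q) (h₂ : Maj N₂ p₂ q)
    (hf : Supp n f) (hg : Supp n g) (u : Wiener) :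
    ∑ k ∈ modes n, |(k : ℝ)| ^ (m + 1) * ‖u k‖
        * (|(k : ℝ)| ^ 1 * ‖(N₁ * cut n (dsym m) f + N₂ * cut n (dsym m) g) k‖)
      ≤ √(en n (2 * (m + 1)) u) * (p₁ * √(en n (2 * (m + 1)) f) + p₂ * √(en n (2 * (m + 1)) g)
        + q * (√(en n (2 * m) f) + √(en n (2 * m) g))) := by
  have e1 : ∀ v : Wiener, ∑ k ∈ modes n, (|(k : ℝ)| ^ (m + 1) * ‖v k‖) ^ 2 = en n (2 * (m + 1)) v :=
    fun v => Finset.sum_congr rfl fun k _ => by rw [mul_pow, ← pow_mul, mul_comm (m + 1)]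
  have e2 : ∀ v : Wiener, Supp n v → ∑ k ∈ modes n, ‖cut n (dsym m) v k‖ ^ 2 = en n (2 * m) v :=
    fun v hv => Finset.sum_congr rfl fun k _ => by
      rw [norm_cut_dsym hv, mul_pow, ← pow_mul, mul_comm m]
  have e3 : ∀ v : Wiener, Supp n v →
      ∑ k ∈ modes n, (|(k : ℝ)| * ‖cut n (dsym m) v k‖) ^ 2 = en n (2 * (m + 1)) v :=
    fun v hv => by
      rw [← e1]
      exact Finset.sum_congr rfl fun k _ => by rw [norm_cut_dsym hv]; ring
  have t1 := h₁.pairing_le (supp_cut n (dsym m) f) (fun k => |(k : ℝ)| ^ (m + 1) * ‖u k‖)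
    fun k => by positivity
  have t2 := h₂.pairing_le (supp_cut n (dsym m) g) (fun k => |(k : ℝ)| ^ (m + 1) * ‖u k‖)
    fun k => by positivity
  rw [e1, e2 f hf, e3 f hf] at t1
  rw [e1, e2 g hg, e3 g hg] at t2
  calc _ ≤ ∑ k ∈ modes n, (|(k : ℝ)| ^ (m + 1) * ‖u k‖
          * (|(k : ℝ)| ^ 1 * ‖(N₁ * cut n (dsym m) f) k‖) + |(k : ℝ)| ^ (m + 1) * ‖u k‖
          * (|(k : ℝ)| ^ 1 * ‖(N₂ * cut n (dsym m) g) k‖)) := by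
        refine Finset.sum_le_sum fun k _ => ?_
        rw [← mul_add, ← mul_add]
        gcongr
        exact norm_add_le _ _
    _ ≤ _ := by rw [Finset.sum_add_distrib]; linarith

/-- Uniform majorants of the nonlinear part of the mobility matrix, for arguments of norm at
most `e`. -/
lemma exists_maj (h : P.Pos) {e : ℝ} (he : 0 ≤ e) : ∃ K : ℝ, 0 ≤ K ∧ ∀ {n : ℕ} {f g : Wiener},
    Supp n f → Supp n g → ‖f‖ ≤ e → ‖g‖ ≤ e →
      Maj (P.w₁₁ f g) (n₁₁ P.ρ P.F P.G e e) (K * (wt 1 f + wt 1 g)) ∧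
      Maj (P.w₁₂ f g) (n₁₂ P.F P.G e e) (K * (wt 1 f + wt 1 g)) ∧
      Maj (P.w₂₁ f g) (n₂₁ P.ρ P.μ P.F P.G e e) (K * (wt 1 f + wt 1 g)) ∧
      Maj (P.w₂₂ f g) (n₂₂ P.μ P.F P.G e e) (K * (wt 1 f + wt 1 g)) := by
  have hρ := h.ρ.le
  have hμ := h.μ.le
  have hF := h.F.le
  have hG := h.G.le
  obtain ⟨ρ, μ, F, G⟩ := P
  simp only at hρ hμ hF hG
  obtain ⟨x, hx⟩ : ∃ x, x = 2 * e * e + 2 * e * F + 2 * e * G + 2 * F * G := ⟨_, rfl⟩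
  obtain ⟨y, hy⟩ : ∃ y, y = e ^ 2 + 2 * e * F + F ^ 2 := ⟨_, rfl⟩
  obtain ⟨z, hz⟩ : ∃ z, z = e ^ 2 + 2 * e * G + G ^ 2 := ⟨_, rfl⟩
  have hx0 : 0 ≤ x := by rw [hx]; positivity
  have hy0 : 0 ≤ y := by rw [hy]; positivity
  have hz0 : 0 ≤ z := by rw [hz]; positivity
  refine ⟨(9 + 3 * ρ) * (x + y + z) + (6 * ρ + 6 * μ + 6) * (y + z), by positivity,
    fun {n f g} hf hg hfe hge => ?_⟩
  have hf' : Maj f e (wt 1 f) := hf.maj.mono hfe le_rfl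
  have hg' : Maj g e (wt 1 g) := hg.maj.mono hge le_rfl
  have ha := wt_nonneg 1 f
  have hb := wt_nonneg 1 g
  have d1 : dmixed F G e e (wt 1 f) (wt 1 g) = x * wt 1 f + y * wt 1 g := by
    rw [dmixed, hx, hy]
  have d2 : dmixed G F e e (wt 1 g) (wt 1 f) = x * wt 1 g + z * wt 1 f := by
    rw [dmixed, hx, hz]; ring
  have d3 : dcubic F e (wt 1 f) = 3 * y * wt 1 f := by rw [dcubic, hy]; ring
  have d4 : dcubic G e (wt 1 g) = 3 * z * wt 1 g := by rw [dcubic, hz]; ring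
  refine ⟨(maj_w₁₁ h hf' hg').mono le_rfl ?_, (maj_w₁₂ h hf' hg').mono le_rfl ?_,
    (maj_w₂₁ h hf' hg').mono le_rfl ?_, (maj_w₂₂ h hf' hg').mono le_rfl ?_⟩
  all_goals
    simp only [d1, d2, d3, d4]
    generalize wt 1 f = a at *
    generalize wt 1 g = b at *
    rw [← sub_nonneg]
    ring_nf
    positivity

/-- The inequality of Young type that absorbs the lower order terms of a fourth order system. -/
lemma absorb_fourth_order {η e a b A B r t X Y H I : ℝ} (hη : 0 < η) (he : 0 ≤ e) (A0 : 0 ≤ A)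
    (B0 : 0 ≤ B) (p1 : 0 ≤ r) (p2 : 0 ≤ t) (p3 : 0 ≤ X) (p4 : 0 ≤ Y) (hH1 : H ^ 2 ≤ r * X)
    (hH2 : I ^ 2 ≤ t * Y) (hf1 : a ^ 4 ≤ e ^ 3 * A) (hg1 : b ^ 4 ≤ e ^ 3 * B)
    (y : (a + b) * (H + I) * (X + Y)
      ≤ η / 4 * (X + Y) ^ 2 + (a + b) ^ 2 * (H + I) ^ 2 / η) :
    (a + b) * (H + I) * (X + Y)
      ≤ η * (X ^ 2 + Y ^ 2) + 8 * e ^ 3 * (256 / η ^ 3) * (A + B) * (r ^ 2 + t ^ 2) := by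
  have z1 : (X + Y) ^ 2 ≤ 2 * (X ^ 2 + Y ^ 2) := add_sq_le
  have z2 : (H + I) ^ 2 ≤ 2 * ((r + t) * (X + Y)) := by
    have w1 : (H + I) ^ 2 = 2 * (H ^ 2 + I ^ 2) - (H - I) ^ 2 := by ring
    have w2 : (r + t) * (X + Y) = r * X + t * Y + (r * Y + t * X) := by ring
    have w3 : 0 ≤ r * Y + t * X := by positivity
    have w4 := sq_nonneg (H - I)
    linarith
  have z3 : (a + b) ^ 4 ≤ 8 * e ^ 3 * (A + B) := by
    have w1 : (a + b) ^ 2 ≤ 2 * (a ^ 2 + b ^ 2) := add_sq_le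
    calc (a + b) ^ 4 = ((a + b) ^ 2) ^ 2 := by ring
      _ ≤ (2 * (a ^ 2 + b ^ 2)) ^ 2 := by gcongr
      _ = 8 * (a ^ 4 + b ^ 4) - 4 * (a ^ 2 - b ^ 2) ^ 2 := by ring
      _ ≤ 8 * (a ^ 4 + b ^ 4) := sub_le_self _ (by positivity)
      _ ≤ _ := by linarith
  have z4 : (r + t) ^ 2 ≤ 2 * (r ^ 2 + t ^ 2) := add_sq_le
  have z5 : (a + b) ^ 2 * (H + I) ^ 2 / η ≤ η / 4 * (X + Y) ^ 2
      + 16 / η ^ 3 * ((a + b) ^ 4 * (r + t) ^ 2) := by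
    have w1 : (a + b) ^ 2 * (H + I) ^ 2 ≤ (a + b) ^ 2 * (2 * ((r + t) * (X + Y))) := by gcongr
    have w2 : 0 ≤ (η / 2 * (X + Y) - 4 / η ^ 2 * ((a + b) ^ 2 * (r + t)) * (η / 2)) ^ 2 / η := by
      positivity
    have w3 : (η / 2 * (X + Y) - 4 / η ^ 2 * ((a + b) ^ 2 * (r + t)) * (η / 2)) ^ 2 / η
        = η / 4 * (X + Y) ^ 2 - 2 * ((a + b) ^ 2 * ((r + t) * (X + Y))) / η
          + 4 / η ^ 3 * ((a + b) ^ 4 * (r + t) ^ 2) := by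
      field_simp; ring
    have w4 : (a + b) ^ 2 * (H + I) ^ 2 / η
        ≤ 2 * ((a + b) ^ 2 * ((r + t) * (X + Y))) / η :=
      div_le_div_of_nonneg_right (w1.trans_eq (by ring)) hη.le
    have w5 : 4 / η ^ 3 * ((a + b) ^ 4 * (r + t) ^ 2)
        ≤ 16 / η ^ 3 * ((a + b) ^ 4 * (r + t) ^ 2) := by gcongr; norm_num
    linarith
  have z6 : (a + b) ^ 4 * (r + t) ^ 2 ≤ 8 * e ^ 3 * (A + B) * (2 * (r ^ 2 + t ^ 2)) :=
    mul_le_mul z3 z4 (sq_nonneg _) (by positivity)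
  have z7 : 16 / η ^ 3 * ((a + b) ^ 4 * (r + t) ^ 2)
      ≤ 8 * e ^ 3 * (256 / η ^ 3) * (A + B) * (r ^ 2 + t ^ 2) := by
    calc _ ≤ 16 / η ^ 3 * (8 * e ^ 3 * (A + B) * (2 * (r ^ 2 + t ^ 2))) := by gcongr
      _ = 32 / η ^ 3 * (8 * e ^ 3 * (A + B) * (r ^ 2 + t ^ 2)) := by ring
      _ ≤ 256 / η ^ 3 * (8 * e ^ 3 * (A + B) * (r ^ 2 + t ^ 2)) := by gcongr; norm_num
      _ = _ := by ring
  have z8 : η / 4 * (X + Y) ^ 2 ≤ η / 4 * (2 * (X ^ 2 + Y ^ 2)) := by gcongr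
  linarith

/-- The lower order terms in the energy estimate are absorbed by interpolation. -/
lemma lower_order_le (hm : m = 1 ∨ m = 3) {e η : ℝ} (he : 0 ≤ e) (hη : 0 < η) :
    ∃ C : ℝ, 0 ≤ C ∧ ∀ {n : ℕ} {f g : Wiener}, Supp n f → Supp n g → ‖f‖ ≤ e → ‖g‖ ≤ e →
      (wt 1 f + wt 1 g) * (√(en n (2 * m) f) + √(en n (2 * m) g))
          * (√(en n (2 * (m + 1)) f) + √(en n (2 * (m + 1)) g))
        ≤ η * (en n (2 * (m + 1)) f + en n (2 * (m + 1)) g)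
          + C * (wt (m + 1) f + wt (m + 1) g) * (en n (m + 1) f + en n (m + 1) g) := by
  have young : ∀ s H Z : ℝ, s * H * Z ≤ η / 4 * Z ^ 2 + s ^ 2 * H ^ 2 / η := fun s H Z => by
    have h0 : 0 ≤ (η / 2 * Z - s * H) ^ 2 / η := by positivity
    have h1 : (η / 2 * Z - s * H) ^ 2 / η = η / 4 * Z ^ 2 - s * H * Z + s ^ 2 * H ^ 2 / η := by
      field_simp; ring
    linarith
  rcases hm with rfl | rfl
  · refine ⟨4 * e / η, by positivity, fun {n f g} hf hg hfe hge => ?_⟩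
    have i1 := hf.wt_mul_wt_self 1
    have i2 := hg.wt_mul_wt_self 1
    norm_num at i1 i2 ⊢
    have hA := wt_nonneg 2 f
    have hB := wt_nonneg 2 g
    have i1' := i1.trans (mul_le_mul_of_nonneg_right hfe hA)
    have i2' := i2.trans (mul_le_mul_of_nonneg_right hge hB)
    have y := young (wt 1 f + wt 1 g) (√(en n 2 f) + √(en n 2 g)) (√(en n 4 f) + √(en n 4 g))
    have q1 := Real.sq_sqrt (en_nonneg n 2 f)
    have q2 := Real.sq_sqrt (en_nonneg n 2 g)
    have q3 := Real.sq_sqrt (en_nonneg n 4 f)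
    have q4 := Real.sq_sqrt (en_nonneg n 4 g)
    have z1 : (√(en n 4 f) + √(en n 4 g)) ^ 2 ≤ 2 * (en n 4 f + en n 4 g) := by
      nlinarith [sq_nonneg (√(en n 4 f) - √(en n 4 g))]
    have z2 : (√(en n 2 f) + √(en n 2 g)) ^ 2 ≤ 2 * (en n 2 f + en n 2 g) := by
      nlinarith [sq_nonneg (√(en n 2 f) - √(en n 2 g))]
    have z3 : (wt 1 f + wt 1 g) ^ 2 ≤ 2 * e * (wt 2 f + wt 2 g) := by
      nlinarith [sq_nonneg (wt 1 f - wt 1 g)]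
    have z4 := mul_le_mul z3 z2 (sq_nonneg _) (by positivity)
    have z5 : (wt 1 f + wt 1 g) ^ 2 * (√(en n 2 f) + √(en n 2 g)) ^ 2 / η
        ≤ 4 * e / η * (wt 2 f + wt 2 g) * (en n 2 f + en n 2 g) := by
      rw [div_le_iff₀ hη]
      refine z4.trans_eq ?_
      field_simp; ring
    have z6 := mul_le_mul_of_nonneg_left z1 (show 0 ≤ η / 4 by positivity)
    have := en_nonneg n 4 f
    have := en_nonneg n 4 g
    nlinarith
  · refine ⟨8 * e ^ 3 * (256 / η ^ 3), by positivity, fun {n f g} hf hg hfe hge => ?_⟩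
    have cs : ∀ u : Wiener, en n 6 u ^ 2 ≤ en n 4 u * en n 8 u := fun u => by
      have := Finset.sum_mul_sq_le_sq_mul_sq (modes n) (fun k => |(k : ℝ)| ^ 2 * ‖u k‖)
        (fun k => |(k : ℝ)| ^ 4 * ‖u k‖)
      refine le_of_eq_of_le ?_ (this.trans_eq ?_)
      · rw [en]; congr 1; exact Finset.sum_congr rfl fun k _ => by ring
      · rw [en, en]; congr 1 <;> exact Finset.sum_congr rfl fun k _ => by ring
    have iw : ∀ u : Wiener, Supp n u → ‖u‖ ≤ e → wt 1 u ^ 4 ≤ e ^ 3 * wt 4 u := fun u hu hue => by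
      have i1 := (hu.wt_mul_wt_self 1).trans
        (mul_le_mul_of_nonneg_right hue (wt_nonneg _ _))
      have i3 := (hu.wt_mul_wt_self 3).trans
        (mul_le_mul_of_nonneg_right hue (wt_nonneg _ _))
      have i2 := (hu.wt_mul_wt_self 2).trans
        (mul_le_mul_of_nonneg_right hue (wt_nonneg _ _))
      norm_num at i1 i2 i3
      have h1 := wt_nonneg 1 u
      have h2 := wt_nonneg 2 u
      calc wt 1 u ^ 4 = wt 1 u ^ 2 * (wt 1 u * wt 1 u) := by ring
        _ ≤ wt 1 u ^ 2 * (e * wt 2 u) := by gcongr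
        _ = e * wt 1 u * (wt 1 u * wt 2 u) := by ring
        _ ≤ e * wt 1 u * (e * wt 3 u) := by gcongr
        _ = e ^ 2 * (wt 1 u * wt 3 u) := by ring
        _ ≤ e ^ 2 * (e * wt 4 u) := by gcongr
        _ = _ := by ring
    norm_num
    have hH : ∀ u : Wiener, √(en n 6 u) ^ 2 ≤ √(en n 4 u) * √(en n 8 u) := fun u => by
      rw [Real.sq_sqrt (en_nonneg n 6 u), ← Real.sqrt_mul (en_nonneg n 4 u)]
      exact Real.le_sqrt_of_sq_le (cs u)
    have y := young (wt 1 f + wt 1 g) (√(en n 6 f) + √(en n 6 g)) (√(en n 8 f) + √(en n 8 g))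
    have hf1 := iw f hf hfe
    have hg1 := iw g hg hge
    have hH1 := hH f
    have hH2 := hH g
    have q1 := Real.sq_sqrt (en_nonneg n 4 f)
    have q2 := Real.sq_sqrt (en_nonneg n 4 g)
    have q3 := Real.sq_sqrt (en_nonneg n 8 f)
    have q4 := Real.sq_sqrt (en_nonneg n 8 g)
    have p1 := Real.sqrt_nonneg (en n 4 f)
    have p2 := Real.sqrt_nonneg (en n 4 g)
    have p3 := Real.sqrt_nonneg (en n 8 f)
    have p4 := Real.sqrt_nonneg (en n 8 g)
    have A0 := wt_nonneg 4 f
    have B0 := wt_nonneg 4 g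
    have := absorb_fourth_order hη he A0 B0 p1 p2 p3 p4 hH1 hH2 hf1 hg1 y
    rwa [q1, q2, q3, q4] at this

end Par

open Wiener

namespace Par

variable {P : Par} {n m : ℕ} {f g : Wiener}

/-- The dissipation in one mode `u` whose velocity is `w`. -/
lemma inner_V_le {u v w N : ℂ} {α β l : ℝ} {s : ℂ} (hβ : 0 ≤ β) (hs : ‖s‖ = l)
    (hw : w = -(α : ℂ) * u - (β : ℂ) * v + s * N) :
    inner ℝ u w ≤ -α * ‖u‖ ^ 2 + β * (‖u‖ * ‖v‖) + ‖u‖ * (l * ‖N‖) := by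
  have e : w = (-α) • u + ((-β) • v + s * N) := by
    rw [hw, Complex.real_smul, Complex.real_smul]; push_cast; ring
  rw [e, inner_add_right, inner_add_right, real_inner_smul_right, real_inner_smul_right,
    real_inner_self_eq_norm_sq]
  have h1 := (abs_le.1 (abs_real_inner_le_norm u v)).1
  have h2 := real_inner_le_norm u (s * N)
  rw [norm_mul, hs] at h2
  nlinarith

/-- The size of the energy flux in one mode `u` whose velocity is `w`. -/
lemma norm_V_le {u v w N : ℂ} {α β l : ℝ} {s : ℂ} (hα : 0 ≤ α) (hβ : 0 ≤ β) (hs : ‖s‖ = l)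
    (hw : w = -(α : ℂ) * u - (β : ℂ) * v + s * N) :
    ‖u‖ * ‖w‖ ≤ α * ‖u‖ ^ 2 + β * (‖u‖ * ‖v‖) + ‖u‖ * (l * ‖N‖) := by
  have h : ‖w‖ ≤ α * ‖u‖ + β * ‖v‖ + l * ‖N‖ := by
    rw [hw]
    refine (norm_add_le _ _).trans (add_le_add ((norm_sub_le _ _).trans_eq ?_) ?_)
    · rw [norm_mul, norm_mul, norm_neg, Complex.norm_real, Complex.norm_real,
        Real.norm_of_nonneg hα, Real.norm_of_nonneg hβ]
    · rw [norm_mul, hs]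
  have := mul_le_mul_of_nonneg_left h (norm_nonneg u)
  nlinarith

/-- Summation of pointwise bounds for one equation over the frequencies. -/
lemma sum_weight_le {u v N : Wiener} {α β : ℝ} {I : ℤ → ℝ} (hβ : 0 ≤ β)
    (hI : ∀ k ∈ modes n, I k ≤ α * |(k : ℝ)| ^ (m + 1) * ‖u k‖ ^ 2
      + β * |(k : ℝ)| ^ (m + 1) * (‖u k‖ * ‖v k‖) + ‖u k‖ * (|(k : ℝ)| ^ 1 * ‖N k‖)) :
    ∑ k ∈ modes n, |(k : ℝ)| ^ (m + 1) * I k ≤ α * √(en n (2 * (m + 1)) u) ^ 2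
      + β * (√(en n (2 * (m + 1)) u) * √(en n (2 * (m + 1)) v))
      + ∑ k ∈ modes n, |(k : ℝ)| ^ (m + 1) * ‖u k‖ * (|(k : ℝ)| ^ 1 * ‖N k‖) := by
  have e1 : ∀ v : Wiener, ∑ k ∈ modes n, (|(k : ℝ)| ^ (m + 1) * ‖v k‖) ^ 2 = en n (2 * (m + 1)) v :=
    fun v => Finset.sum_congr rfl fun k _ => by rw [mul_pow, ← pow_mul, mul_comm (m + 1)]
  have cs := Real.sum_mul_le_sqrt_mul_sqrt (modes n) (fun k => |(k : ℝ)| ^ (m + 1) * ‖u k‖)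
    (fun k => |(k : ℝ)| ^ (m + 1) * ‖v k‖)
  rw [e1, e1] at cs
  rw [Real.sq_sqrt (en_nonneg _ _ _), ← e1 u]
  calc ∑ k ∈ modes n, |(k : ℝ)| ^ (m + 1) * I k
      ≤ ∑ k ∈ modes n, (α * (|(k : ℝ)| ^ (m + 1) * ‖u k‖) ^ 2
        + β * (|(k : ℝ)| ^ (m + 1) * ‖u k‖ * (|(k : ℝ)| ^ (m + 1) * ‖v k‖))
        + |(k : ℝ)| ^ (m + 1) * ‖u k‖ * (|(k : ℝ)| ^ 1 * ‖N k‖)) := by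
        refine Finset.sum_le_sum fun k hk => ?_
        refine (mul_le_mul_of_nonneg_left (hI k hk) (by positivity)).trans_eq ?_
        ring
    _ ≤ _ := by
        simp only [Finset.sum_add_distrib, ← Finset.mul_sum]
        have := mul_le_mul_of_nonneg_left cs hβ
        rw [e1]
        linarith

/-- The algebra of the energy estimate.  Here `X² + Y²` is the dissipation, `S` a lower order factor,
and `d₁`, `d₂` are the weights for which the cross terms complete the square `-(d₁ X - d₂ Y)²`. -/
lemma energy_algebra {a₁₁ a₁₂ a₂₁ a₂₂ b₁₁ b₁₂ b₂₁ b₂₂ K X Y S W C η d₁ d₂ κ I₁ I₂ T₁ T₂ : ℝ}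
    (A11 : 0 ≤ a₁₁) (A12 : 0 ≤ a₁₂) (A21 : 0 ≤ a₂₁) (A22 : 0 ≤ a₂₂) (N11 : 0 ≤ b₁₁)
    (N12 : 0 ≤ b₁₂) (N21 : 0 ≤ b₂₁) (N22 : 0 ≤ b₂₂) (hK : 0 ≤ K) (X0 : 0 ≤ X) (Y0 : 0 ≤ Y)
    (S0 : 0 ≤ S) (W0 : 0 ≤ W) (C0 : 0 ≤ C) (η0 : 0 ≤ η) (d₁0 : 0 ≤ d₁) (d₂0 : 0 ≤ d₂)
    (hd₁ : d₁ = a₂₁ + b₂₁) (hd₂ : d₂ = a₁₂ + b₁₂)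
    (κ1 : κ ≤ d₁ * (a₁₁ - b₁₁ - d₁)) (κ2 : κ ≤ d₂ * (a₂₂ - b₂₂ - d₂))
    (ηκ : K * (d₁ + d₂) * η ≤ κ / 2)
    (t1 : I₁ ≤ -a₁₁ * X ^ 2 + a₁₂ * (X * Y) + X * (b₁₁ * X + b₁₂ * Y + K * S))
    (t2 : I₂ ≤ -a₂₂ * Y ^ 2 + a₂₁ * (Y * X) + Y * (b₂₁ * X + b₂₂ * Y + K * S))
    (t3 : T₁ ≤ a₁₁ * X ^ 2 + a₁₂ * (X * Y) + X * (b₁₁ * X + b₁₂ * Y + K * S))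
    (t4 : T₂ ≤ a₂₂ * Y ^ 2 + a₂₁ * (Y * X) + Y * (b₂₁ * X + b₂₂ * Y + K * S))
    (low : S * (X + Y) ≤ η * (X ^ 2 + Y ^ 2) + C * W) :
    d₁ * I₁ + d₂ * I₂ ≤ -(κ / 2) * (X ^ 2 + Y ^ 2) + (K * (d₁ + d₂ + 1) * C
      + (a₁₁ + a₁₂ + a₂₁ + a₂₂ + b₁₁ + b₁₂ + b₂₁ + b₂₂) + K * η) * W ∧
    T₁ + T₂ ≤ (K * (d₁ + d₂ + 1) * C
        + (a₁₁ + a₁₂ + a₂₁ + a₂₂ + b₁₁ + b₁₂ + b₂₁ + b₂₂) + K * η) * (X ^ 2 + Y ^ 2)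
      + (K * (d₁ + d₂ + 1) * C
        + (a₁₁ + a₁₂ + a₂₁ + a₂₂ + b₁₁ + b₁₂ + b₂₁ + b₂₂) + K * η) * W := by
  have hZ : 0 ≤ X ^ 2 + Y ^ 2 := by positivity
  constructor
  · have u1 := mul_le_mul_of_nonneg_left t1 d₁0
    have u2 := mul_le_mul_of_nonneg_left t2 d₂0
    have u3 : d₁ * (-a₁₁ * X ^ 2 + a₁₂ * (X * Y) + X * (b₁₁ * X + b₁₂ * Y + K * S))
        + d₂ * (-a₂₂ * Y ^ 2 + a₂₁ * (Y * X) + Y * (b₂₁ * X + b₂₂ * Y + K * S))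
        = -(d₁ * (a₁₁ - b₁₁ - d₁)) * X ^ 2 - d₂ * (a₂₂ - b₂₂ - d₂) * Y ^ 2 - (d₁ * X - d₂ * Y) ^ 2
          + K * (S * (d₁ * X + d₂ * Y)) := by
      rw [hd₁, hd₂]; ring
    have u4 := mul_le_mul_of_nonneg_right κ1 (sq_nonneg X)
    have u5 := mul_le_mul_of_nonneg_right κ2 (sq_nonneg Y)
    have u6 : K * (S * (d₁ * X + d₂ * Y)) ≤ K * (d₁ + d₂) * (S * (X + Y)) := by
      have : 0 ≤ K * S * (d₁ * Y + d₂ * X) := by positivity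
      linarith
    have u7 := mul_le_mul_of_nonneg_left low (show 0 ≤ K * (d₁ + d₂) by positivity)
    have u8 := mul_le_mul_of_nonneg_right ηκ hZ
    have u9 : 0 ≤ (K * C + (a₁₁ + a₁₂ + a₂₁ + a₂₂ + b₁₁ + b₁₂ + b₂₁ + b₂₂) + K * η) * W := by
      positivity
    have u10 := sq_nonneg (d₁ * X - d₂ * Y)
    linarith
  · have xy : X * Y ≤ X ^ 2 + Y ^ 2 := by nlinarith [sq_nonneg (X - Y)]
    have v1 := mul_le_mul_of_nonneg_left xy (show 0 ≤ a₁₂ + a₂₁ + b₁₂ + b₂₁ by positivity)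
    have v2 : 0 ≤ (a₁₁ + b₁₁) * Y ^ 2 + (a₂₂ + b₂₂) * X ^ 2 := by positivity
    have v3 := mul_le_mul_of_nonneg_left low hK
    have v4 : 0 ≤ K * (d₁ + d₂ + 1) * C * (X ^ 2 + Y ^ 2) := by positivity
    have v5 : 0 ≤ (K * (d₁ + d₂) * C
        + (a₁₁ + a₁₂ + a₂₁ + a₂₂ + b₁₁ + b₁₂ + b₂₁ + b₂₂) + K * η) * W := by positivity
    linarith

/-- The energy estimate.  The conditions `Σ₁, Σ₂ > 0` say that the mobility matrix is dominated by
its diagonal, column by column.  For such a matrix the weights `d₁`, `d₂`, chosen as the bounds of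
the off-diagonal entries, make the symmetric part positive definite. -/
lemma exists_energy_dissipation {e : ℝ} (h : P.Adm e) (hm : m = 1 ∨ m = 3) :
    ∃ d₁ d₂ κ C : ℝ, 0 < d₁ ∧ 0 < d₂ ∧ 0 < κ ∧ 0 ≤ C ∧ ∀ {n : ℕ} {f g : Wiener}, Supp n f →
      Supp n g → ‖f‖ + ‖g‖ ≤ e →
      (d₁ * ∑ k ∈ modes n, |(k : ℝ)| ^ (m + 1) * inner ℝ (f k) (P.V₁ n m f g k)
        + d₂ * ∑ k ∈ modes n, |(k : ℝ)| ^ (m + 1) * inner ℝ (g k) (P.V₂ n m f g k)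
        ≤ -κ * (en n (2 * (m + 1)) f + en n (2 * (m + 1)) g)
          + C * (wt (m + 1) f + wt (m + 1) g) * (en n (m + 1) f + en n (m + 1) g)) ∧
      ((∑ k ∈ modes n, |(k : ℝ)| ^ (m + 1) * (‖f k‖ * ‖P.V₁ n m f g k‖))
        + ∑ k ∈ modes n, |(k : ℝ)| ^ (m + 1) * (‖g k‖ * ‖P.V₂ n m f g k‖)
        ≤ C * (en n (2 * (m + 1)) f + en n (2 * (m + 1)) g)
          + C * (wt (m + 1) f + wt (m + 1) g) * (en n (m + 1) f + en n (m + 1) g)) := by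
  have hodd : Odd m := by rcases hm with rfl | rfl <;> decide
  have he := h.nonneg
  obtain ⟨K, hK, hmaj⟩ := exists_maj h.pos he
  have ρ0 := h.pos.ρ.le
  have μ0 := h.pos.μ.le
  have F0 := h.pos.F.le
  have G0 := h.pos.G.le
  have N11 : 0 ≤ n₁₁ P.ρ P.F P.G e e := by rw [n₁₁, mixed, cubic]; positivity
  have N12 : 0 ≤ n₁₂ P.F P.G e e := by rw [n₁₂, mixed, cubic]; positivity
  have N21 : 0 ≤ n₂₁ P.ρ P.μ P.F P.G e e := by rw [n₂₁, mixed, mixed, cubic]; positivity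
  have N22 : 0 ≤ n₂₂ P.μ P.F P.G e e := by rw [n₂₂, mixed, mixed, cubic]; positivity
  have c1 : Sigma₁ P.ρ P.μ P.F P.G e ≤ P.a₁₁ - P.a₂₁ - n₁₁ P.ρ P.F P.G e e
      - n₂₁ P.ρ P.μ P.F P.G e e := by
    rw [← sub_nonneg, a₁₁, a₂₁, Sigma₁, n₁₁, n₂₁, mixed, mixed, cubic, cubic]
    ring_nf
    positivity
  have c2 : Sigma₂ P.ρ P.μ P.F P.G e ≤ P.a₂₂ - P.a₁₂ - n₁₂ P.F P.G e e
      - n₂₂ P.μ P.F P.G e e := by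
    rw [← sub_nonneg, a₂₂, a₁₂, Sigma₂, n₁₂, n₂₂, mixed, mixed, cubic, cubic]
    ring_nf
    positivity
  have s1 := h.sigma₁
  have s2 := h.sigma₂
  have A11 := h.pos.a₁₁
  have A12 := h.pos.a₁₂
  have A21 := h.pos.a₂₁
  have A22 := h.pos.a₂₂
  generalize hN11 : n₁₁ P.ρ P.F P.G e e = b₁₁ at *
  generalize hN12 : n₁₂ P.F P.G e e = b₁₂ at *
  generalize hN21 : n₂₁ P.ρ P.μ P.F P.G e e = b₂₁ at *
  generalize hN22 : n₂₂ P.μ P.F P.G e e = b₂₂ at *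
  generalize Sigma₁ P.ρ P.μ P.F P.G e = σ₁ at *
  generalize Sigma₂ P.ρ P.μ P.F P.G e = σ₂ at *
  obtain ⟨d₁, hd₁⟩ : ∃ d₁, d₁ = P.a₂₁ + b₂₁ := ⟨_, rfl⟩
  obtain ⟨d₂, hd₂⟩ : ∃ d₂, d₂ = P.a₁₂ + b₁₂ := ⟨_, rfl⟩
  have d₁0 : 0 < d₁ := by linarith
  have d₂0 : 0 < d₂ := by linarith
  obtain ⟨κ, hκ⟩ : ∃ κ, κ = min (d₁ * σ₁) (d₂ * σ₂) := ⟨_, rfl⟩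
  have κ0 : 0 < κ := by rw [hκ]; exact lt_min (by positivity) (by positivity)
  have κ1 : κ ≤ d₁ * σ₁ := hκ ▸ min_le_left _ _
  have κ2 : κ ≤ d₂ * σ₂ := hκ ▸ min_le_right _ _
  obtain ⟨η, hη⟩ : ∃ η, η = κ / (2 * (K * (d₁ + d₂) + 1)) := ⟨_, rfl⟩
  have η0 : 0 < η := by rw [hη]; positivity
  have ηκ : K * (d₁ + d₂) * η ≤ κ / 2 := by
    rw [hη, ← mul_div_assoc, div_le_div_iff₀ (by positivity) (by positivity)]
    nlinarith
  obtain ⟨C, hC0, hC⟩ := lower_order_le hm he η0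
  have M0 : 0 ≤ P.a₁₁ + P.a₁₂ + P.a₂₁ + P.a₂₂ + b₁₁ + b₁₂ + b₂₁ + b₂₂ := by positivity
  refine ⟨d₁, d₂, κ / 2, K * (d₁ + d₂ + 1) * C
    + (P.a₁₁ + P.a₁₂ + P.a₂₁ + P.a₂₂ + b₁₁ + b₁₂ + b₂₁ + b₂₂) + K * η,
    d₁0, d₂0, by positivity, by positivity, fun {n f g} hf hg hfg => ?_⟩
  have hfe : ‖f‖ ≤ e := by linarith [norm_nonneg g]
  have hge : ‖g‖ ≤ e := by linarith [norm_nonneg f]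
  obtain ⟨m11, m12, m21, m22⟩ := hmaj hf hg hfe hge
  have p1 := pairing_nl_le (m := m) m11 m12 hf hg f
  have p2 := pairing_nl_le (m := m) m21 m22 hf hg g
  have low := hC hf hg hfe hge
  have i1 := sum_weight_le (n := n) (m := m) (u := f) (v := g)
    (N := P.nl₁ f g (cut n (dsym m) f) (cut n (dsym m) g)) (α := -P.a₁₁) A12.le
    (fun k hk => (inner_V_le (β := P.a₁₂ * |(k : ℝ)| ^ (m + 1)) (by positivity) (norm_dsym 1 k)
      (V₁_apply (P := P) (f := f) (g := g) hodd hk)).trans_eq (by ring))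
  have i2 := sum_weight_le (n := n) (m := m) (u := g) (v := f)
    (N := P.nl₂ f g (cut n (dsym m) f) (cut n (dsym m) g)) (α := -P.a₂₂) A21.le
    (fun k hk => (inner_V_le (α := P.a₂₂ * |(k : ℝ)| ^ (m + 1))
      (β := P.a₂₁ * |(k : ℝ)| ^ (m + 1)) (by positivity) (norm_dsym 1 k)
      (V₂_apply (P := P) (f := f) (g := g) hodd hk)).trans_eq (by ring))
  have j1 := sum_weight_le (n := n) (m := m) (u := f) (v := g)
    (N := P.nl₁ f g (cut n (dsym m) f) (cut n (dsym m) g)) (α := P.a₁₁) A12.le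
    (fun k hk => norm_V_le (α := P.a₁₁ * |(k : ℝ)| ^ (m + 1))
      (β := P.a₁₂ * |(k : ℝ)| ^ (m + 1)) (by positivity) (by positivity)
      (norm_dsym 1 k) (V₁_apply (P := P) (f := f) (g := g) hodd hk))
  have j2 := sum_weight_le (n := n) (m := m) (u := g) (v := f)
    (N := P.nl₂ f g (cut n (dsym m) f) (cut n (dsym m) g)) (α := P.a₂₂) A21.le
    (fun k hk => norm_V_le (α := P.a₂₂ * |(k : ℝ)| ^ (m + 1))
      (β := P.a₂₁ * |(k : ℝ)| ^ (m + 1)) (by positivity) (by positivity)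
      (norm_dsym 1 k) (V₂_apply (P := P) (f := f) (g := g) hodd hk))
  have q1 := Real.sq_sqrt (en_nonneg n (2 * (m + 1)) f)
  have q2 := Real.sq_sqrt (en_nonneg n (2 * (m + 1)) g)
  have X0 := Real.sqrt_nonneg (en n (2 * (m + 1)) f)
  have Y0 := Real.sqrt_nonneg (en n (2 * (m + 1)) g)
  have S0 : 0 ≤ (wt 1 f + wt 1 g) * (√(en n (2 * m) f) + √(en n (2 * m) g)) :=
    mul_nonneg (add_nonneg (wt_nonneg _ _) (wt_nonneg _ _))
      (add_nonneg (Real.sqrt_nonneg _) (Real.sqrt_nonneg _))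
  have W0 : 0 ≤ (wt (m + 1) f + wt (m + 1) g) * (en n (m + 1) f + en n (m + 1) g) :=
    mul_nonneg (add_nonneg (wt_nonneg _ _) (wt_nonneg _ _))
      (add_nonneg (en_nonneg _ _ _) (en_nonneg _ _ _))
  rw [mul_assoc K] at p1 p2
  rw [mul_assoc C] at low
  unfold nl₁ at i1 j1
  unfold nl₂ at i2 j2
  rw [mul_assoc _ (wt (m + 1) f + wt (m + 1) g)]
  generalize (wt 1 f + wt 1 g) * (√(en n (2 * m) f) + √(en n (2 * m) g)) = S at *
  generalize (wt (m + 1) f + wt (m + 1) g) * (en n (m + 1) f + en n (m + 1) g) = W at *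
  have t1 := i1.trans (add_le_add_right p1 _)
  have t2 := i2.trans (add_le_add_right p2 _)
  have t3 := j1.trans (add_le_add_right p1 _)
  have t4 := j2.trans (add_le_add_right p2 _)
  have hT := energy_algebra A11.le A12.le A21.le A22.le N11 N12 N21 N22 hK X0 Y0 S0 W0 hC0 η0.le
    d₁0.le d₂0.le hd₁ hd₂ (κ1.trans (mul_le_mul_of_nonneg_left (by linarith) d₁0.le))
    (κ2.trans (mul_le_mul_of_nonneg_left (by linarith) d₂0.le)) ηκ t1 t2 t3 t4
    (by rw [q1, q2]; exact low)
  rw [q1, q2] at hT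
  exact hT

end Par

open Wiener

/-! ### Ordinary differential equations with locally Lipschitz right-hand side -/

/-- Maps that are bounded and Lipschitz on bounded sets. -/
def BddLip {E F : Type*} [NormedAddCommGroup E] [NormedAddCommGroup F] (Φ : E → F) : Prop :=
  ∀ R : ℝ, ∃ K : ℝ, 0 ≤ K ∧ ∀ u v, ‖u‖ ≤ R → ‖v‖ ≤ R → ‖Φ u‖ ≤ K ∧ ‖Φ u - Φ v‖ ≤ K * ‖u - v‖

namespace BddLip

variable {E F H : Type*} [NormedAddCommGroup E] [NormedAddCommGroup F] [NormedAddCommGroup H]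

lemma const (c : F) : BddLip fun _ : E => c := fun _ =>
  ⟨‖c‖, norm_nonneg c, fun u v _ _ => ⟨le_rfl, by simp; positivity⟩⟩

lemma add {Φ Ψ : E → F} (h : BddLip Φ) (h' : BddLip Ψ) : BddLip fun u => Φ u + Ψ u := fun R => by
  obtain ⟨K, hK, hΦ⟩ := h R
  obtain ⟨L, hL, hΨ⟩ := h' R
  refine ⟨K + L, by positivity, fun u v hu hv => ⟨?_, ?_⟩⟩
  · exact (norm_add_le _ _).trans (add_le_add (hΦ u v hu hv).1 (hΨ u v hu hv).1)
  · rw [add_sub_add_comm, add_mul]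
    exact (norm_add_le _ _).trans (add_le_add (hΦ u v hu hv).2 (hΨ u v hu hv).2)

lemma mul {F : Type*} [NormedCommRing F] {Φ Ψ : E → F} (h : BddLip Φ) (h' : BddLip Ψ) :
    BddLip fun u => Φ u * Ψ u := fun R => by
  obtain ⟨K, hK, hΦ⟩ := h R
  obtain ⟨L, hL, hΨ⟩ := h' R
  refine ⟨2 * (K * L), by positivity, fun u v hu hv => ⟨?_, ?_⟩⟩
  · have := (norm_mul_le (Φ u) (Ψ u)).trans
      (mul_le_mul (hΦ u v hu hv).1 (hΨ u v hu hv).1 (norm_nonneg _) hK)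
    have : 0 ≤ K * L := by positivity
    linarith
  · have e : Φ u * Ψ u - Φ v * Ψ v = Φ u * (Ψ u - Ψ v) + (Φ u - Φ v) * Ψ v := by ring
    rw [e]
    refine (norm_add_le _ _).trans ?_
    have h1 := (norm_mul_le (Φ u) (Ψ u - Ψ v)).trans
      (mul_le_mul (hΦ u v hu hv).1 (hΨ u v hu hv).2 (norm_nonneg _) hK)
    have h2 := (norm_mul_le (Φ u - Φ v) (Ψ v)).trans
      (mul_le_mul (hΦ u v hu hv).2 (hΨ v u hv hu).1 (norm_nonneg _) (by positivity))
    linarith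

lemma pow {F : Type*} [NormedCommRing F] {Φ : E → F} (h : BddLip Φ) (n : ℕ) :
    BddLip fun u => Φ u ^ n := by
  induction n with
  | zero => simpa using BddLip.const (E := E) (1 : F)
  | succ n ih => simpa only [pow_succ] using ih.mul h

lemma clm {𝕜 : Type*} [NontriviallyNormedField 𝕜] [NormedSpace 𝕜 F] [NormedSpace 𝕜 H]
    (L : F →L[𝕜] H) {Φ : E → F} (h : BddLip Φ) : BddLip fun u => L (Φ u) := fun R => by
  obtain ⟨K, hK, hΦ⟩ := h R
  refine ⟨‖L‖ * K, by positivity, fun u v hu hv => ⟨?_, ?_⟩⟩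
  · exact L.le_opNorm_of_le (hΦ u v hu hv).1
  · rw [← map_sub, mul_assoc]
    exact L.le_opNorm_of_le (hΦ u v hu hv).2

lemma prodMk {Φ : E → F} {Ψ : E → H} (h : BddLip Φ) (h' : BddLip Ψ) :
    BddLip fun u => (Φ u, Ψ u) := fun R => by
  obtain ⟨K, hK, hΦ⟩ := h R
  obtain ⟨L, hL, hΨ⟩ := h' R
  refine ⟨max K L, le_max_of_le_left hK, fun u v hu hv => ⟨?_, ?_⟩⟩
  · exact max_le_max (hΦ u v hu hv).1 (hΨ u v hu hv).1
  · rw [Prod.mk_sub_mk, Prod.norm_def, max_mul_of_nonneg _ _ (norm_nonneg _)]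
    exact max_le_max (hΦ u v hu hv).2 (hΨ u v hu hv).2

lemma fst : BddLip fun u : E × F => u.1 := fun R =>
  ⟨max R 1, by positivity, fun u v hu _ => ⟨(norm_fst_le u).trans (hu.trans (le_max_left _ _)),
    (norm_fst_le (u - v)).trans (le_mul_of_one_le_left (norm_nonneg _) (le_max_right _ _))⟩⟩

lemma snd : BddLip fun u : E × F => u.2 := fun R =>
  ⟨max R 1, by positivity, fun u v hu _ => ⟨(norm_snd_le u).trans (hu.trans (le_max_left _ _)),
    (norm_snd_le (u - v)).trans (le_mul_of_one_le_left (norm_nonneg _) (le_max_right _ _))⟩⟩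

end BddLip

/-- A cutoff function, `1` for `‖u‖ ≤ R` and `0` for `‖u‖ ≥ R + 1`. -/
def cutoff {E : Type*} [NormedAddCommGroup E] (R : ℝ) (u : E) : ℝ := max 0 (min 1 (R + 1 - ‖u‖))

section Cutoff

variable {E : Type*} [NormedAddCommGroup E]

lemma cutoff_of_le {R : ℝ} {u : E} (h : ‖u‖ ≤ R) : cutoff R u = 1 := by
  rw [cutoff, min_eq_left (by linarith), max_eq_right zero_le_one]

lemma cutoff_of_ge {R : ℝ} {u : E} (h : R + 1 ≤ ‖u‖) : cutoff R u = 0 := by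
  rw [cutoff, max_eq_left]; exact (min_le_right _ _).trans (by linarith)

lemma cutoff_nonneg (R : ℝ) (u : E) : 0 ≤ cutoff R u := le_max_left _ _

lemma cutoff_le_one (R : ℝ) (u : E) : cutoff R u ≤ 1 := max_le zero_le_one (min_le_left _ _)

lemma abs_cutoff_sub_le (R : ℝ) (u v : E) : |cutoff R u - cutoff R v| ≤ ‖u - v‖ := by
  rw [cutoff, cutoff]
  refine (abs_max_sub_max_le_max _ _ _ _).trans ?_
  rw [sub_self, abs_zero]
  refine max_le (norm_nonneg _) ((abs_min_sub_min_le_max _ _ _ _).trans ?_)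
  rw [sub_self, abs_zero]
  refine max_le (norm_nonneg _) ?_
  rw [show R + 1 - ‖u‖ - (R + 1 - ‖v‖) = -(‖u‖ - ‖v‖) by ring, abs_neg]
  exact abs_norm_sub_norm_le u v

variable [NormedSpace ℝ E]

/-- A vector field that is Lipschitz on bounded sets becomes globally bounded and Lipschitz after
multiplication by a cutoff. -/
lemma BddLip.exists_cutoff {V : E → E} (hV : BddLip V) (R : ℝ) :
    ∃ K : NNReal, LipschitzWith K (fun u => cutoff R u • V u) ∧ ∀ u, ‖cutoff R u • V u‖ ≤ K := by
  obtain ⟨K, hK, h⟩ := hV (R + 1)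
  have hin : ∀ u v : E, ‖u‖ ≤ R + 1 → ‖cutoff R u • V u - cutoff R v • V v‖ ≤ 2 * K * ‖u - v‖ := by
    intro u v hu
    rcases le_total ‖v‖ (R + 1) with hv | hv
    · have e : cutoff R u • V u - cutoff R v • V v
          = (cutoff R u - cutoff R v) • V u + cutoff R v • (V u - V v) := by
        rw [sub_smul, smul_sub]; abel
      rw [e]
      refine (norm_add_le _ _).trans ?_
      rw [norm_smul, norm_smul, Real.norm_eq_abs, Real.norm_of_nonneg (cutoff_nonneg R v)]
      have h1 := mul_le_mul (abs_cutoff_sub_le R u v) (h u v hu hv).1 (norm_nonneg _)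
        (norm_nonneg _)
      have h2 := mul_le_mul (cutoff_le_one R v) (h u v hu hv).2 (norm_nonneg _) zero_le_one
      linarith
    · have h1 := mul_le_mul (abs_cutoff_sub_le R u v) (h u u hu hu).1 (norm_nonneg _)
        (norm_nonneg _)
      have h2 : 0 ≤ K * ‖u - v‖ := by positivity
      rw [cutoff_of_ge hv, sub_zero] at h1
      rw [cutoff_of_ge hv, zero_smul, sub_zero, norm_smul, Real.norm_eq_abs]
      linarith
  have h2K : ((2 * K).toNNReal : ℝ) = 2 * K := Real.coe_toNNReal _ (by positivity)
  refine ⟨(2 * K).toNNReal, LipschitzWith.of_dist_le_mul fun u v => ?_, fun u => ?_⟩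
  · rw [dist_eq_norm, dist_eq_norm, h2K]
    rcases le_total ‖u‖ (R + 1) with hu | hu
    · exact hin u v hu
    rcases le_total ‖v‖ (R + 1) with hv | hv
    · rw [norm_sub_rev, norm_sub_rev u]; exact hin v u hv
    · rw [cutoff_of_ge hu, cutoff_of_ge hv]; simp; positivity
  · rw [h2K]
    rcases le_total ‖u‖ (R + 1) with hu | hu
    · rw [norm_smul, Real.norm_of_nonneg (cutoff_nonneg R u)]
      have := mul_le_mul (cutoff_le_one R u) (h u u hu hu).1 (norm_nonneg _) zero_le_one
      linarith
    · rw [cutoff_of_ge hu]; simp; positivity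

/-- A bounded Lipschitz vector field has integral curves on arbitrarily long time intervals. -/
lemma exists_integralCurve [CompleteSpace E] {V : E → E} {K : NNReal} (hL : LipschitzWith K V)
    (hb : ∀ u, ‖V u‖ ≤ K) (x₀ : E) {T : ℝ} (hT : 0 ≤ T) :
    ∃ u : ℝ → E, u 0 = x₀ ∧ ∀ t ∈ Ioo (-T) T, HasDerivAt u (V (u t)) t := by
  obtain ⟨u, hu, hu'⟩ := (IsPicardLindelof.of_time_independent (f := V) (tmin := -T) (tmax := T)
    (t₀ := ⟨0, by constructor <;> linarith⟩) (x₀ := x₀) (a := K * T.toNNReal) (r := 0) (L := K) (K := K)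
    (fun x _ => hb x) (hL.lipschitzOnWith) (by simp [hT])).exists_eq_forall_mem_Icc_hasDerivWithinAt₀
  exact ⟨u, hu, fun t ht => (hu' t (Ioo_subset_Icc_self ht)).hasDerivAt (Icc_mem_nhds ht.1 ht.2)⟩

end Cutoff

/-! ### Real-valued functions in the Wiener algebra -/

namespace Wiener

/-- The Fourier coefficients are those of a real function. -/
def IsReal (u : Wiener) : Prop := ∀ k, u (-k) = (starRingEnd ℂ) (u k)

/-- Complex conjugation of functions, as a ring homomorphism of the Wiener algebra. -/
def conjFun (u : Wiener) : Wiener :=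
  of (fun k => (starRingEnd ℂ) (u (-k))) (by
    simp_rw [RCLike.norm_conj]
    exact (Equiv.neg ℤ).summable_iff.2 u.summable_norm)

@[simp] lemma conjFun_apply (u : Wiener) (k : ℤ) : conjFun u k = (starRingEnd ℂ) (u (-k)) := rfl

lemma isReal_iff {u : Wiener} : IsReal u ↔ conjFun u = u := by
  constructor
  · intro h; ext k; rw [conjFun_apply, h k, Complex.conj_conj]
  · intro h k
    have := congrArg (fun v : Wiener => v (-k)) h
    simpa using this.symm

lemma norm_conjFun (u : Wiener) : ‖conjFun u‖ = ‖u‖ := by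
  rw [norm_def, norm_def, ← (Equiv.neg ℤ).tsum_eq fun k => ‖u k‖]
  simp

lemma ev_conjFun (u : Wiener) (x : ℝ) : ev (conjFun u) x = (starRingEnd ℂ) (ev u x) := by
  rw [ev, ev, Complex.conj_tsum, ← (Equiv.neg ℤ).tsum_eq fun k => (starRingEnd ℂ) (u k * chr k x)]
  refine tsum_congr fun k => ?_
  rw [conjFun_apply, map_mul, Equiv.neg_apply, chr_neg, Complex.conj_conj]

/-- The conjugation `conjFun` as a ring homomorphism; it corresponds to pointwise conjugation. -/
def conjHom : Wiener →+* Wiener where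
  toFun := conjFun
  map_one' := ev_injective fun x => by simp [ev_conjFun]
  map_mul' u v := ev_injective fun x => by simp [ev_conjFun]
  map_zero' := by ext; simp
  map_add' u v := by ext; simp

lemma conjHom_apply (u : Wiener) : conjHom u = conjFun u := rfl

/-- Conjugation as a continuous real-linear map. -/
def conjL : Wiener →L[ℝ] Wiener :=
  LinearMap.mkContinuous ⟨⟨conjFun, conjHom.map_add⟩, fun c u => by ext; simp⟩ 1 fun u => by
    rw [one_mul]; exact (norm_conjFun u).le

lemma conjL_apply (u : Wiener) : conjL u = conjFun u := rfl

lemma conjHom_const (c : ℝ) : conjHom (const c) = const c :=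
  ev_injective fun x => by rw [conjHom_apply, ev_conjFun]; simp

lemma conj_dsym {m : ℕ} (hm : Odd m) (k : ℤ) : (starRingEnd ℂ) (dsym m (-k)) = dsym m k := by
  simp [dsym, hm.neg_pow]

lemma conjHom_cut {n m : ℕ} (hm : Odd m) (u : Wiener) :
    conjHom (cut n (dsym m) u) = cut n (dsym m) (conjHom u) := by
  ext k
  rw [conjHom_apply, conjHom_apply, conjFun_apply, cut_apply, cut_apply, conjFun_apply]
  have : -k ∈ modes n ↔ k ∈ modes n := by simp [mem_modes]
  by_cases hk : k ∈ modes n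
  · rw [if_pos hk, if_pos (this.2 hk), map_mul, conj_dsym hm]
  · rw [if_neg hk, if_neg (mt this.1 hk), map_zero]

end Wiener

namespace Par

variable (P : Par) (n m : ℕ)

/-- The Galerkin vector field. -/
def V (u : Wiener × Wiener) : Wiener × Wiener := (P.V₁ n m u.1 u.2, P.V₂ n m u.1 u.2)

lemma conj_J₁ (f g a b : Wiener) :
    conjHom (P.J₁ f g a b) = P.J₁ (conjHom f) (conjHom g) (conjHom a) (conjHom b) := by
  simp only [J₁, nl₁, w₁₁, w₁₂, map_add, map_mul, map_n₁₁, map_n₁₂, conjHom_const]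

lemma conj_J₂ (f g a b : Wiener) :
    conjHom (P.J₂ f g a b) = P.J₂ (conjHom f) (conjHom g) (conjHom a) (conjHom b) := by
  simp only [J₂, nl₂, w₂₁, w₂₂, map_add, map_mul, map_n₂₁, map_n₂₂, conjHom_const]

lemma conj_V₁ {m : ℕ} (hm : Odd m) (f g : Wiener) :
    conjHom (P.V₁ n m f g) = P.V₁ n m (conjHom f) (conjHom g) := by
  rw [V₁, V₁, conjHom_cut odd_one, conj_J₁, conjHom_cut hm, conjHom_cut hm]

lemma conj_V₂ {m : ℕ} (hm : Odd m) (f g : Wiener) :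
    conjHom (P.V₂ n m f g) = P.V₂ n m (conjHom f) (conjHom g) := by
  rw [V₂, V₂, conjHom_cut odd_one, conj_J₂, conjHom_cut hm, conjHom_cut hm]

section BddLip

variable {E : Type*} [NormedAddCommGroup E] {Φ Ψ : E → Wiener}

lemma bddLip_cubic (F : Wiener) (h : BddLip Φ) : BddLip fun u => cubic F (Φ u) :=
  ((h.pow 3).add (((BddLip.const 3).mul (h.pow 2)).mul (.const F))).add
    (((BddLip.const 3).mul h).mul (.const (F ^ 2)))

lemma bddLip_mixed (F G : Wiener) (h : BddLip Φ) (h' : BddLip Ψ) :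
    BddLip fun u => mixed F G (Φ u) (Ψ u) :=
  (((((h.pow 2).mul h').add ((((BddLip.const 2).mul h).mul h').mul (.const F))).add
    ((h.pow 2).mul (.const G))).add (h'.mul (.const (F ^ 2)))).add
    ((((BddLip.const 2).mul h).mul (.const F)).mul (.const G))

lemma bddLip_w₁₁ (h : BddLip Φ) (h' : BddLip Ψ) : BddLip fun u => P.w₁₁ (Φ u) (Ψ u) :=
  ((BddLip.const 3).mul (bddLip_mixed _ _ h h')).add ((BddLip.const (2 * _)).mul (bddLip_cubic _ h))

lemma bddLip_w₁₂ (h : BddLip Φ) (h' : BddLip Ψ) : BddLip fun u => P.w₁₂ (Φ u) (Ψ u) :=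
  ((BddLip.const 3).mul (bddLip_mixed _ _ h h')).add ((BddLip.const 2).mul (bddLip_cubic _ h))

lemma bddLip_w₂₁ (h : BddLip Φ) (h' : BddLip Ψ) : BddLip fun u => P.w₂₁ (Φ u) (Ψ u) :=
  (((BddLip.const (2 * _)).mul (bddLip_cubic _ h')).add
    ((BddLip.const (3 * _)).mul (bddLip_mixed _ _ h h'))).add
    ((BddLip.const 6).mul (bddLip_mixed _ _ h' h))

lemma bddLip_w₂₂ (h : BddLip Φ) (h' : BddLip Ψ) : BddLip fun u => P.w₂₂ (Φ u) (Ψ u) :=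
  (((BddLip.const (2 * _)).mul (bddLip_cubic _ h')).add
    ((BddLip.const 3).mul (bddLip_mixed _ _ h h'))).add
    ((BddLip.const 6).mul (bddLip_mixed _ _ h' h))

lemma bddLip_V : BddLip (P.V n m) := by
  have hf : BddLip fun u : Wiener × Wiener => u.1 := .fst
  have hg : BddLip fun u : Wiener × Wiener => u.2 := .snd
  have ha := hf.clm (cut n (dsym m))
  have hb := hg.clm (cut n (dsym m))
  exact ((((BddLip.const (const P.a₁₁)).mul ha).add ((BddLip.const (const P.a₁₂)).mul hb)).add
    (((P.bddLip_w₁₁ hf hg).mul ha).add ((P.bddLip_w₁₂ hf hg).mul hb))).clm (cut n (dsym 1)) |>.prodMk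
    (((((BddLip.const (const P.a₂₁)).mul ha).add ((BddLip.const (const P.a₂₂)).mul hb)).add
    (((P.bddLip_w₂₁ hf hg).mul ha).add ((P.bddLip_w₂₂ hf hg).mul hb))).clm (cut n (dsym 1)))

end BddLip

end Par

open Wiener

/-! ### The Galerkin approximation -/

/-- A bound for explicit Euler steps bounds the right derivative of the norm. -/
lemma slope_norm_add_norm_lt {E : Type*} [NormedAddCommGroup E] [NormedSpace ℝ E] {f g : ℝ → E}
    {v w : E} {t τ₀ S r : ℝ} (hf : HasDerivWithinAt f v (Ici t) t)
    (hg : HasDerivWithinAt g w (Ici t) t) (hτ₀ : 0 < τ₀)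
    (hstep : ∀ τ, 0 ≤ τ → τ ≤ τ₀ → ‖f t + τ • v‖ + ‖g t + τ • w‖ ≤ ‖f t‖ + ‖g t‖ - τ * S)
    (hr : -S < r) : ∀ᶠ z in 𝓝[>] t, slope (fun s => ‖f s‖ + ‖g s‖) t z < r := by
  have hc : 0 < (r + S) / 3 := by linarith
  have h1 := (hasDerivWithinAt_iff_isLittleO.1 hf).def hc
  have h2 := (hasDerivWithinAt_iff_isLittleO.1 hg).def hc
  have hle : 𝓝[>] t ≤ 𝓝[≥] t := nhdsWithin_mono _ Ioi_subset_Ici_self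
  filter_upwards [hle h1, hle h2, self_mem_nhdsWithin,
    mem_nhdsWithin_of_mem_nhds (Iio_mem_nhds (show t < t + τ₀ by linarith))] with z z1 z2 z3 z4
  have hz : 0 < z - t := sub_pos.2 z3
  have hz4 : z < t + τ₀ := z4
  have h3 := hstep (z - t) hz.le (by linarith)
  rw [Real.norm_of_nonneg hz.le] at z1 z2
  have e1 : ‖f z‖ ≤ ‖f t + (z - t) • v‖ + ‖f z - f t - (z - t) • v‖ := by
    refine le_of_eq_of_le ?_ (norm_add_le _ _); congr 1; abel
  have e2 : ‖g z‖ ≤ ‖g t + (z - t) • w‖ + ‖g z - g t - (z - t) • w‖ := by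
    refine le_of_eq_of_le ?_ (norm_add_le _ _); congr 1; abel
  rw [slope_def_field, div_lt_iff₀ hz]
  have : (r + S) / 3 * (z - t) > 0 := by positivity
  linarith

lemma hasDerivAt_apply {f : ℝ → Wiener} {v : Wiener} {t : ℝ} (h : HasDerivAt f v t) (k : ℤ) :
    HasDerivAt (fun s => f s k) (v k) t :=
  ((coeffL k).restrictScalars ℝ).hasFDerivAt.comp_hasDerivAt t h

lemma hasDerivWithinAt_apply {f : ℝ → Wiener} {v : Wiener} {t : ℝ} {s : Set ℝ}
    (h : HasDerivWithinAt f v s t) (k : ℤ) : HasDerivWithinAt (fun s => f s k) (v k) s t :=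
  ((coeffL k).restrictScalars ℝ).hasFDerivAt.comp_hasDerivWithinAt t h

lemma wt_zero_le_wt {u : Wiener} {n s : ℕ} (hu : Supp n u) (h0 : u 0 = 0) : ‖u‖ ≤ wt s u := by
  rw [hu.norm_eq, hu.wt_eq]
  refine Finset.sum_le_sum fun k _ => ?_
  by_cases hk : k = 0
  · subst hk; simp [h0]
  · have : (1 : ℝ) ≤ |(k : ℝ)| := by exact_mod_cast Int.one_le_abs hk
    exact le_mul_of_one_le_left (norm_nonneg _) (one_le_pow₀ this)

namespace Par

variable {P : Par} {n m : ℕ} {f g : Wiener} {e : ℝ}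

/-- The rate of decay of the Wiener norm. -/
def rate (P : Par) (e : ℝ) : ℝ := min (Sigma₁ P.ρ P.μ P.F P.G e) (Sigma₂ P.ρ P.μ P.F P.G e)

lemma Adm.rate_pos (h : P.Adm e) : 0 < P.rate e := lt_min h.sigma₁ h.sigma₂

lemma rate_mul_wt_le (f g : Wiener) : P.rate e * (wt (m + 1) f + wt (m + 1) g)
    ≤ Sigma₁ P.ρ P.μ P.F P.G e * wt (m + 1) f + Sigma₂ P.ρ P.μ P.F P.G e * wt (m + 1) g := by
  rw [mul_add]
  exact add_le_add (mul_le_mul_of_nonneg_right (min_le_left _ _) (wt_nonneg _ _))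
    (mul_le_mul_of_nonneg_right (min_le_right _ _) (wt_nonneg _ _))

lemma exists_euler_step (h : P.Adm e) (hm : Odd m) (hf : Supp n f) (hg : Supp n g)
    (he : ‖f‖ + ‖g‖ ≤ e) : ∃ τ₀ : ℝ, 0 < τ₀ ∧ ∀ τ, 0 ≤ τ → τ ≤ τ₀ →
      ‖f + τ • P.V₁ n m f g‖ + ‖g + τ • P.V₂ n m f g‖
        ≤ ‖f‖ + ‖g‖ - τ * (P.rate e * (wt (m + 1) f + wt (m + 1) g)) := by
  have h1 := h.pos.a₁₁
  have h2 := h.pos.a₂₂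
  have hM : 0 < P.a₁₁ * (n : ℝ) ^ (m + 1) + P.a₂₂ * (n : ℝ) ^ (m + 1) + 1 := by positivity
  refine ⟨1 / (P.a₁₁ * (n : ℝ) ^ (m + 1) + P.a₂₂ * (n : ℝ) ^ (m + 1) + 1), by positivity,
    fun τ hτ hτ' => ?_⟩
  rw [le_div_iff₀ hM] at hτ'
  have p1 : 0 ≤ τ * (P.a₁₁ * (n : ℝ) ^ (m + 1)) := by positivity
  have p2 : 0 ≤ τ * (P.a₂₂ * (n : ℝ) ^ (m + 1)) := by positivity
  have := norm_euler_step_le h.pos hm hf hg he hτ (by linarith) (by linarith)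
  have := mul_le_mul_of_nonneg_left (rate_mul_wt_le (P := P) (m := m) (e := e) f g) hτ
  linarith

/-- A solution of the Galerkin system on `[0, T]`, extended by constants to the real line. -/
structure IsGalerkin (P : Par) (e : ℝ) (n m : ℕ) (T : ℝ) (f₀ g₀ : Wiener) (f g : ℝ → Wiener) :
    Prop where
  cont_f : Continuous f
  cont_g : Continuous g
  init_f : f 0 = cut n 1 f₀
  init_g : g 0 = cut n 1 g₀
  deriv_f : ∀ t ∈ Ico 0 T, HasDerivWithinAt f (P.V₁ n m (f t) (g t)) (Ici t) t
  deriv_g : ∀ t ∈ Ico 0 T, HasDerivWithinAt g (P.V₂ n m (f t) (g t)) (Ici t) t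
  const : ∀ t, f t = f (max 0 (min t T)) ∧ g t = g (max 0 (min t T))
  supp_f : ∀ t, Supp n (f t)
  supp_g : ∀ t, Supp n (g t)
  zero_f : ∀ t, f t 0 = 0
  zero_g : ∀ t, g t 0 = 0
  real_f : ∀ t, IsReal (f t)
  real_g : ∀ t, IsReal (g t)
  norm_le : ∀ t, ‖f t‖ + ‖g t‖ ≤ e
  decay : ∀ t ∈ Icc 0 T, ‖f t‖ + ‖g t‖ ≤ e * Real.exp (-(P.rate e / 2 * t))

lemma norm_cut_one_le (n : ℕ) (u : Wiener) : ‖cut n 1 u‖ ≤ ‖u‖ := by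
  rw [(supp_cut n 1 u).norm_eq]
  refine (Finset.sum_le_sum fun k hk => ?_).trans (u.sum_norm_le (modes n))
  simp [cut_apply, hk]

/-- Existence of the Galerkin approximation.  The vector field is cut off outside a ball, and the
decay of the Wiener norm shows that the cutoff is never active. -/
lemma exists_isGalerkin (h : P.Adm e) (hm : Odd m) (n : ℕ) {T : ℝ} (hT : 0 < T) {f₀ g₀ : Wiener}
    (hf₀ : f₀ 0 = 0) (hg₀ : g₀ 0 = 0) (hf₀r : IsReal f₀) (hg₀r : IsReal g₀)
    (he : ‖f₀‖ + ‖g₀‖ = e) : ∃ f g, IsGalerkin P e n m T f₀ g₀ f g := by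
  rcases h.nonneg.eq_or_lt with rfl | hepos
  · -- for `e = 0` the solution is zero
    have hf : f₀ = 0 := by
      rw [← norm_le_zero_iff]; linarith [norm_nonneg g₀]
    have hg : g₀ = 0 := by
      rw [← norm_le_zero_iff]; linarith [norm_nonneg f₀]
    subst hf hg
    refine ⟨fun _ => 0, fun _ => 0, ⟨continuous_const, continuous_const, by simp, by simp,
      fun t _ => ?_, fun t _ => ?_, by simp, fun t k _ => rfl, fun t k _ => rfl, fun _ => rfl,
      fun _ => rfl, fun t k => by simp, fun t k => by simp, fun _ => by simp, fun _ _ => by simp⟩⟩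
    · simpa [V₁, J₁, nl₁] using hasDerivWithinAt_const t (Ici t) (0 : Wiener)
    · simpa [V₂, J₂, nl₂] using hasDerivWithinAt_const t (Ici t) (0 : Wiener)
  obtain ⟨K, hL, hb⟩ := (P.bddLip_V n m).exists_cutoff e
  obtain ⟨u, hu0, hu⟩ := exists_integralCurve hL hb (cut n 1 f₀, cut n 1 g₀)
    (show 0 ≤ T + 1 by linarith)
  have huf : ∀ t ∈ Ioo (-(T + 1)) (T + 1), HasDerivAt (fun s => (u s).1)
      (cutoff e (u t) • P.V₁ n m (u t).1 (u t).2) t := fun t ht => (hu t ht).fst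
  have hug : ∀ t ∈ Ioo (-(T + 1)) (T + 1), HasDerivAt (fun s => (u s).2)
      (cutoff e (u t) • P.V₂ n m (u t).1 (u t).2) t := fun t ht => (hu t ht).snd
  have hsub : Icc 0 T ⊆ Ioo (-(T + 1)) (T + 1) := fun t ht =>
    ⟨by linarith [ht.1], by linarith [ht.2]⟩
  -- coefficients that are not moved by the vector field
  have hfix : ∀ k : ℤ, (k ∉ modes n ∨ k = 0) → ∀ t ∈ Icc 0 T, (u t).1 k = 0 ∧ (u t).2 k = 0 := by
    intro k hk t ht
    have hV : ∀ w : Wiener, cut n (dsym 1) w k = 0 := fun w => by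
      rw [cut_apply]
      rcases hk with hk | rfl
      · rw [if_neg hk]
      · simp [dsym]
    have d1 : ∀ s ∈ Icc 0 T, HasDerivAt (fun s => (u s).1 k) 0 s := fun s hs => by
      have := hasDerivAt_apply (huf s (hsub hs)) k
      simpa [V₁, hV] using this
    have d2 : ∀ s ∈ Icc 0 T, HasDerivAt (fun s => (u s).2 k) 0 s := fun s hs => by
      have := hasDerivAt_apply (hug s (hsub hs)) k
      simpa [V₂, hV] using this
    have c1 := constant_of_has_deriv_right_zero
      (fun s hs => (d1 s hs).continuousAt.continuousWithinAt)
      (fun s hs => (d1 s (Ico_subset_Icc_self hs)).hasDerivWithinAt) t ht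
    have c2 := constant_of_has_deriv_right_zero
      (fun s hs => (d2 s hs).continuousAt.continuousWithinAt)
      (fun s hs => (d2 s (Ico_subset_Icc_self hs)).hasDerivWithinAt) t ht
    rw [c1, c2, hu0]
    simp only [cut_apply]
    rcases hk with hk | rfl
    · simp [hk]
    · simp [hf₀, hg₀]
  have hsf : ∀ t ∈ Icc 0 T, Supp n (u t).1 := fun t ht k hk => (hfix k (.inl hk) t ht).1
  have hsg : ∀ t ∈ Icc 0 T, Supp n (u t).2 := fun t ht k hk => (hfix k (.inl hk) t ht).2
  -- real-valuedness, by uniqueness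
  have hreal : ∀ t ∈ Icc 0 T, IsReal (u t).1 ∧ IsReal (u t).2 := by
    have hσ : EqOn (fun t => (conjL (u t).1, conjL (u t).2)) u (Ioo (-(T + 1)) (T + 1)) := by
      refine ODE_solution_unique_of_mem_Ioo (K := K)
        (v := fun _ u => cutoff e u • P.V n m u) (s := fun _ => univ)
        (fun _ _ => hL.lipschitzOnWith) (t₀ := 0) ⟨by linarith, by linarith⟩ (fun t ht => ⟨?_, trivial⟩)
        (fun t ht => ⟨hu t ht, trivial⟩) ?_
      · have h1 := conjL.hasFDerivAt.comp_hasDerivAt t (huf t ht)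
        have h2 := conjL.hasFDerivAt.comp_hasDerivAt t (hug t ht)
        have h3 := h1.prodMk h2
        have hc : cutoff e (conjL (u t).1, conjL (u t).2) = cutoff e (u t) := by
          rw [cutoff, cutoff, Prod.norm_def, Prod.norm_def, conjL_apply, conjL_apply, norm_conjFun,
            norm_conjFun]
        have hv1 : conjL (P.V₁ n m (u t).1 (u t).2) = P.V₁ n m (conjL (u t).1) (conjL (u t).2) :=
          P.conj_V₁ n hm _ _
        have hv2 : conjL (P.V₂ n m (u t).1 (u t).2) = P.V₂ n m (conjL (u t).1) (conjL (u t).2) :=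
          P.conj_V₂ n hm _ _
        rw [map_smul, map_smul, hv1, hv2] at h3
        simp only [hc]
        exact h3
      · have hc : ∀ w : Wiener, IsReal w → conjL (cut n 1 w) = cut n 1 w := fun w hw => by
          ext k
          rw [conjL_apply, conjFun_apply, cut_apply, cut_apply]
          have : -k ∈ modes n ↔ k ∈ modes n := by simp [mem_modes]
          simp [this, hw k, apply_ite (starRingEnd ℂ)]
        simp only [hu0, hc _ hf₀r, hc _ hg₀r]
    intro t ht
    have := hσ (hsub ht)
    rw [isReal_iff, isReal_iff]
    exact ⟨congrArg Prod.fst this, congrArg Prod.snd this⟩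
  -- decay of the Wiener norm, by continuous induction
  have hdecay : ∀ t ∈ Icc 0 T, ‖(u t).1‖ + ‖(u t).2‖ ≤ e * Real.exp (-(P.rate e / 2 * t)) := by
    have hcont : ContinuousOn (fun t => ‖(u t).1‖ + ‖(u t).2‖) (Icc 0 T) := fun t ht =>
      ((huf t (hsub ht)).continuousAt.norm.add
        (hug t (hsub ht)).continuousAt.norm).continuousWithinAt
    have hcut : ∀ t, ‖(u t).1‖ + ‖(u t).2‖ ≤ e → cutoff e (u t) = 1 := fun t ht =>
      cutoff_of_le (max_le (by linarith [norm_nonneg (u t).2]) (by linarith [norm_nonneg (u t).1]))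
    refine image_le_of_liminf_slope_right_lt_deriv_boundary (a := 0) (b := T)
      (f' := fun t => -(if ‖(u t).1‖ + ‖(u t).2‖ ≤ e then
          P.rate e * (wt (m + 1) (u t).1 + wt (m + 1) (u t).2)
        else -(‖cutoff e (u t) • P.V₁ n m (u t).1 (u t).2‖
          + ‖cutoff e (u t) • P.V₂ n m (u t).1 (u t).2‖)))
      (B' := fun t => e * (Real.exp (-(P.rate e / 2 * t)) * -(P.rate e / 2)))
      hcont (fun t ht r hr => ?_) ?_ (fun t => ?_) (fun t ht heq => ?_)
    · have ht' := Ico_subset_Icc_self ht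
      have df := (huf t (hsub ht')).hasDerivWithinAt (s := Ici t)
      have dg := (hug t (hsub ht')).hasDerivWithinAt (s := Ici t)
      split_ifs at hr with hle
      · rw [hcut t hle, one_smul] at df dg
        obtain ⟨τ₀, hτ₀, hstep⟩ := exists_euler_step h hm (hsf t ht') (hsg t ht') hle
        exact (slope_norm_add_norm_lt df dg hτ₀ hstep hr).frequently
      · refine (slope_norm_add_norm_lt df dg one_pos (fun τ h0 h1 => ?_) hr).frequently
        refine (add_le_add (norm_add_le _ _) (norm_add_le _ _)).trans_eq ?_
        rw [norm_smul τ, norm_smul τ, Real.norm_of_nonneg h0]; ring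
    · rw [hu0]
      have := norm_cut_one_le n f₀
      have := norm_cut_one_le n g₀
      simp
      linarith
    · have : HasDerivAt (fun t => -(P.rate e / 2 * t)) (-(P.rate e / 2)) t := by
        have := ((hasDerivAt_id t).const_mul (P.rate e / 2)).neg
        rw [mul_one] at this
        exact this
      exact this.exp.const_mul e
    · have hδ := h.rate_pos
      have ht' := Ico_subset_Icc_self ht
      have hpos : 0 < e * Real.exp (-(P.rate e / 2 * t)) := by positivity
      have hle : ‖(u t).1‖ + ‖(u t).2‖ ≤ e := by
        have hexp : Real.exp (-(P.rate e / 2 * t)) ≤ 1 := by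
          rw [Real.exp_le_one_iff, neg_nonpos]
          have := ht.1
          positivity
        rw [heq]
        exact mul_le_of_le_one_right hepos.le hexp
      have w1 := wt_zero_le_wt (s := m + 1) (hsf t ht') (hfix 0 (.inr rfl) t ht').1
      have w2 := wt_zero_le_wt (s := m + 1) (hsg t ht') (hfix 0 (.inr rfl) t ht').2
      rw [if_pos hle]
      have : P.rate e * (e * Real.exp (-(P.rate e / 2 * t)))
          ≤ P.rate e * (wt (m + 1) (u t).1 + wt (m + 1) (u t).2) := by
        rw [← heq]; gcongr
      nlinarith
  have hexp : ∀ t ∈ Icc 0 T, ‖(u t).1‖ + ‖(u t).2‖ ≤ e := fun t ht => by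
    refine (hdecay t ht).trans (mul_le_of_le_one_right hepos.le ?_)
    rw [Real.exp_le_one_iff, neg_nonpos]
    have := ht.1
    have := h.rate_pos
    positivity
  have hcut : ∀ t ∈ Icc 0 T, cutoff e (u t) = 1 := fun t ht =>
    cutoff_of_le (max_le (by linarith [norm_nonneg (u t).2, hexp t ht])
      (by linarith [norm_nonneg (u t).1, hexp t ht]))
  -- extension by constants
  have hcl : ∀ t, max 0 (min t T) ∈ Icc 0 T := fun t =>
    ⟨le_max_left _ _, max_le hT.le (min_le_right _ _)⟩
  have hid : ∀ t ∈ Icc 0 T, max 0 (min t T) = t := fun t ht => by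
    rw [min_eq_left ht.2, max_eq_right ht.1]
  have hcu : Continuous fun t => u (max 0 (min t T)) :=
    continuous_iff_continuousAt.2 fun t => ContinuousAt.comp (g := u)
      (hu _ (hsub (hcl t))).continuousAt (by fun_prop)
  have hev : ∀ t ∈ Ico 0 T, ∀ᶠ s in 𝓝[≥] t, u (max 0 (min s T)) = u s := fun t ht => by
    filter_upwards [self_mem_nhdsWithin, mem_nhdsWithin_of_mem_nhds (Iio_mem_nhds ht.2)] with s h1 h2
    rw [hid s ⟨ht.1.trans h1, le_of_lt h2⟩]
  refine ⟨fun t => (u (max 0 (min t T))).1, fun t => (u (max 0 (min t T))).2,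
    hcu.fst, hcu.snd, ?_, ?_, fun t ht => ?_, fun t ht => ?_, fun t => ?_,
    fun t => hsf _ (hcl t), fun t => hsg _ (hcl t), fun t => (hfix 0 (.inr rfl) _ (hcl t)).1,
    fun t => (hfix 0 (.inr rfl) _ (hcl t)).2, fun t => (hreal _ (hcl t)).1,
    fun t => (hreal _ (hcl t)).2, fun t => hexp _ (hcl t), fun t ht => ?_⟩
  · rw [hid 0 ⟨le_rfl, hT.le⟩, hu0]
  · rw [hid 0 ⟨le_rfl, hT.le⟩, hu0]
  · have ht' := Ico_subset_Icc_self ht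
    have := (huf t (hsub ht')).hasDerivWithinAt (s := Ici t)
    rw [hcut t ht', one_smul] at this
    simp only [hid t ht']
    exact this.congr_of_eventuallyEq ((hev t ht).mono fun s hs => congrArg Prod.fst hs)
      (by rw [hid t ht'])
  · have ht' := Ico_subset_Icc_self ht
    have := (hug t (hsub ht')).hasDerivWithinAt (s := Ici t)
    rw [hcut t ht', one_smul] at this
    simp only [hid t ht']
    exact this.congr_of_eventuallyEq ((hev t ht).mono fun s hs => congrArg Prod.snd hs)
      (by rw [hid t ht'])
  · simp only [hid _ (hcl t), and_self]
  · simp only [hid t ht]; exact hdecay t ht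

end Par

/-! ### Bounds for the Galerkin approximation -/

namespace Wiener

lemma continuous_apply_comp {X : Type*} [TopologicalSpace X] {u : X → Wiener} (hu : Continuous u)
    (k : ℤ) : Continuous fun t => u t k :=
  (coeffL k).continuous.comp hu

lemma continuous_wt {X : Type*} [TopologicalSpace X] {n s : ℕ} {u : X → Wiener}
    (hs : ∀ t, Supp n (u t)) (hu : Continuous u) : Continuous fun t => wt s (u t) := by
  simp_rw [fun t => (hs t).wt_eq s]
  exact continuous_finsetSum _ fun k _ => (continuous_apply_comp hu k).norm.const_mul _

lemma continuous_en {X : Type*} [TopologicalSpace X] {n s : ℕ} {u : X → Wiener}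
    (hu : Continuous u) : Continuous fun t => en n s (u t) :=
  continuous_finsetSum _ fun k _ => ((continuous_apply_comp hu k).norm.pow 2).const_mul _

lemma en_cut_one_le {n s : ℕ} {u : Wiener} (h : Summable fun k : ℤ => |(k : ℝ)| ^ s * ‖u k‖ ^ 2) :
    en n s (cut n 1 u) ≤ ∑' k : ℤ, |(k : ℝ)| ^ s * ‖u k‖ ^ 2 := by
  refine le_trans (Finset.sum_le_sum fun k hk => ?_) (h.sum_le_tsum (modes n) fun _ _ => by positivity)
  simp [cut_apply, hk]

/-- Interpolation between the frequencies: `|k|^m ≤ η |k|^{m+1} + η^{-m}`. -/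
lemma wt_le_interp {n m : ℕ} {u : Wiener} (h : Supp n u) {η : ℝ} (hη : 0 < η) :
    wt m u ≤ η * wt (m + 1) u + (1 / η) ^ m * ‖u‖ := by
  rw [h.wt_eq, h.wt_eq, h.norm_eq, Finset.mul_sum, Finset.mul_sum, ← Finset.sum_add_distrib]
  refine Finset.sum_le_sum fun k _ => ?_
  rw [← mul_assoc, ← add_mul]
  refine mul_le_mul_of_nonneg_right ?_ (norm_nonneg _)
  rcases le_total (1 / η) |(k : ℝ)| with hk | hk
  · rw [div_le_iff₀ hη] at hk
    have h1 : |(k : ℝ)| ^ m * 1 ≤ |(k : ℝ)| ^ m * (|(k : ℝ)| * η) := by gcongr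
    have h2 : 0 ≤ (1 / η) ^ m := by positivity
    rw [pow_succ]; linarith
  · have h1 : |(k : ℝ)| ^ m ≤ (1 / η) ^ m := by gcongr
    have h2 : 0 ≤ η * |(k : ℝ)| ^ (m + 1) := by positivity
    linarith

end Wiener

open Wiener

lemma hasDerivWithinAt_primitive {w : ℝ → ℝ} (hw : Continuous w) (t : ℝ) (s : Set ℝ) :
    HasDerivWithinAt (fun t => ∫ s in (0 : ℝ)..t, w s) (w t) s t :=
  (intervalIntegral.integral_hasDerivAt_right (hw.intervalIntegrable _ _)
    (hw.stronglyMeasurableAtFilter _ _) hw.continuousAt).hasDerivWithinAt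

lemma continuous_primitive {w : ℝ → ℝ} (hw : Continuous w) :
    Continuous fun t => ∫ s in (0 : ℝ)..t, w s :=
  continuous_iff_continuousAt.2 fun t =>
    (hasDerivWithinAt_univ.1 (hasDerivWithinAt_primitive hw t univ)).continuousAt

/-- A Gronwall inequality with a dissipation term. -/
lemma gronwall_dissipation {D D' W Z : ℝ → ℝ} {T κ C M : ℝ} (hD : ContinuousOn D (Icc 0 T))
    (hD' : ∀ t ∈ Ico 0 T, HasDerivWithinAt D (D' t) (Ici t) t) (hW : Continuous W)
    (hZ : Continuous Z) (hZ0 : ∀ t, 0 ≤ Z t) (hκ : 0 ≤ κ)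
    (hle : ∀ t ∈ Ico 0 T, D' t ≤ -κ * Z t + C * W t * D t)
    (hM : ∀ t ∈ Icc 0 T, C * ∫ s in (0 : ℝ)..t, W s ≤ M) {t : ℝ} (ht : t ∈ Icc 0 T) :
    D t * Real.exp (-(C * ∫ s in (0 : ℝ)..t, W s))
      + κ * Real.exp (-M) * (∫ s in (0 : ℝ)..t, Z s) ≤ D 0 := by
  have hcI := continuous_primitive hW
  have hcZ := continuous_primitive hZ
  have key := image_le_of_deriv_right_le_deriv_boundary (a := 0) (b := T)
    (f := fun t => D t * Real.exp (-(C * ∫ s in (0 : ℝ)..t, W s)))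
    (f' := fun t => D' t * Real.exp (-(C * ∫ s in (0 : ℝ)..t, W s))
      + D t * (Real.exp (-(C * ∫ s in (0 : ℝ)..t, W s)) * -(C * W t)))
    (B := fun t => D 0 - κ * Real.exp (-M) * ∫ s in (0 : ℝ)..t, Z s)
    (B' := fun t => -(κ * Real.exp (-M) * Z t))
    (hD.mul (by fun_prop)) (fun t ht => ?_) (by simp) (by fun_prop) (fun t ht => ?_)
    (fun t ht => ?_) ht
  · linarith
  · exact (hD' t ht).mul ((hasDerivWithinAt_primitive hW t _).const_mul C).fun_neg.exp
  · exact ((hasDerivWithinAt_primitive hZ t _).const_mul _).const_sub _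
  · have h1 := hM t (Ico_subset_Icc_self ht)
    have h2 : Real.exp (-M) ≤ Real.exp (-(C * ∫ s in (0 : ℝ)..t, W s)) :=
      Real.exp_le_exp.2 (by linarith)
    have h3 := hle t ht
    have h4 : κ * Z t * Real.exp (-M) ≤ κ * Z t * Real.exp (-(C * ∫ s in (0 : ℝ)..t, W s)) :=
      mul_le_mul_of_nonneg_left h2 (mul_nonneg hκ (hZ0 t))
    have h5 := mul_le_mul_of_nonneg_right h3 (Real.exp_pos (-(C * ∫ s in (0 : ℝ)..t, W s))).le
    linarith

lemma BddLip.continuous {E F : Type*} [NormedAddCommGroup E] [NormedAddCommGroup F] {Φ : E → F}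
    (h : BddLip Φ) : Continuous Φ := by
  refine continuous_iff_continuousAt.2 fun u => ?_
  obtain ⟨K, hK, hL⟩ := h (‖u‖ + 1)
  rw [ContinuousAt, tendsto_iff_norm_sub_tendsto_zero]
  have h1 : Tendsto (fun v => K * ‖v - u‖) (𝓝 u) (𝓝 0) := by
    have : Continuous fun v => K * ‖v - u‖ := by fun_prop
    simpa using this.tendsto u
  have hn : ∀ᶠ v in 𝓝 u, ‖v‖ < ‖u‖ + 1 :=
    continuous_norm.continuousAt.eventually_lt_const (by linarith)
  refine squeeze_zero' (.of_forall fun _ => norm_nonneg _) ?_ h1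
  filter_upwards [hn] with v hv using (hL v u hv.le (by linarith)).2

namespace Par

variable {P : Par} {n m : ℕ} {e T : ℝ} {f₀ g₀ : Wiener} {f g : ℝ → Wiener}

/-- The fluxes are bounded by the derivatives entering linearly. -/
lemma exists_norm_J_le (P : Par) (e : ℝ) : ∃ C : ℝ, 0 ≤ C ∧ ∀ f g a b : Wiener, ‖f‖ ≤ e → ‖g‖ ≤ e →
    ‖P.J₁ f g a b‖ ≤ C * (‖a‖ + ‖b‖) ∧ ‖P.J₂ f g a b‖ ≤ C * (‖a‖ + ‖b‖) := by
  have hf : BddLip fun u : Wiener × Wiener => u.1 := .fst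
  have hg : BddLip fun u : Wiener × Wiener => u.2 := .snd
  obtain ⟨K₁, h₁, b₁⟩ := ((BddLip.const (const P.a₁₁)).add (P.bddLip_w₁₁ hf hg)) e
  obtain ⟨K₂, h₂, b₂⟩ := ((BddLip.const (const P.a₁₂)).add (P.bddLip_w₁₂ hf hg)) e
  obtain ⟨K₃, h₃, b₃⟩ := ((BddLip.const (const P.a₂₁)).add (P.bddLip_w₂₁ hf hg)) e
  obtain ⟨K₄, h₄, b₄⟩ := ((BddLip.const (const P.a₂₂)).add (P.bddLip_w₂₂ hf hg)) e
  refine ⟨K₁ + K₂ + K₃ + K₄, by positivity, fun f g a b hf hg => ?_⟩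
  have hu : ‖(f, g)‖ ≤ e := max_le hf hg
  have c₁ := (b₁ (f, g) (f, g) hu hu).1
  have c₂ := (b₂ (f, g) (f, g) hu hu).1
  have c₃ := (b₃ (f, g) (f, g) hu hu).1
  have c₄ := (b₄ (f, g) (f, g) hu hu).1
  have key : ∀ (w w' : Wiener) (K K' : ℝ), ‖w‖ ≤ K → ‖w'‖ ≤ K' → 0 ≤ K → 0 ≤ K' →
      ‖w * a + w' * b‖ ≤ (K + K') * (‖a‖ + ‖b‖) := fun w w' K K' hw hw' hK hK' => by
    have e1 : ‖w * a‖ ≤ K * ‖a‖ := (norm_mul_le _ _).trans (by gcongr)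
    have e2 : ‖w' * b‖ ≤ K' * ‖b‖ := (norm_mul_le _ _).trans (by gcongr)
    have e3 : 0 ≤ K * ‖b‖ := by positivity
    have e4 : 0 ≤ K' * ‖a‖ := by positivity
    linarith [norm_add_le (w * a) (w' * b)]
  have na : 0 ≤ ‖a‖ + ‖b‖ := by positivity
  constructor
  · have e1 : P.J₁ f g a b = (const P.a₁₁ + P.w₁₁ f g) * a + (const P.a₁₂ + P.w₁₂ f g) * b := by
      rw [J₁, nl₁]; ring
    rw [e1]
    exact (key _ _ _ _ c₁ c₂ h₁ h₂).trans (mul_le_mul_of_nonneg_right (by linarith) na)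
  · have e1 : P.J₂ f g a b = (const P.a₂₁ + P.w₂₁ f g) * a + (const P.a₂₂ + P.w₂₂ f g) * b := by
      rw [J₂, nl₂]; ring
    rw [e1]
    exact (key _ _ _ _ c₃ c₄ h₃ h₄).trans (mul_le_mul_of_nonneg_right (by linarith) na)

namespace IsGalerkin

lemma norm_f_le (h : IsGalerkin P e n m T f₀ g₀ f g) (t : ℝ) : ‖f t‖ ≤ e := by
  linarith [h.norm_le t, norm_nonneg (g t)]

lemma norm_g_le (h : IsGalerkin P e n m T f₀ g₀ f g) (t : ℝ) : ‖g t‖ ≤ e := by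
  linarith [h.norm_le t, norm_nonneg (f t)]

lemma cont_V₁ (h : IsGalerkin P e n m T f₀ g₀ f g) : Continuous fun t => P.V₁ n m (f t) (g t) :=
  ((P.bddLip_V n m).continuous.comp (h.cont_f.prodMk h.cont_g)).fst

lemma cont_V₂ (h : IsGalerkin P e n m T f₀ g₀ f g) : Continuous fun t => P.V₂ n m (f t) (g t) :=
  ((P.bddLip_V n m).continuous.comp (h.cont_f.prodMk h.cont_g)).snd

lemma cont_wt (h : IsGalerkin P e n m T f₀ g₀ f g) (s : ℕ) :
    Continuous fun t => wt s (f t) + wt s (g t) :=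
  (continuous_wt h.supp_f h.cont_f).add (continuous_wt h.supp_g h.cont_g)

lemma cont_en (h : IsGalerkin P e n m T f₀ g₀ f g) (s : ℕ) :
    Continuous fun t => en n s (f t) + en n s (g t) :=
  (continuous_en h.cont_f).add (continuous_en h.cont_g)

/-- The dissipation of the Wiener norm. -/
lemma integral_wt_le (h : IsGalerkin P e n m T f₀ g₀ f g) (hP : P.Adm e) (hm : Odd m) {t : ℝ}
    (ht : t ∈ Icc 0 T) : ∫ s in (0 : ℝ)..t, (wt (m + 1) (f s) + wt (m + 1) (g s)) ≤ e / P.rate e := by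
  have hδ := hP.rate_pos
  have hW := h.cont_wt (m + 1)
  have key := image_le_of_liminf_slope_right_le_deriv_boundary (a := 0) (b := T)
    (f := fun t => ‖f t‖ + ‖g t‖)
    (B := fun t => e - P.rate e * ∫ s in (0 : ℝ)..t, (wt (m + 1) (f s) + wt (m + 1) (g s)))
    (B' := fun t => -(P.rate e * (wt (m + 1) (f t) + wt (m + 1) (g t))))
    (h.cont_f.norm.add h.cont_g.norm).continuousOn (by simpa using h.norm_le 0)
    (continuous_const.sub ((continuous_primitive hW).const_mul _)).continuousOn
    (fun t _ => ((hasDerivWithinAt_primitive hW t _).const_mul _).const_sub _)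
    (fun t ht r hr => ?_) ht
  · rw [le_div_iff₀ hδ]
    linarith [norm_nonneg (f t), norm_nonneg (g t)]
  · obtain ⟨τ₀, hτ₀, hstep⟩ := exists_euler_step hP hm (h.supp_f t) (h.supp_g t) (h.norm_le t)
    exact (slope_norm_add_norm_lt (h.deriv_f t ht) (h.deriv_g t ht) hτ₀ hstep hr).frequently

lemma hasDeriv_en {s : ℕ} {u v : ℝ → Wiener} {t : ℝ} (h : HasDerivWithinAt u (v t) (Ici t) t) :
    HasDerivWithinAt (fun t => en n s (u t))
      (2 * ∑ k ∈ modes n, |(k : ℝ)| ^ s * inner ℝ (u t k) (v t k)) (Ici t) t := by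
  have := HasDerivWithinAt.fun_sum (u := modes n) fun k _ =>
    ((hasDerivWithinAt_apply h k).norm_sq).const_mul (|(k : ℝ)| ^ s)
  refine this.congr_deriv ?_
  rw [Finset.mul_sum]
  exact Finset.sum_congr rfl fun k _ => by ring

/-- One mode at any time is bounded through its initial value and the total energy flux. -/
lemma norm_sq_le {u v : ℝ → ℂ} (hu : Continuous u) (hv : Continuous v)
    (h : ∀ t ∈ Ico 0 T, HasDerivWithinAt u (v t) (Ici t) t) {t : ℝ} (ht : t ∈ Icc 0 T) :
    ‖u t‖ ^ 2 ≤ ‖u 0‖ ^ 2 + 2 * ∫ s in (0 : ℝ)..T, ‖u s‖ * ‖v s‖ := by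
  have hc : Continuous fun s => ‖u s‖ * ‖v s‖ := hu.norm.mul hv.norm
  have key := image_le_of_deriv_right_le_deriv_boundary (a := 0) (b := T)
    (f := fun t => ‖u t‖ ^ 2) (f' := fun t => 2 * inner ℝ (u t) (v t))
    (B := fun t => ‖u 0‖ ^ 2 + 2 * ∫ s in (0 : ℝ)..t, ‖u s‖ * ‖v s‖)
    (B' := fun t => 2 * (‖u t‖ * ‖v t‖))
    (hu.norm.pow 2).continuousOn (fun t ht => (h t ht).norm_sq) (by simp)
    (((continuous_primitive hc).const_mul 2).const_add _).continuousOn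
    (fun t _ => ((hasDerivWithinAt_primitive hc t _).const_mul _).const_add _)
    (fun t _ => by
      have := real_inner_le_norm (u t) (v t)
      linarith) ht
  have h2 : ∫ s in (0 : ℝ)..t, ‖u s‖ * ‖v s‖ ≤ ∫ s in (0 : ℝ)..T, ‖u s‖ * ‖v s‖ :=
    intervalIntegral.integral_mono_interval le_rfl ht.1 ht.2
      (.of_forall fun s => by positivity) (hc.intervalIntegrable _ _)
  linarith

end IsGalerkin

/-- The energy bounds for the Galerkin approximation, uniform in the number of modes.  In the last
one every mode may be evaluated at a time of its own. -/
lemma exists_energy_bound (hP : P.Adm e) (hm : m = 1 ∨ m = 3)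
    (hf₀ : Summable fun k : ℤ => |(k : ℝ)| ^ (m + 1) * ‖f₀ k‖ ^ 2)
    (hg₀ : Summable fun k : ℤ => |(k : ℝ)| ^ (m + 1) * ‖g₀ k‖ ^ 2) :
    ∃ M : ℝ, 0 ≤ M ∧ ∀ {n T f g}, 0 < T → IsGalerkin P e n m T f₀ g₀ f g →
      (∫ s in (0 : ℝ)..T, (en n (2 * (m + 1)) (f s) + en n (2 * (m + 1)) (g s)) ≤ M) ∧
      ∀ τ : ℤ → ℝ, (∀ k, τ k ∈ Icc 0 T) → ∑ k ∈ modes n, |(k : ℝ)| ^ (m + 1) * ‖f (τ k) k‖ ^ 2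
        + ∑ k ∈ modes n, |(k : ℝ)| ^ (m + 1) * ‖g (τ k) k‖ ^ 2 ≤ M := by
  have hodd : Odd m := by rcases hm with rfl | rfl <;> decide
  obtain ⟨d₁, d₂, κ, C, hd₁, hd₂, hκ, hC, hdis⟩ := exists_energy_dissipation hP hm
  set A := e / P.rate e with hA
  have hA0 : 0 ≤ A := div_nonneg hP.nonneg hP.rate_pos.le
  set H₁ := ∑' k : ℤ, |(k : ℝ)| ^ (m + 1) * ‖f₀ k‖ ^ 2 with hH₁
  set H₂ := ∑' k : ℤ, |(k : ℝ)| ^ (m + 1) * ‖g₀ k‖ ^ 2 with hH₂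
  have hH₁0 : 0 ≤ H₁ := tsum_nonneg fun _ => by positivity
  have hH₂0 : 0 ≤ H₂ := tsum_nonneg fun _ => by positivity
  have hd : 0 < min d₁ d₂ := lt_min hd₁ hd₂
  set C' := 2 * C / min d₁ d₂ with hC'
  have hC'0 : 0 ≤ C' := by positivity
  set D₀ := d₁ * H₁ + d₂ * H₂ with hD₀
  have hD₀0 : 0 ≤ D₀ := by positivity
  set B := D₀ * Real.exp (C' * A) with hB
  have hB0 : 0 ≤ B := by positivity
  set M₁ := B / (2 * κ) with hM₁
  have hM₁0 : 0 ≤ M₁ := by positivity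
  refine ⟨M₁ + (H₁ + H₂ + 2 * (C * M₁ + C * (A * (B / min d₁ d₂)))), by positivity,
    fun {n T f g} hT h => ?_⟩
  set W := fun s => wt (m + 1) (f s) + wt (m + 1) (g s) with hW
  set Z := fun s => en n (2 * (m + 1)) (f s) + en n (2 * (m + 1)) (g s) with hZ
  set E := fun s => en n (m + 1) (f s) + en n (m + 1) (g s) with hE
  set D := fun s => d₁ * en n (m + 1) (f s) + d₂ * en n (m + 1) (g s) with hD
  have hWc : Continuous W := h.cont_wt _
  have hZc : Continuous Z := h.cont_en _
  have hEc : Continuous E := h.cont_en _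
  have hDc : Continuous D := ((continuous_en h.cont_f).const_mul _).add
    ((continuous_en h.cont_g).const_mul _)
  have hW0 : ∀ t, 0 ≤ W t := fun t => add_nonneg (wt_nonneg _ _) (wt_nonneg _ _)
  have hZ0 : ∀ t, 0 ≤ Z t := fun t => add_nonneg (en_nonneg _ _ _) (en_nonneg _ _ _)
  have hE0 : ∀ t, 0 ≤ E t := fun t => add_nonneg (en_nonneg _ _ _) (en_nonneg _ _ _)
  have hED : ∀ t, E t ≤ D t / min d₁ d₂ := fun t => by
    rw [le_div_iff₀ hd, hE, hD]
    have h1 := mul_le_mul_of_nonneg_right (min_le_left d₁ d₂) (en_nonneg n (m + 1) (f t))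
    have h2 := mul_le_mul_of_nonneg_right (min_le_right d₁ d₂) (en_nonneg n (m + 1) (g t))
    simp only
    linarith
  have hWA : ∀ t ∈ Icc 0 T, C' * ∫ s in (0 : ℝ)..t, W s ≤ C' * A := fun t ht =>
    mul_le_mul_of_nonneg_left (h.integral_wt_le hP hodd ht) hC'0
  have hD0 : D 0 ≤ D₀ := by
    have h1 := en_cut_one_le (n := n) hf₀
    have h2 := en_cut_one_le (n := n) hg₀
    simp only [hD, h.init_f, h.init_g, hD₀]
    gcongr
  have gron : ∀ t ∈ Icc 0 T, D t * Real.exp (-(C' * ∫ s in (0 : ℝ)..t, W s))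
      + 2 * κ * Real.exp (-(C' * A)) * (∫ s in (0 : ℝ)..t, Z s) ≤ D 0 := fun t ht =>
    gronwall_dissipation (D' := fun t =>
        d₁ * (2 * ∑ k ∈ modes n, |(k : ℝ)| ^ (m + 1) * inner ℝ (f t k) (P.V₁ n m (f t) (g t) k))
        + d₂ * (2 * ∑ k ∈ modes n, |(k : ℝ)| ^ (m + 1) * inner ℝ (g t k) (P.V₂ n m (f t) (g t) k)))
      hDc.continuousOn
      (fun t ht => ((IsGalerkin.hasDeriv_en (v := fun t => P.V₁ n m (f t) (g t))
        (h.deriv_f t ht)).const_mul d₁).add ((IsGalerkin.hasDeriv_en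
          (v := fun t => P.V₂ n m (f t) (g t)) (h.deriv_g t ht)).const_mul d₂))
      hWc hZc hZ0 (by positivity) (fun t _ => by
        have h1 := (hdis (h.supp_f t) (h.supp_g t) (h.norm_le t)).1
        have h2 : 2 * (C * W t * E t) ≤ C' * W t * D t := by
          have := mul_le_mul_of_nonneg_left (hED t) (mul_nonneg (mul_nonneg zero_le_two hC) (hW0 t))
          refine (le_of_eq (by ring)).trans (this.trans_eq ?_)
          rw [hC']; ring
        simp only [hW, hZ, hE] at h1 h2 ⊢
        linarith) hWA ht
  have hexp : Real.exp (C' * A) * Real.exp (-(C' * A)) = 1 := by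
    rw [← Real.exp_add]; simp
  have hDB : ∀ t ∈ Icc 0 T, D t ≤ B := fun t ht => by
    have h1 := gron t ht
    have h2 : 0 ≤ ∫ s in (0 : ℝ)..t, Z s := intervalIntegral.integral_nonneg ht.1 fun s _ => hZ0 s
    have h3 : Real.exp (-(C' * A)) ≤ Real.exp (-(C' * ∫ s in (0 : ℝ)..t, W s)) :=
      Real.exp_le_exp.2 (by linarith [hWA t ht])
    have hDt : 0 ≤ D t := add_nonneg (mul_nonneg hd₁.le (en_nonneg _ _ _))
      (mul_nonneg hd₂.le (en_nonneg _ _ _))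
    have h4 := mul_le_mul_of_nonneg_left h3 hDt
    have h5 : D t * Real.exp (-(C' * A)) ≤ D₀ := by
      have : 0 ≤ 2 * κ * Real.exp (-(C' * A)) * ∫ s in (0 : ℝ)..t, Z s := by positivity
      linarith
    calc D t = D t * Real.exp (-(C' * A)) * Real.exp (C' * A) := by rw [mul_assoc, mul_comm (Real.exp (-_)), hexp, mul_one]
      _ ≤ B := mul_le_mul_of_nonneg_right h5 (Real.exp_pos _).le
  have hZM : ∫ s in (0 : ℝ)..T, Z s ≤ M₁ := by
    have h1 := gron T ⟨hT.le, le_rfl⟩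
    have hDt : 0 ≤ D T := add_nonneg (mul_nonneg hd₁.le (en_nonneg _ _ _))
      (mul_nonneg hd₂.le (en_nonneg _ _ _))
    have h2 : 2 * κ * Real.exp (-(C' * A)) * (∫ s in (0 : ℝ)..T, Z s) ≤ D₀ := by
      have := mul_nonneg hDt (Real.exp_pos (-(C' * ∫ s in (0 : ℝ)..T, W s))).le
      linarith
    rw [hM₁, le_div_iff₀ (by positivity), hB]
    calc (∫ s in (0 : ℝ)..T, Z s) * (2 * κ)
        = 2 * κ * Real.exp (-(C' * A)) * (∫ s in (0 : ℝ)..T, Z s) * Real.exp (C' * A) := by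
          linear_combination (-(∫ s in (0 : ℝ)..T, Z s) * (2 * κ)) * hexp
      _ ≤ _ := mul_le_mul_of_nonneg_right h2 (Real.exp_pos _).le
  -- to allow for different times, each mode is estimated separately through `∫ ‖u‖ ‖u'‖`
  refine ⟨hZM.trans (le_add_of_nonneg_right (by positivity)), fun τ hτ => ?_⟩
  have m1 : ∀ k, ‖f (τ k) k‖ ^ 2 ≤ ‖f 0 k‖ ^ 2
      + 2 * ∫ s in (0 : ℝ)..T, ‖f s k‖ * ‖P.V₁ n m (f s) (g s) k‖ := fun k =>
    IsGalerkin.norm_sq_le (continuous_apply_comp h.cont_f k) (continuous_apply_comp h.cont_V₁ k)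
      (fun t ht => hasDerivWithinAt_apply (h.deriv_f t ht) k) (hτ k)
  have m2 : ∀ k, ‖g (τ k) k‖ ^ 2 ≤ ‖g 0 k‖ ^ 2
      + 2 * ∫ s in (0 : ℝ)..T, ‖g s k‖ * ‖P.V₂ n m (f s) (g s) k‖ := fun k =>
    IsGalerkin.norm_sq_le (continuous_apply_comp h.cont_g k) (continuous_apply_comp h.cont_V₂ k)
      (fun t ht => hasDerivWithinAt_apply (h.deriv_g t ht) k) (hτ k)
  have c1 : ∀ k : ℤ, Continuous fun s => |(k : ℝ)| ^ (m + 1) * (‖f s k‖ * ‖P.V₁ n m (f s) (g s) k‖) :=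
    fun k => ((continuous_apply_comp h.cont_f k).norm.mul
      (continuous_apply_comp h.cont_V₁ k).norm).const_mul _
  have c2 : ∀ k : ℤ, Continuous fun s => |(k : ℝ)| ^ (m + 1) * (‖g s k‖ * ‖P.V₂ n m (f s) (g s) k‖) :=
    fun k => ((continuous_apply_comp h.cont_g k).norm.mul
      (continuous_apply_comp h.cont_V₂ k).norm).const_mul _
  have sum1 : ∀ (u v : ℝ → Wiener),
      (∀ k, ‖u (τ k) k‖ ^ 2 ≤ ‖u 0 k‖ ^ 2 + 2 * ∫ s in (0 : ℝ)..T, ‖u s k‖ * ‖v s k‖) →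
      (∀ k : ℤ, Continuous fun s => |(k : ℝ)| ^ (m + 1) * (‖u s k‖ * ‖v s k‖)) →
      ∑ k ∈ modes n, |(k : ℝ)| ^ (m + 1) * ‖u (τ k) k‖ ^ 2 ≤ en n (m + 1) (u 0)
        + 2 * ∫ s in (0 : ℝ)..T, ∑ k ∈ modes n, |(k : ℝ)| ^ (m + 1) * (‖u s k‖ * ‖v s k‖) := by
    intro u v hu hc
    rw [intervalIntegral.integral_finsetSum fun k _ => (hc k).intervalIntegrable _ _, en,
      Finset.mul_sum, ← Finset.sum_add_distrib]
    refine Finset.sum_le_sum fun k _ => ?_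
    rw [intervalIntegral.integral_const_mul]
    refine (mul_le_mul_of_nonneg_left (hu k) (by positivity)).trans_eq (by ring)
  have s1 := sum1 f (fun s => P.V₁ n m (f s) (g s)) m1 c1
  have s2 := sum1 g (fun s => P.V₂ n m (f s) (g s)) m2 c2
  have i1 := en_cut_one_le (n := n) hf₀
  have i2 := en_cut_one_le (n := n) hg₀
  rw [← h.init_f] at i1
  rw [← h.init_g] at i2
  have hcc1 := continuous_finsetSum (modes n) fun k _ => c1 k
  have hcc2 := continuous_finsetSum (modes n) fun k _ => c2 k
  have hint : (∫ s in (0 : ℝ)..T, ∑ k ∈ modes n, |(k : ℝ)| ^ (m + 1) * (‖f s k‖ * ‖P.V₁ n m (f s) (g s) k‖))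
      + (∫ s in (0 : ℝ)..T, ∑ k ∈ modes n, |(k : ℝ)| ^ (m + 1) * (‖g s k‖ * ‖P.V₂ n m (f s) (g s) k‖))
      ≤ C * M₁ + C * (A * (B / min d₁ d₂)) := by
    rw [← intervalIntegral.integral_add (hcc1.intervalIntegrable _ _) (hcc2.intervalIntegrable _ _)]
    calc _ ≤ ∫ s in (0 : ℝ)..T, (C * Z s + C * (W s * (B / min d₁ d₂))) := by
          refine intervalIntegral.integral_mono_on hT.le ((hcc1.add hcc2).intervalIntegrable _ _)
            ((by fun_prop : Continuous fun s => C * Z s + C * (W s * (B / min d₁ d₂))).intervalIntegrable _ _)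
            fun s hs => ?_
          have h1 := (hdis (h.supp_f s) (h.supp_g s) (h.norm_le s)).2
          have h2 : E s ≤ B / min d₁ d₂ := (hED s).trans (div_le_div_of_nonneg_right (hDB s hs) hd.le)
          have h3 : C * (W s * E s) ≤ C * (W s * (B / min d₁ d₂)) :=
            mul_le_mul_of_nonneg_left (mul_le_mul_of_nonneg_left h2 (hW0 s)) hC
          simp only [hW, hZ, hE] at h1 h3 ⊢
          linarith
      _ = C * (∫ s in (0 : ℝ)..T, Z s) + C * ((∫ s in (0 : ℝ)..T, W s) * (B / min d₁ d₂)) := by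
          rw [intervalIntegral.integral_add ((hZc.const_mul C).intervalIntegrable _ _)
            (((hWc.mul_const _).const_mul C).intervalIntegrable _ _),
            intervalIntegral.integral_const_mul, intervalIntegral.integral_const_mul,
            intervalIntegral.integral_mul_const]
      _ ≤ _ := by
          have := h.integral_wt_le hP hodd ⟨hT.le, le_rfl⟩
          have hBd : 0 ≤ B / min d₁ d₂ := by positivity
          gcongr
  linarith

/-- The modes of the Galerkin approximations are equicontinuous in time. -/
lemma exists_equicontinuous (hP : P.Adm e) (hm : Odd m) {η : ℝ} (hη : 0 < η) :
    ∃ L : ℝ, 0 ≤ L ∧ ∀ {n T f₀ g₀ f g}, IsGalerkin P e n m T f₀ g₀ f g → ∀ (k : ℤ) {s t : ℝ},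
      s ∈ Icc 0 T → t ∈ Icc s T → ‖f t k - f s k‖ ≤ |(k : ℝ)| * (η + L * (t - s)) ∧
        ‖g t k - g s k‖ ≤ |(k : ℝ)| * (η + L * (t - s)) := by
  obtain ⟨C, hC, hJ⟩ := exists_norm_J_le P e
  set A := e / P.rate e with hA
  have he := hP.nonneg
  have hA0 : 0 ≤ A := div_nonneg he hP.rate_pos.le
  set θ := η / ((C + 1) * (A + 1)) with hθ
  have hθ0 : 0 < θ := by positivity
  have hCA : C * θ * A ≤ η := by
    have : C * θ * A = (C * A) / ((C + 1) * (A + 1)) * η := by rw [hθ]; ring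
    rw [this]
    refine mul_le_of_le_one_left hη.le ((div_le_one (by positivity)).2 ?_)
    nlinarith
  refine ⟨C * ((1 / θ) ^ m * e), by positivity, fun {n T f₀ g₀ f g} h k s t hs ht => ?_⟩
  set W := fun s => wt (m + 1) (f s) + wt (m + 1) (g s) with hW
  have hWc : Continuous W := h.cont_wt _
  have hW0 : ∀ t, 0 ≤ W t := fun t => add_nonneg (wt_nonneg _ _) (wt_nonneg _ _)
  have hbase : ∀ r, ‖cut n (dsym m) (f r)‖ + ‖cut n (dsym m) (g r)‖ ≤ θ * W r + (1 / θ) ^ m * e :=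
    fun r => by
    have h1 := (maj_cut_dsym (m := m) (h.supp_f r)).norm_le
    have h2 := (maj_cut_dsym (m := m) (h.supp_g r)).norm_le
    have h3 := wt_le_interp (m := m) (h.supp_f r) hθ0
    have h4 := wt_le_interp (m := m) (h.supp_g r) hθ0
    have h5 := mul_le_mul_of_nonneg_left (h.norm_le r) (by positivity : 0 ≤ (1 / θ) ^ m)
    simp only [hW]
    linarith
  have hcut : ∀ w : Wiener, ‖cut n (dsym 1) w k‖ ≤ |(k : ℝ)| * ‖w‖ := fun w => by
    rw [cut_apply]
    split_ifs
    · rw [norm_mul, norm_dsym, pow_one]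
      exact mul_le_mul_of_nonneg_left (w.norm_apply_le k) (abs_nonneg _)
    · simp; positivity
  have hV : ∀ r, ‖P.V₁ n m (f r) (g r) k‖ ≤ |(k : ℝ)| * (C * (θ * W r + (1 / θ) ^ m * e)) ∧
      ‖P.V₂ n m (f r) (g r) k‖ ≤ |(k : ℝ)| * (C * (θ * W r + (1 / θ) ^ m * e)) := fun r => by
    have hj := hJ (f r) (g r) (cut n (dsym m) (f r)) (cut n (dsym m) (g r)) (h.norm_f_le r)
      (h.norm_g_le r)
    have := mul_le_mul_of_nonneg_left (hbase r) hC
    exact ⟨(hcut _).trans (mul_le_mul_of_nonneg_left (hj.1.trans this) (abs_nonneg _)),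
      (hcut _).trans (mul_le_mul_of_nonneg_left (hj.2.trans this) (abs_nonneg _))⟩
  set b := fun r => |(k : ℝ)| * (C * (θ * W r + (1 / θ) ^ m * e)) with hb
  have hbc : Continuous b := by fun_prop
  have hB : (∫ r in (0 : ℝ)..t, b r) - (∫ r in (0 : ℝ)..s, b r)
      ≤ |(k : ℝ)| * (η + C * ((1 / θ) ^ m * e) * (t - s)) := by
    rw [intervalIntegral.integral_interval_sub_left (hbc.intervalIntegrable _ _)
      (hbc.intervalIntegrable _ _), hb, intervalIntegral.integral_const_mul,
      intervalIntegral.integral_const_mul, intervalIntegral.integral_add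
      ((hWc.const_mul _).intervalIntegrable _ _) (continuous_const.intervalIntegrable _ _),
      intervalIntegral.integral_const_mul, intervalIntegral.integral_const, smul_eq_mul]
    have h1 : ∫ r in s..t, W r ≤ A := by
      refine le_trans ?_ (h.integral_wt_le hP hm (t := t) ⟨hs.1.trans ht.1, ht.2⟩)
      exact intervalIntegral.integral_mono_interval hs.1 ht.1 le_rfl
        (.of_forall fun s => hW0 s) (hWc.intervalIntegrable _ _)
    have h2 : C * θ * (∫ r in s..t, W r) ≤ C * θ * A :=
      mul_le_mul_of_nonneg_left h1 (by positivity)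
    refine mul_le_mul_of_nonneg_left ?_ (abs_nonneg _)
    linarith
  have key : ∀ u v : ℝ → ℂ, Continuous u →
      (∀ t ∈ Ico 0 T, HasDerivWithinAt u (v t) (Ici t) t) → (∀ r, ‖v r‖ ≤ b r) →
      ‖u t - u s‖ ≤ |(k : ℝ)| * (η + C * ((1 / θ) ^ m * e) * (t - s)) := by
    intro u v hu hd hv
    refine le_trans ?_ hB
    exact image_norm_le_of_norm_deriv_right_le_deriv_boundary' (a := s) (b := T)
      (f := fun t => u t - u s) (f' := v)
      (B := fun t => (∫ r in (0 : ℝ)..t, b r) - ∫ r in (0 : ℝ)..s, b r) (B' := b)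
      (hu.sub continuous_const).continuousOn
      (fun r hr => (hd r ⟨hs.1.trans hr.1, hr.2⟩).sub_const _) (by simp)
      ((continuous_primitive hbc).sub continuous_const).continuousOn
      (fun r _ => (hasDerivWithinAt_primitive hbc r _).sub_const _) (fun r _ => hv r) ht
  exact ⟨key _ _ (continuous_apply_comp h.cont_f k)
      (fun t ht => hasDerivWithinAt_apply (h.deriv_f t ht) k) fun r => (hV r).1,
    key _ _ (continuous_apply_comp h.cont_g k)
      (fun t ht => hasDerivWithinAt_apply (h.deriv_g t ht) k) fun r => (hV r).2⟩

end Par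

/-! ### Convergence in the Wiener algebra -/

/-- A series of nonnegative functions whose partial sums have bounded integrals converges almost
everywhere to an integrable function. -/
lemma integrable_tsum_of_sum_le {α ι : Type*} [MeasurableSpace α] [Countable ι] {μ : Measure α}
    {F : ι → α → ℝ} (hF : ∀ k, Integrable (F k) μ) (h0 : ∀ k a, 0 ≤ F k a) {M : ℝ}
    (hM : ∀ S : Finset ι, ∫ a, ∑ k ∈ S, F k a ∂μ ≤ M) :
    (∀ᵐ a ∂μ, Summable fun k => F k a) ∧ Integrable (fun a => ∑' k, F k a) μ ∧
      ∫ a, ∑' k, F k a ∂μ ≤ M := by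
  have hi0 : ∀ k, 0 ≤ ∫ a, F k a ∂μ := fun k => integral_nonneg (h0 k)
  have hS : ∀ S : Finset ι, ∑ k ∈ S, ∫ a, F k a ∂μ ≤ M := fun S => by
    rw [← integral_finsetSum S fun k _ => hF k]; exact hM S
  have hsum : Summable fun k => ∫ a, F k a ∂μ := summable_of_sum_le hi0 hS
  have hlint : ∫⁻ a, ∑' k, ENNReal.ofReal (F k a) ∂μ < ⊤ := by
    rw [lintegral_tsum fun k => (hF k).aestronglyMeasurable.aemeasurable.ennreal_ofReal]
    simp_rw [fun k => (ofReal_integral_eq_lintegral_ofReal (hF k) (.of_forall (h0 k))).symm]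
    rw [← ENNReal.ofReal_tsum_of_nonneg hi0 hsum]
    exact ENNReal.ofReal_lt_top
  have hmeas : AEMeasurable (fun a => ∑' k, ENNReal.ofReal (F k a)) μ :=
    AEMeasurable.tsum fun k => (hF k).aestronglyMeasurable.aemeasurable.ennreal_ofReal
  have hae : ∀ᵐ a ∂μ, Summable fun k => F k a := by
    filter_upwards [ae_lt_top' hmeas hlint.ne] with a ha
    simpa [ENNReal.toReal_ofReal (h0 _ a)] using ENNReal.summable_toReal ha.ne
  have hval : (fun a => ∑' k, F k a) =ᵐ[μ] fun a => (∑' k, ENNReal.ofReal (F k a)).toReal := by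
    filter_upwards [hae] with a ha
    rw [← ENNReal.ofReal_tsum_of_nonneg (fun k => h0 k a) ha,
      ENNReal.toReal_ofReal (tsum_nonneg fun k => h0 k a)]
  refine ⟨hae, (integrable_congr hval).2 (integrable_toReal_of_lintegral_ne_top hmeas hlint.ne), ?_⟩
  have hn : (fun k => ∫ a, ‖F k a‖ ∂μ) = fun k => ∫ a, F k a ∂μ :=
    funext fun k => integral_congr_ae (.of_forall fun a => Real.norm_of_nonneg (h0 k a))
  rw [← integral_tsum_of_summable_integral_norm hF (by rw [hn]; exact hsum)]
  exact hsum.tsum_le_of_sum_le hS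

namespace Wiener

lemma norm_le_of_sum_le {u : Wiener} {C : ℝ} (h : ∀ S : Finset ℤ, ∑ k ∈ S, ‖u k‖ ≤ C) : ‖u‖ ≤ C := by
  rw [norm_def]; exact u.summable_norm.tsum_le_of_sum_le h

/-- Convergence of the coefficients together with uniformly small tails implies convergence. -/
lemma tendsto_of_tail {ι : Type*} {l : Filter ι} {u : ι → Wiener} {v : Wiener}
    (h : ∀ k, Tendsto (fun i => u i k) l (𝓝 (v k)))
    (ht : ∀ ε > 0, ∃ s : Finset ℤ, ∀ᶠ i in l, ∀ t : Finset ℤ, Disjoint t s → ∑ k ∈ t, ‖u i k‖ ≤ ε) :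
    Tendsto u l (𝓝 v) := by
  classical
  rw [tendsto_iff_norm_sub_tendsto_zero, Metric.tendsto_nhds]
  intro ε hε
  obtain ⟨s, hs⟩ := ht (ε / 4) (by positivity)
  obtain ⟨s', hs'⟩ := summable_iff_vanishing_norm.1 v.summable_norm (ε / 4) (by positivity)
  have hlim : Tendsto (fun i => ∑ k ∈ s ∪ s', ‖u i k - v k‖) l (𝓝 0) := by
    have : ∀ k, Tendsto (fun i => ‖u i k - v k‖) l (𝓝 0) := fun k =>
      tendsto_iff_norm_sub_tendsto_zero.1 (h k)
    simpa using tendsto_finsetSum (s ∪ s') fun k _ => this k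
  filter_upwards [hs, hlim.eventually_lt_const (show (0 : ℝ) < ε / 4 by positivity)] with i hi hl
  rw [Real.dist_eq, sub_zero, abs_norm]
  refine (norm_le_of_sum_le (C := 3 * (ε / 4)) fun S => ?_).trans_lt (by linarith)
  have h1 : ∑ k ∈ S ∩ (s ∪ s'), ‖u i k - v k‖ ≤ ∑ k ∈ s ∪ s', ‖u i k - v k‖ :=
    Finset.sum_le_sum_of_subset_of_nonneg Finset.inter_subset_right fun _ _ _ => norm_nonneg _
  have h2 := hi (S \ (s ∪ s')) (Finset.sdiff_disjoint.mono_right Finset.subset_union_left)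
  have h3 := hs' (S \ (s ∪ s')) (Finset.sdiff_disjoint.mono_right Finset.subset_union_right)
  rw [Real.norm_of_nonneg (Finset.sum_nonneg fun _ _ => norm_nonneg _)] at h3
  have h4 : ∑ k ∈ S \ (s ∪ s'), ‖u i k - v k‖
      ≤ ∑ k ∈ S \ (s ∪ s'), ‖u i k‖ + ∑ k ∈ S \ (s ∪ s'), ‖v k‖ := by
    rw [← Finset.sum_add_distrib]; exact Finset.sum_le_sum fun k _ => norm_sub_le _ _
  have h5 := Finset.sum_inter_add_sum_sdiff S (s ∪ s') fun k => ‖u i k - v k‖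
  simp only [sub_apply]
  linarith

lemma summable_inv_int_sq : Summable fun k : ℤ => 1 / (k : ℝ) ^ 2 :=
  Real.summable_one_div_int_pow.2 one_lt_two

/-- A bound for `∑ₖ |k|^{m+1} |û(k)|²`, where `m + 1 ≥ 2`, makes the tails of `∑ₖ |û(k)|` uniformly
small. -/
lemma exists_tail_le {m : ℕ} (hm : 1 ≤ m) {M ε : ℝ} (hM : 0 ≤ M) (hε : 0 < ε) :
    ∃ s : Finset ℤ, ∀ u : ℤ → ℂ, (∀ S : Finset ℤ, ∑ k ∈ S, |(k : ℝ)| ^ (m + 1) * ‖u k‖ ^ 2 ≤ M) →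
      ∀ t : Finset ℤ, Disjoint t s → ∑ k ∈ t, ‖u k‖ ≤ ε := by
  classical
  set l := ε / (2 * (M + 1)) with hl
  have hl0 : 0 < l := by positivity
  obtain ⟨s, hs⟩ := summable_iff_vanishing_norm.1 summable_inv_int_sq (4 * l * (ε / 2)) (by positivity)
  refine ⟨insert 0 s, fun u hu t ht => ?_⟩
  have h1 := hs t (ht.mono_right (Finset.subset_insert _ _))
  rw [Real.norm_of_nonneg (Finset.sum_nonneg fun _ _ => by positivity)] at h1
  have h2 : ∑ k ∈ t, ‖u k‖ ≤ ∑ k ∈ t, (l * (|(k : ℝ)| ^ (m + 1) * ‖u k‖ ^ 2)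
      + 1 / (4 * l) * (1 / (k : ℝ) ^ 2)) := by
    refine Finset.sum_le_sum fun k hk => ?_
    have hk0 : k ≠ 0 := fun h => Finset.disjoint_left.1 ht hk (by simp [h])
    have hk1 : (1 : ℝ) ≤ |(k : ℝ)| := by exact_mod_cast Int.one_le_abs hk0
    have hp : |(k : ℝ)| ^ 2 ≤ |(k : ℝ)| ^ (m + 1) := pow_le_pow_right₀ hk1 (by lia)
    have h3 : l * (|(k : ℝ)| ^ 2 * ‖u k‖ ^ 2) ≤ l * (|(k : ℝ)| ^ (m + 1) * ‖u k‖ ^ 2) := by gcongr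
    rw [← sq_abs (k : ℝ)]
    have hkp : 0 < |(k : ℝ)| := by linarith
    have h4 : l * (|(k : ℝ)| ^ 2 * ‖u k‖ ^ 2) + 1 / (4 * l) * (1 / |(k : ℝ)| ^ 2) - ‖u k‖
        = l * (|(k : ℝ)| * ‖u k‖ - 1 / (2 * l * |(k : ℝ)|)) ^ 2 := by
      field_simp; ring
    have h5 : 0 ≤ l * (|(k : ℝ)| * ‖u k‖ - 1 / (2 * l * |(k : ℝ)|)) ^ 2 := by positivity
    linarith
  rw [Finset.sum_add_distrib, ← Finset.mul_sum, ← Finset.mul_sum] at h2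
  have h3 : l * ∑ k ∈ t, |(k : ℝ)| ^ (m + 1) * ‖u k‖ ^ 2 ≤ ε / 2 := by
    calc _ ≤ l * M := mul_le_mul_of_nonneg_left (hu t) hl0.le
      _ = ε / 2 * (M / (M + 1)) := by rw [hl]; field_simp
      _ ≤ ε / 2 := mul_le_of_le_one_right (by positivity) ((div_le_one (by positivity)).2 (by linarith))
  have h4 : 1 / (4 * l) * ∑ k ∈ t, 1 / (k : ℝ) ^ 2 ≤ ε / 2 := by
    rw [one_div, inv_mul_le_iff₀ (by positivity)]; exact h1.le
  linarith

/-- The Fourier multiplier with symbol `c`.  It is `0` by convention where the result does not have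
absolutely summable coefficients. -/
def fmul (c : ℤ → ℂ) (u : Wiener) : Wiener :=
  open Classical in if h : Summable fun k => ‖c k * u k‖ then of (fun k => c k * u k) h else 0

lemma fmul_apply {c : ℤ → ℂ} {u : Wiener} (h : Summable fun k => ‖c k * u k‖) (k : ℤ) :
    fmul c u k = c k * u k := by
  rw [fmul, dif_pos h]; rfl

lemma norm_fmul_le (c : ℤ → ℂ) (u : Wiener) : ‖fmul c u‖ ≤ ∑' k, ‖c k * u k‖ := by
  rw [fmul]
  split_ifs with h
  · rw [norm_def]; rfl
  · rw [norm_zero]; exact tsum_nonneg fun _ => norm_nonneg _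

lemma Supp.fmul_eq {n : ℕ} {u : Wiener} (h : Supp n u) (c : ℤ → ℂ) : fmul c u = cut n c u := by
  ext k
  rw [fmul_apply (summable_of_ne_finset_zero (s := modes n) fun k hk => by simp [h k hk]), cut_apply]
  split_ifs with hk
  · rfl
  · simp [h k hk]

lemma tendsto_cut {c : ℤ → ℂ} {u : Wiener} (h : Summable fun k => ‖c k * u k‖) :
    Tendsto (fun n => cut n c u) atTop (𝓝 (fmul c u)) := by
  refine tendsto_of_tail (fun k => ?_) fun ε hε => ?_
  · refine tendsto_const_nhds.congr' ?_
    filter_upwards [eventually_ge_atTop k.natAbs] with n hn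
    rw [fmul_apply h, cut_apply, if_pos (modes_mono hn (natAbs_mem_modes k))]
  · obtain ⟨s, hs⟩ := summable_iff_vanishing_norm.1 h ε hε
    refine ⟨s, .of_forall fun n t ht => le_trans (Finset.sum_le_sum fun k _ => ?_)
      ((le_abs_self _).trans (hs t ht).le)⟩
    rw [cut_apply]
    split_ifs
    · rfl
    · rw [norm_zero]; exact norm_nonneg _

lemma aestronglyMeasurable_fmul {μ : Measure ℝ} {u : ℝ → Wiener} (hu : Continuous u) {c : ℤ → ℂ}
    (h : ∀ᵐ t ∂μ, Summable fun k => ‖c k * u t k‖) :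
    AEStronglyMeasurable (fun t => fmul c (u t)) μ :=
  aestronglyMeasurable_of_tendsto_ae atTop
    (fun n => ((cut n c).continuous.comp hu).aestronglyMeasurable)
    (h.mono fun _ ht => tendsto_cut ht)

lemma norm_dsym_mul {m : ℕ} (u : Wiener) (k : ℤ) : ‖dsym m k * u k‖ = |(k : ℝ)| ^ m * ‖u k‖ := by
  rw [norm_mul, norm_dsym]

lemma WS.of_succ {m : ℕ} {u : Wiener} (h : WS (m + 1) u) : WS m u := by
  refine .of_nonneg_of_le (fun k => by positivity) (fun k => ?_) (h.add u.summable_norm)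
  have : |(k : ℝ)| ^ m ≤ |(k : ℝ)| ^ (m + 1) + 1 := by
    rcases le_total 1 |(k : ℝ)| with h1 | h1
    · exact (pow_le_pow_right₀ h1 (Nat.le_succ m)).trans (le_add_of_nonneg_right zero_le_one)
    · exact (pow_le_one₀ (abs_nonneg _) h1).trans (le_add_of_nonneg_left (by positivity))
  calc _ ≤ (|(k : ℝ)| ^ (m + 1) + 1) * ‖u k‖ := by gcongr
    _ = _ := by ring

lemma WS.summable_dsym {m : ℕ} {u : Wiener} (h : WS m u) : Summable fun k => ‖dsym m k * u k‖ := by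
  simp_rw [norm_dsym_mul]; exact h

/-- The truncation error of the derivative is controlled by one more derivative. -/
lemma norm_fmul_sub_cut_le {m : ℕ} {u : Wiener} (h : WS (m + 1) u) {R : ℕ} (hR : 0 < R) :
    ‖fmul (dsym m) u - cut R (dsym m) u‖ ≤ 1 / R * wt (m + 1) u := by
  have hR' : (0 : ℝ) < R := by exact_mod_cast hR
  refine norm_le_of_sum_le fun S => ?_
  rw [wt]
  refine le_trans ?_ (mul_le_mul_of_nonneg_left (h.sum_le_tsum S fun _ _ => by positivity)
    (by positivity))
  rw [Finset.mul_sum]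
  refine Finset.sum_le_sum fun k _ => ?_
  rw [sub_apply, fmul_apply h.of_succ.summable_dsym, cut_apply]
  split_ifs with hk
  · simp; positivity
  · rw [sub_zero, norm_dsym_mul, ← mul_assoc]
    refine mul_le_mul_of_nonneg_right ?_ (norm_nonneg _)
    have : (R : ℝ) ≤ |(k : ℝ)| := by
      rw [mem_modes, not_le] at hk; exact_mod_cast hk.le
    rw [div_mul_eq_mul_div, one_mul, le_div_iff₀ hR', pow_succ]
    gcongr

lemma norm_dsym_le (m : ℕ) (k : ℤ) (hk : k ≠ 0) : ‖dsym m k‖ ≤ |(k : ℝ)| ^ (m + 1) := by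
  have hk1 : (1 : ℝ) ≤ |(k : ℝ)| := by exact_mod_cast Int.one_le_abs hk
  rw [norm_dsym]
  exact pow_le_pow_right₀ hk1 (Nat.le_succ m)

section Symbol

variable {m : ℕ} {c : ℤ → ℂ} {u : Wiener}

lemma norm_symbol_mul_le (hc : ∀ k ≠ 0, ‖c k‖ ≤ |(k : ℝ)| ^ m) (h0 : u 0 = 0) (k : ℤ) :
    ‖c k * u k‖ ≤ |(k : ℝ)| ^ m * ‖u k‖ := by
  by_cases hk : k = 0
  · subst hk; simp [h0]
  · rw [norm_mul]; exact mul_le_mul_of_nonneg_right (hc k hk) (norm_nonneg _)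

lemma WS.summable_symbol (h : WS m u) (hc : ∀ k ≠ 0, ‖c k‖ ≤ |(k : ℝ)| ^ m) (h0 : u 0 = 0) :
    Summable fun k => ‖c k * u k‖ :=
  .of_nonneg_of_le (fun _ => norm_nonneg _) (norm_symbol_mul_le hc h0) h

lemma norm_fmul_le_wt (h : WS m u) (hc : ∀ k ≠ 0, ‖c k‖ ≤ |(k : ℝ)| ^ m) (h0 : u 0 = 0) :
    ‖fmul c u‖ ≤ wt m u :=
  (norm_fmul_le _ _).trans
    (Summable.tsum_le_tsum (norm_symbol_mul_le hc h0) (h.summable_symbol hc h0) h)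

end Symbol

end Wiener

open Wiener

/-! ### Passage to the limit -/

/-- Equicontinuity upgrades convergence at rational times to convergence at all times. -/
lemma exists_tendsto_of_equicontinuous {X : ℕ → ℝ → ℂ}
    (heq : ∀ η > 0, ∃ δ > 0, ∀ n s t, |t - s| < δ → ‖X n t - X n s‖ ≤ η)
    (hq : ∀ q : ℚ, ∃ l, Tendsto (fun n => X n q) atTop (𝓝 l)) (t : ℝ) :
    ∃ l, Tendsto (fun n => X n t) atTop (𝓝 l) := by
  refine cauchySeq_tendsto_of_complete (Metric.cauchySeq_iff.2 fun ε hε => ?_)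
  obtain ⟨δ, hδ, h⟩ := heq (ε / 4) (by positivity)
  obtain ⟨q, hq1, hq2⟩ := exists_rat_btwn (show t - δ < t by linarith)
  obtain ⟨l, hl⟩ := hq q
  obtain ⟨N, hN⟩ := Metric.cauchySeq_iff.1 hl.cauchySeq (ε / 4) (by positivity)
  refine ⟨N, fun a ha b hb => ?_⟩
  have hd : |t - q| < δ := by rw [abs_lt]; constructor <;> linarith
  have h1 := h a q t hd
  have h2 := h b q t hd
  have h3 := hN a ha b hb
  rw [dist_eq_norm] at h3 ⊢
  calc ‖X a t - X b t‖ = ‖(X a t - X a q) + (X a q - X b q) - (X b t - X b q)‖ := by congr 1; ring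
    _ ≤ ‖X a t - X a q‖ + ‖X a q - X b q‖ + ‖X b t - X b q‖ :=
      (norm_sub_le _ _).trans (add_le_add_left (norm_add_le _ _) _)
    _ < ε := by linarith

namespace Wiener

/-- A function of time with values in the Wiener algebra that has the regularity of a solution; all
bounds are by the constant `M`.  In the bound `energy`, every mode may be evaluated at a time of its
own. -/
structure IsPath (m : ℕ) (M : ℝ) (u : ℝ → Wiener) : Prop where
  cont : Continuous u
  zero : ∀ t, u t 0 = 0
  real : ∀ t, IsReal (u t)
  norm_le : ∀ t, ‖u t‖ ≤ M
  energy : ∀ (S : Finset ℤ) (τ : ℤ → ℝ), ∑ k ∈ S, |(k : ℝ)| ^ (m + 1) * ‖u (τ k) k‖ ^ 2 ≤ M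
  sum_wt : ∀ (T : ℝ) (S : Finset ℤ), ∫ t in Ioo 0 T, ∑ k ∈ S, |(k : ℝ)| ^ (m + 1) * ‖u t k‖ ≤ M
  sum_en : ∀ (T : ℝ) (S : Finset ℤ),
    ∫ t in Ioo 0 T, ∑ k ∈ S, |(k : ℝ)| ^ (2 * (m + 1)) * ‖u t k‖ ^ 2 ≤ M

/-- The pointwise limit of functions with values in the Wiener algebra with uniform bounds. -/
lemma exists_path {m : ℕ} (hm : 1 ≤ m) {M : ℝ} {N : ℕ → ℕ} (hN : Tendsto N atTop atTop)
    {u : ℕ → ℝ → Wiener} (hu : ∀ n, Continuous (u n)) (hs : ∀ n t, Supp (N n) (u n t))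
    (h0 : ∀ n t, u n t 0 = 0) (hr : ∀ n t, IsReal (u n t)) (hb : ∀ n t, ‖u n t‖ ≤ M)
    (hen : ∀ n (τ : ℤ → ℝ), ∑ k ∈ modes (N n), |(k : ℝ)| ^ (m + 1) * ‖u n (τ k) k‖ ^ 2 ≤ M)
    (hwt : ∀ T : ℝ, ∀ᶠ n in atTop, ∫ t in Ioo 0 T, wt (m + 1) (u n t) ≤ M)
    (hdis : ∀ T : ℝ, ∀ᶠ n in atTop, ∫ t in Ioo 0 T, en (N n) (2 * (m + 1)) (u n t) ≤ M)
    (heq : ∀ k : ℤ, ∀ η > 0, ∃ δ > 0, ∀ n s t, |t - s| < δ → ‖u n t k - u n s k‖ ≤ η)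
    (hq : ∀ (k : ℤ) (q : ℚ), ∃ l, Tendsto (fun n => u n q k) atTop (𝓝 l)) :
    ∃ v : ℝ → Wiener, IsPath m M v ∧ ∀ t, Tendsto (fun n => u n t) atTop (𝓝 (v t)) := by
  have hM : 0 ≤ M := (norm_nonneg _).trans (hb 0 0)
  choose y hy using fun (t : ℝ) (k : ℤ) => exists_tendsto_of_equicontinuous (heq k) (hq k) t
  have hsumm : ∀ t, Summable fun k => ‖y t k‖ := fun t =>
    summable_of_sum_le (c := M) (fun k => norm_nonneg _) fun S =>
      le_of_tendsto (tendsto_finsetSum S fun k _ => (hy t k).norm)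
        (.of_forall fun n => ((u n t).sum_norm_le S).trans (hb n t))
  have hsub : ∀ S : Finset ℤ, ∀ᶠ n in atTop, S ⊆ modes (N n) := fun S =>
    (tendsto_modes.comp hN).eventually_ge_atTop S
  have henS : ∀ (S : Finset ℤ) (τ : ℤ → ℝ) (n : ℕ),
      ∑ k ∈ S, |(k : ℝ)| ^ (m + 1) * ‖u n (τ k) k‖ ^ 2 ≤ M := fun S τ n => by
    classical
    refine le_trans ?_ (hen n τ)
    rw [← Finset.sum_inter_add_sum_sdiff S (modes (N n))]
    have hz : ∑ k ∈ S \ modes (N n), |(k : ℝ)| ^ (m + 1) * ‖u n (τ k) k‖ ^ 2 = 0 :=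
      Finset.sum_eq_zero fun k hk => by
        rw [hs n _ k (Finset.mem_sdiff.1 hk).2]; simp
    rw [hz, add_zero]
    exact Finset.sum_le_sum_of_subset_of_nonneg Finset.inter_subset_right fun _ _ _ => by positivity
  set v : ℝ → Wiener := fun t => of (y t) (hsumm t) with hv
  have hvy : ∀ t k, Tendsto (fun n => u n t k) atTop (𝓝 (v t k)) := hy
  have hven : ∀ (S : Finset ℤ) (τ : ℤ → ℝ),
      ∑ k ∈ S, |(k : ℝ)| ^ (m + 1) * ‖v (τ k) k‖ ^ 2 ≤ M := fun S τ =>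
    le_of_tendsto (tendsto_finsetSum S fun k _ => ((hvy (τ k) k).norm.pow 2).const_mul _)
      (.of_forall (henS S τ))
  have hlim : ∀ t, Tendsto (fun n => u n t) atTop (𝓝 (v t)) := fun t =>
    tendsto_of_tail (hvy t) fun ε hε => by
      obtain ⟨s, hs⟩ := exists_tail_le hm hM hε
      exact ⟨s, .of_forall fun n => hs _ fun S => henS S (fun _ => t) n⟩
  have hcont : Continuous v := continuous_iff_continuousAt.2 fun t =>
    tendsto_of_tail (fun k => Metric.tendsto_nhds.2 fun ε hε => by
      obtain ⟨δ, hδ, h⟩ := heq k (ε / 2) (by positivity)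
      filter_upwards [Metric.ball_mem_nhds t hδ] with s hs
      have h1 : ‖v s k - v t k‖ ≤ ε / 2 :=
        le_of_tendsto ((hvy s k).sub (hvy t k)).norm (.of_forall fun n => h n t s hs)
      rw [dist_eq_norm]; linarith) fun ε hε => by
      obtain ⟨s, hs⟩ := exists_tail_le hm hM hε
      exact ⟨s, .of_forall fun r => hs _ fun S => hven S fun _ => r⟩
  have hint : ∀ (T : ℝ) (S : Finset ℤ) (j : ℕ) (p : ℕ),
      Tendsto (fun n => ∫ t in Ioo 0 T, ∑ k ∈ S, |(k : ℝ)| ^ j * ‖u n t k‖ ^ p) atTop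
        (𝓝 (∫ t in Ioo 0 T, ∑ k ∈ S, |(k : ℝ)| ^ j * ‖v t k‖ ^ p)) := fun T S j p =>
    tendsto_integral_filter_of_norm_le_const
      (.of_forall fun n => (continuous_finsetSum _ fun k _ =>
        ((continuous_apply_comp (hu n) k).norm.pow p).const_mul _).aestronglyMeasurable)
      ⟨∑ k ∈ S, |(k : ℝ)| ^ j * M ^ p, .of_forall fun n => .of_forall fun t => by
        rw [Real.norm_of_nonneg (Finset.sum_nonneg fun _ _ => by positivity)]
        refine Finset.sum_le_sum fun k _ => ?_
        have := ((u n t).norm_apply_le k).trans (hb n t)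
        gcongr⟩
      (.of_forall fun t => tendsto_finsetSum S fun k _ => ((hvy t k).norm.pow p).const_mul _)
  refine ⟨v, ⟨hcont, fun t => ?_, fun t k => ?_, fun t => ?_, hven, fun T S => ?_, fun T S => ?_⟩,
    hlim⟩
  · exact tendsto_nhds_unique (hvy t 0) (by simp [h0])
  · refine tendsto_nhds_unique (hvy t (-k)) ?_
    simp_rw [fun n => hr n t k]
    exact (Complex.continuous_conj.tendsto _).comp (hvy t k)
  · exact le_of_tendsto (hlim t).norm (.of_forall fun n => hb n t)
  · have := hint T S (m + 1) 1
    simp only [pow_one] at this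
    refine le_of_tendsto this ?_
    filter_upwards [hsub S, hwt T] with n h1 h2
    refine le_trans (setIntegral_mono_on ?_ ?_ measurableSet_Ioo fun t _ => ?_) h2
    · exact (continuous_finsetSum _ fun k _ => ((continuous_apply_comp (hu n) k).norm).const_mul _
        ).integrableOn_Icc.mono_set Ioo_subset_Icc_self
    · exact (continuous_wt (hs n) (hu n)).integrableOn_Icc.mono_set Ioo_subset_Icc_self
    · rw [(hs n t).wt_eq]
      exact Finset.sum_le_sum_of_subset_of_nonneg h1 fun _ _ _ => by positivity
  · refine le_of_tendsto (hint T S (2 * (m + 1)) 2) ?_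
    filter_upwards [hsub S, hdis T] with n h1 h2
    refine le_trans (setIntegral_mono_on ?_ ?_ measurableSet_Ioo fun t _ => ?_) h2
    · exact (continuous_finsetSum _ fun k _ => ((continuous_apply_comp (hu n) k).norm.pow 2).const_mul _
        ).integrableOn_Icc.mono_set Ioo_subset_Icc_self
    · exact (continuous_en (hu n)).integrableOn_Icc.mono_set Ioo_subset_Icc_self
    · exact Finset.sum_le_sum_of_subset_of_nonneg h1 fun _ _ _ => by positivity

namespace IsPath

variable {m : ℕ} {M : ℝ} {u : ℝ → Wiener}

lemma continuous_coeff (h : IsPath m M u) (k : ℤ) : Continuous fun t => u t k :=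
  continuous_apply_comp h.cont k

/-- The higher norms of a path, in `L¹` and in `L²`. -/
lemma integrable_wt (h : IsPath m M u) (T : ℝ) :
    (∀ᵐ t ∂volume.restrict (Ioo 0 T), WS (m + 1) (u t)) ∧
      IntegrableOn (fun t => wt (m + 1) (u t)) (Ioo 0 T) ∧
      ∫ t in Ioo 0 T, wt (m + 1) (u t) ≤ M :=
  integrable_tsum_of_sum_le (F := fun (k : ℤ) t => |(k : ℝ)| ^ (m + 1) * ‖u t k‖)
    (fun k => (((h.continuous_coeff k).norm.const_mul _).integrableOn_Icc (a := 0) (b := T)).mono_set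
      Ioo_subset_Icc_self)
    (fun _ _ => by positivity) (h.sum_wt T)

lemma integrable_en (h : IsPath m M u) (T : ℝ) :
    (∀ᵐ t ∂volume.restrict (Ioo 0 T), Summable fun k : ℤ => |(k : ℝ)| ^ (2 * (m + 1)) * ‖u t k‖ ^ 2) ∧
      IntegrableOn (fun t => ∑' k : ℤ, |(k : ℝ)| ^ (2 * (m + 1)) * ‖u t k‖ ^ 2) (Ioo 0 T) ∧
      ∫ t in Ioo 0 T, ∑' k : ℤ, |(k : ℝ)| ^ (2 * (m + 1)) * ‖u t k‖ ^ 2 ≤ M :=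
  integrable_tsum_of_sum_le (F := fun (k : ℤ) t => |(k : ℝ)| ^ (2 * (m + 1)) * ‖u t k‖ ^ 2)
    (fun k => by
      have := h.continuous_coeff k
      exact ((by fun_prop : Continuous fun t => |(k : ℝ)| ^ (2 * (m + 1)) * ‖u t k‖ ^ 2
        ).integrableOn_Icc (a := 0) (b := T)).mono_set Ioo_subset_Icc_self)
    (fun _ _ => by positivity) (h.sum_en T)

/-- The derivatives of order at most `m + 1` of a path are integrable in time with values in the
Wiener algebra. -/
lemma integrable_fmul (h : IsPath m M u) {c : ℤ → ℂ} (hc : ∀ k ≠ 0, ‖c k‖ ≤ |(k : ℝ)| ^ (m + 1))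
    (T : ℝ) : IntegrableOn (fun t => fmul c (u t)) (Ioo 0 T) := by
  obtain ⟨h1, h2, -⟩ := h.integrable_wt T
  refine h2.mono' (aestronglyMeasurable_fmul h.cont
    (h1.mono fun t ht => ht.summable_symbol hc (h.zero t))) ?_
  exact h1.mono fun t ht => norm_fmul_le_wt ht hc (h.zero t)

end IsPath

end Wiener

/-- A pair of functions of time for which the fluxes are integrable up to time `T`, the derivatives
being controlled by the constant `A`. -/
structure FluxPair (m : ℕ) (e T A : ℝ) (f g : ℝ → Wiener) : Prop where
  cont_f : Continuous f
  cont_g : Continuous g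
  norm_f : ∀ t, ‖f t‖ ≤ e
  norm_g : ∀ t, ‖g t‖ ≤ e
  ws_f : ∀ᵐ t ∂volume.restrict (Ioo 0 T), WS (m + 1) (f t)
  ws_g : ∀ᵐ t ∂volume.restrict (Ioo 0 T), WS (m + 1) (g t)
  int_f : IntegrableOn (fun t => fmul (dsym m) (f t)) (Ioo 0 T)
  int_g : IntegrableOn (fun t => fmul (dsym m) (g t)) (Ioo 0 T)
  int_wt : IntegrableOn (fun t => wt (m + 1) (f t) + wt (m + 1) (g t)) (Ioo 0 T)
  wt_le : ∫ t in Ioo 0 T, (wt (m + 1) (f t) + wt (m + 1) (g t)) ≤ A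

/-- The properties of the fluxes needed for the passage to the limit: joint continuity, and
linearity in the last two arguments with uniform bounds. -/
structure FluxMap (e C : ℝ) (J : Wiener → Wiener → Wiener → Wiener → Wiener) : Prop where
  cont : Continuous fun p : Wiener × Wiener × Wiener × Wiener => J p.1 p.2.1 p.2.2.1 p.2.2.2
  sub : ∀ f g a b a' b', J f g a b - J f g a' b' = J f g (a - a') (b - b')
  norm_le : ∀ f g a b, ‖f‖ ≤ e → ‖g‖ ≤ e → ‖J f g a b‖ ≤ C * (‖a‖ + ‖b‖)
  nonneg : 0 ≤ C

variable {m : ℕ} {e T A C K : ℝ} {f g : ℝ → Wiener} {J : Wiener → Wiener → Wiener → Wiener → Wiener}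

namespace FluxPair

lemma integrable_flux (h : FluxPair m e T A f g) (hJ : FluxMap e C J) :
    IntegrableOn (fun t => J (f t) (g t) (fmul (dsym m) (f t)) (fmul (dsym m) (g t))) (Ioo 0 T) := by
  refine ((h.int_f.norm.add h.int_g.norm).const_mul C).mono' ?_
    (.of_forall fun t => hJ.norm_le _ _ _ _ (h.norm_f t) (h.norm_g t))
  exact hJ.cont.comp_aestronglyMeasurable (h.cont_f.aestronglyMeasurable.prodMk
    (h.cont_g.aestronglyMeasurable.prodMk (h.int_f.1.prodMk h.int_g.1)))

lemma continuous_cut_flux (h : FluxPair m e T A f g) (hJ : FluxMap e C J) (R : ℕ) :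
    Continuous fun t => J (f t) (g t) (cut R (dsym m) (f t)) (cut R (dsym m) (g t)) := by
  have hf := h.cont_f
  have hg := h.cont_g
  exact hJ.cont.comp (hf.prodMk (hg.prodMk (((cut R (dsym m)).continuous.comp hf).prodMk
    ((cut R (dsym m)).continuous.comp hg))))

lemma integrable_mul {η : ℝ → ℂ} (hη : Continuous η) {w : ℝ → Wiener} (hw : IntegrableOn w (Ioo 0 T))
    (k : ℤ) (c : ℂ) : IntegrableOn (fun t => c * w t k * η t) (Ioo 0 T) := by
  obtain ⟨K, hK⟩ := (isCompact_Icc (a := 0) (b := T)).exists_bound_of_continuousOn hη.continuousOn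
  have h1 : IntegrableOn (fun t => w t k) (Ioo 0 T) := (coeffL k).integrable_comp hw
  exact (h1.const_mul c).mul_bdd (c := K) hη.aestronglyMeasurable
    ((ae_restrict_mem measurableSet_Ioo).mono fun t ht => hK t (Ioo_subset_Icc_self ht))

/-- The error made by truncating the derivatives in the flux. -/
lemma norm_integral_sub_le (h : FluxPair m e T A f g) (hJ : FluxMap e C J) {η : ℝ → ℂ}
    (hη : Continuous η) (hK : ∀ t ∈ Ioo 0 T, ‖η t‖ ≤ K) (hK0 : 0 ≤ K) (k : ℤ) {R : ℕ} (hR : 0 < R) :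
    ‖(∫ t in Ioo 0 T, dsym 1 k * J (f t) (g t) (fmul (dsym m) (f t)) (fmul (dsym m) (g t)) k * η t)
      - ∫ t in Ioo 0 T, dsym 1 k * J (f t) (g t) (cut R (dsym m) (f t)) (cut R (dsym m) (g t)) k * η t‖
      ≤ ‖dsym 1 k‖ * K * C * A / R := by
  have hi := h.integrable_flux hJ
  have hc := h.continuous_cut_flux hJ R
  have hci := hc.integrableOn_Icc.mono_set (Ioo_subset_Icc_self (a := 0) (b := T)) (μ := volume)
  rw [← integral_sub (integrable_mul hη hi k _) (integrable_mul hη hci k _)]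
  have hR' : (0 : ℝ) < R := by exact_mod_cast hR
  have hC := hJ.nonneg
  have hb : Integrable (fun t => ‖dsym 1 k‖ * K * C / R * (wt (m + 1) (f t) + wt (m + 1) (g t)))
      (volume.restrict (Ioo 0 T)) := h.int_wt.const_mul _
  refine (norm_integral_le_of_norm_le hb ?_).trans ?_
  · filter_upwards [h.ws_f, h.ws_g, ae_restrict_mem measurableSet_Ioo] with t h1 h2 ht
    rw [← sub_mul, ← mul_sub, ← sub_apply, hJ.sub, norm_mul, norm_mul]
    have e1 := norm_fmul_sub_cut_le h1 hR
    have e2 := norm_fmul_sub_cut_le h2 hR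
    have e3 := (norm_apply_le _ k).trans (hJ.norm_le (f t) (g t)
      (fmul (dsym m) (f t) - cut R (dsym m) (f t)) (fmul (dsym m) (g t) - cut R (dsym m) (g t))
      (h.norm_f t) (h.norm_g t))
    have e4 : C * (‖fmul (dsym m) (f t) - cut R (dsym m) (f t)‖
        + ‖fmul (dsym m) (g t) - cut R (dsym m) (g t)‖)
        ≤ C * (1 / R * wt (m + 1) (f t) + 1 / R * wt (m + 1) (g t)) :=
      mul_le_mul_of_nonneg_left (add_le_add e1 e2) hC
    calc _ ≤ ‖dsym 1 k‖ * (C * (1 / R * wt (m + 1) (f t) + 1 / R * wt (m + 1) (g t))) * K := by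
          gcongr
          · have := wt_nonneg (m + 1) (f t)
            have := wt_nonneg (m + 1) (g t)
            positivity
          · exact e3.trans e4
          · exact hK t ht
      _ = _ := by ring
  · rw [integral_const_mul, div_mul_eq_mul_div]
    have := h.wt_le
    gcongr

/-- Passage to the limit in the equation of one mode. -/
lemma mode_equation (hJ : FluxMap e C J) {fs gs : ℕ → ℝ → Wiener}
    (hs : ∀ᶠ n in atTop, FluxPair m e T A (fs n) (gs n)) (h : FluxPair m e T A f g)
    (hf : ∀ t, Tendsto (fun n => fs n t) atTop (𝓝 (f t)))
    (hg : ∀ t, Tendsto (fun n => gs n t) atTop (𝓝 (g t)))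
    {η : ℝ → ℂ} (hη : Continuous η) (k : ℤ) {ls : ℕ → ℂ} {l : ℂ} (hl : Tendsto ls atTop (𝓝 l))
    (heq : ∀ᶠ n in atTop, ls n + ∫ t in Ioo 0 T,
      dsym 1 k * J (fs n t) (gs n t) (fmul (dsym m) (fs n t)) (fmul (dsym m) (gs n t)) k * η t = 0) :
    l + ∫ t in Ioo 0 T,
      dsym 1 k * J (f t) (g t) (fmul (dsym m) (f t)) (fmul (dsym m) (g t)) k * η t = 0 := by
  obtain ⟨K, hK⟩ := (isCompact_Icc (a := 0) (b := T)).exists_bound_of_continuousOn hη.continuousOn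
  have hK' : ∀ t ∈ Ioo 0 T, ‖η t‖ ≤ max K 0 := fun t ht =>
    (hK t (Ioo_subset_Icc_self ht)).trans (le_max_left _ _)
  have hK0 : 0 ≤ max K 0 := le_max_right _ _
  set B := ‖dsym 1 k‖ * max K 0 * C * A with hB
  have hC := hJ.nonneg
  have he : 0 ≤ e := (norm_nonneg _).trans (h.norm_f 0)
  -- with `𝒟` truncated at the frequency `R` the integrals converge, and the dissipation bound controls
  -- the error of the truncation uniformly in `n`
  have key : ∀ R : ℕ, 0 < R → ‖l + ∫ t in Ioo 0 T,
      dsym 1 k * J (f t) (g t) (fmul (dsym m) (f t)) (fmul (dsym m) (g t)) k * η t‖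
        ≤ B / R + B / R := fun R hR => by
    have hlim : Tendsto (fun n => ls n + ∫ t in Ioo 0 T, dsym 1 k *
        J (fs n t) (gs n t) (cut R (dsym m) (fs n t)) (cut R (dsym m) (gs n t)) k * η t) atTop
        (𝓝 (l + ∫ t in Ioo 0 T, dsym 1 k *
          J (f t) (g t) (cut R (dsym m) (f t)) (cut R (dsym m) (g t)) k * η t)) := by
      refine hl.add (tendsto_integral_filter_of_norm_le_const (hs.mono fun n hn => ?_)
        ⟨‖dsym 1 k‖ * (C * (‖cut R (dsym m)‖ * e + ‖cut R (dsym m)‖ * e)) * max K 0,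
          hs.mono fun n hn => ?_⟩ (.of_forall fun t => ?_))
      · exact (((continuous_apply_comp (hn.continuous_cut_flux hJ R) k).const_mul _).mul
          hη).aestronglyMeasurable
      · filter_upwards [ae_restrict_mem measurableSet_Ioo] with t ht
        rw [norm_mul, norm_mul]
        have e1 := (norm_apply_le _ k).trans (hJ.norm_le (fs n t) (gs n t)
          (cut R (dsym m) (fs n t)) (cut R (dsym m) (gs n t)) (hn.norm_f t) (hn.norm_g t))
        have e2 := (cut R (dsym m)).le_opNorm_of_le (hn.norm_f t)
        have e3 := (cut R (dsym m)).le_opNorm_of_le (hn.norm_g t)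
        have e4 := e1.trans (mul_le_mul_of_nonneg_left (add_le_add e2 e3) hC)
        have := hK' t ht
        gcongr
      · have h1 := (hJ.cont.tendsto (f t, g t, cut R (dsym m) (f t), cut R (dsym m) (g t))).comp
          ((hf t).prodMk_nhds ((hg t).prodMk_nhds ((((cut R (dsym m)).continuous.tendsto _).comp
            (hf t)).prodMk_nhds (((cut R (dsym m)).continuous.tendsto _).comp (hg t)))))
        exact ((((coeffL k).continuous.tendsto _).comp h1).const_mul _).mul_const _
    have h1 : ‖l + ∫ t in Ioo 0 T, dsym 1 k *
          J (f t) (g t) (cut R (dsym m) (f t)) (cut R (dsym m) (g t)) k * η t‖ ≤ B / R := by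
      refine le_of_tendsto hlim.norm ?_
      filter_upwards [heq, hs] with n h1 h2
      have := h2.norm_integral_sub_le hJ hη hK' hK0 k hR
      rw [← sub_zero (ls n + _), ← h1, add_sub_add_left_eq_sub, norm_sub_rev]
      exact this
    have h2 := h.norm_integral_sub_le hJ hη hK' hK0 k hR
    refine le_trans (le_of_eq_of_le ?_ (norm_add_le _ _)) (add_le_add h1 h2)
    congr 1; ring
  have hlim : Tendsto (fun R : ℕ => B / (R : ℝ) + B / R) atTop (𝓝 0) := by
    simpa using (tendsto_const_div_atTop_nhds_zero_nat B).add (tendsto_const_div_atTop_nhds_zero_nat B)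
  exact norm_le_zero_iff.1 (ge_of_tendsto hlim ((eventually_gt_atTop 0).mono key))

end FluxPair

open Wiener

namespace Par

variable {P : Par} {n m : ℕ} {e T : ℝ} {f₀ g₀ : Wiener} {f g : ℝ → Wiener}

lemma exists_fluxMap (P : Par) (e : ℝ) : ∃ C, FluxMap e C P.J₁ ∧ FluxMap e C P.J₂ := by
  obtain ⟨C, hC, h⟩ := exists_norm_J_le P e
  refine ⟨C, ⟨?_, fun f g a b a' b' => ?_, fun f g a b hf hg => (h f g a b hf hg).1, hC⟩,
    ⟨?_, fun f g a b a' b' => ?_, fun f g a b hf hg => (h f g a b hf hg).2, hC⟩⟩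
  · unfold J₁ nl₁ w₁₁ w₁₂ n₁₁ n₁₂ mixed cubic; fun_prop
  · unfold J₁ nl₁; ring
  · unfold J₂ nl₂ w₂₁ w₂₂ n₂₁ n₂₂ mixed cubic; fun_prop
  · unfold J₂ nl₂; ring

namespace IsGalerkin

lemma fluxPair (h : IsGalerkin P e n m T f₀ g₀ f g) (hP : P.Adm e) (hm : Odd m) {S : ℝ} (hS : 0 ≤ S)
    (hST : S ≤ T) : FluxPair m e S (e / P.rate e) f g := by
  have hc := h.cont_wt (m + 1)
  refine ⟨h.cont_f, h.cont_g, h.norm_f_le, h.norm_g_le, .of_forall fun t => (h.supp_f t).ws _,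
    .of_forall fun t => (h.supp_g t).ws _, ?_, ?_,
    hc.integrableOn_Icc.mono_set Ioo_subset_Icc_self, ?_⟩
  · simp_rw [fun t => (h.supp_f t).fmul_eq (dsym m)]
    exact ((cut n (dsym m)).continuous.comp h.cont_f).integrableOn_Icc.mono_set Ioo_subset_Icc_self
  · simp_rw [fun t => (h.supp_g t).fmul_eq (dsym m)]
    exact ((cut n (dsym m)).continuous.comp h.cont_g).integrableOn_Icc.mono_set Ioo_subset_Icc_self
  · rw [← integral_Ioc_eq_integral_Ioo, ← intervalIntegral.integral_of_le hS]
    exact h.integral_wt_le hP hm ⟨hS, hST⟩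

/-- Integration by parts in time for one mode, against `η` with `η(S) = 0`. -/
lemma integral_deriv_mul {u v η η' : ℝ → ℂ} {S : ℝ} (hS : 0 ≤ S) (hST : S ≤ T) (hu : Continuous u)
    (hv : Continuous v) (h : ∀ t ∈ Ico 0 T, HasDerivWithinAt u (v t) (Ici t) t)
    (hη : ∀ t, HasDerivAt η (η' t) t) (hη' : Continuous η') (hS0 : η S = 0) :
    u 0 * η 0 + (∫ t in Ioo 0 S, u t * η' t) + ∫ t in Ioo 0 S, v t * η t = 0 := by
  have hηc : Continuous η := continuous_iff_continuousAt.2 fun t => (hη t).continuousAt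
  have key := intervalIntegral.integral_eq_sub_of_hasDeriv_right (a := 0) (b := S)
    (f := fun t => u t * η t) (f' := fun t => v t * η t + u t * η' t)
    (hu.mul hηc).continuousOn (fun t ht => by
      rw [min_eq_left hS, max_eq_right hS] at ht
      exact ((h t ⟨ht.1.le, ht.2.trans_le hST⟩).mono Ioi_subset_Ici_self).mul
        (hη t).hasDerivWithinAt)
    (((hv.mul hηc).add (hu.mul hη')).intervalIntegrable _ _)
  have c1 : Continuous fun t => v t * η t := hv.mul hηc
  have c2 : Continuous fun t => u t * η' t := hu.mul hη'
  rw [intervalIntegral.integral_add (c1.intervalIntegrable _ _) (c2.intervalIntegrable _ _), hS0, intervalIntegral.integral_of_le hS,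
    intervalIntegral.integral_of_le hS, integral_Ioc_eq_integral_Ioo, integral_Ioc_eq_integral_Ioo]
    at key
  linear_combination key

lemma mode_equation (h : IsGalerkin P e n m T f₀ g₀ f g) {S : ℝ} (hS : 0 ≤ S) (hST : S ≤ T) {k : ℤ}
    (hk : k ∈ modes n) {η η' : ℝ → ℂ} (hη : ∀ t, HasDerivAt η (η' t) t) (hη' : Continuous η')
    (hS0 : η S = 0) :
    (f 0 k * η 0 + (∫ t in Ioo 0 S, f t k * η' t) + ∫ t in Ioo 0 S,
      dsym 1 k * P.J₁ (f t) (g t) (fmul (dsym m) (f t)) (fmul (dsym m) (g t)) k * η t = 0) ∧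
    (g 0 k * η 0 + (∫ t in Ioo 0 S, g t k * η' t) + ∫ t in Ioo 0 S,
      dsym 1 k * P.J₂ (f t) (g t) (fmul (dsym m) (f t)) (fmul (dsym m) (g t)) k * η t = 0) := by
  have h1 := integral_deriv_mul hS hST (continuous_apply_comp h.cont_f k)
    (continuous_apply_comp h.cont_V₁ k) (fun t ht => hasDerivWithinAt_apply (h.deriv_f t ht) k)
    hη hη' hS0
  have h2 := integral_deriv_mul hS hST (continuous_apply_comp h.cont_g k)
    (continuous_apply_comp h.cont_V₂ k) (fun t ht => hasDerivWithinAt_apply (h.deriv_g t ht) k)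
    hη hη' hS0
  simp_rw [V₁, cut_apply, if_pos hk] at h1
  simp_rw [V₂, cut_apply, if_pos hk] at h2
  simp_rw [fun t => (h.supp_f t).fmul_eq (dsym m), fun t => (h.supp_g t).fmul_eq (dsym m)]
  exact ⟨h1, h2⟩

end IsGalerkin

/-- A common modulus of continuity for a given mode of all Galerkin approximations. -/
lemma exists_modulus (hP : P.Adm e) (hm : Odd m) (k : ℤ) {η : ℝ} (hη : 0 < η) :
    ∃ δ > 0, ∀ {n T f₀ g₀ f g}, 0 ≤ T → IsGalerkin P e n m T f₀ g₀ f g → ∀ s t, |t - s| < δ →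
      ‖f t k - f s k‖ ≤ η ∧ ‖g t k - g s k‖ ≤ η := by
  have hk : 0 ≤ |(k : ℝ)| := abs_nonneg _
  obtain ⟨L, hL, h⟩ := exists_equicontinuous hP hm (η := η / (2 * (|(k : ℝ)| + 1))) (by positivity)
  refine ⟨η / (2 * (|(k : ℝ)| + 1) * (L + 1)), by positivity, fun {n T f₀ g₀ f g} hT hG => ?_⟩
  have key : ∀ s t, s ≤ t → |t - s| < η / (2 * (|(k : ℝ)| + 1) * (L + 1)) →
      ‖f t k - f s k‖ ≤ η ∧ ‖g t k - g s k‖ ≤ η := by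
    intro s t hst hlt
    set c : ℝ → ℝ := fun t => max 0 (min t T) with hc
    have hcs : ∀ t, c t ∈ Icc 0 T := fun t => ⟨le_max_left _ _, max_le hT (min_le_right _ _)⟩
    have hcm : c s ≤ c t := max_le_max le_rfl (min_le_min hst le_rfl)
    have hcl : c t - c s ≤ t - s := by
      simp only [hc]
      rcases le_total s T with h1 | h1 <;> rcases le_total t T with h2 | h2 <;>
        rcases le_total 0 s with h3 | h3 <;> rcases le_total 0 t with h4 | h4 <;>
        simp only [min_eq_left, min_eq_right, max_eq_left, max_eq_right, h1, h2, h3, h4, hT] <;>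
        linarith
    have hb := h hG k (hcs s) (t := c t) ⟨hcm, (hcs t).2⟩
    rw [← (hG.const t).1, ← (hG.const s).1, ← (hG.const t).2, ← (hG.const s).2] at hb
    rw [abs_of_nonneg (by linarith)] at hlt
    have hbd : |(k : ℝ)| * (η / (2 * (|(k : ℝ)| + 1)) + L * (c t - c s)) ≤ η := by
      have h1 : L * (c t - c s) ≤ η / (2 * (|(k : ℝ)| + 1)) := by
        calc L * (c t - c s) ≤ (L + 1) * (η / (2 * (|(k : ℝ)| + 1) * (L + 1))) := by
              apply mul_le_mul <;> linarith
          _ = _ := by field_simp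
      have h2 : η / (2 * (|(k : ℝ)| + 1)) * (|(k : ℝ)| + 1) = η / 2 := by field_simp
      have h3 : 0 ≤ η / (2 * (|(k : ℝ)| + 1)) := by positivity
      have h4 := mul_le_mul_of_nonneg_left h1 hk
      nlinarith
    exact ⟨hb.1.trans hbd, hb.2.trans hbd⟩
  intro s t hst
  rcases le_total s t with h1 | h1
  · exact key s t h1 hst
  · have := key t s h1 (by rwa [abs_sub_comm])
    rwa [norm_sub_rev, norm_sub_rev (g t k)]

/-- Existence of a solution, in terms of Fourier coefficients: a limit of Galerkin
approximations. -/
theorem exists_solution (hP : P.Adm e) (hm : m = 1 ∨ m = 3) (hf₀ : f₀ 0 = 0) (hg₀ : g₀ 0 = 0)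
    (hf₀r : IsReal f₀) (hg₀r : IsReal g₀) (he : ‖f₀‖ + ‖g₀‖ = e)
    (hf₀s : Summable fun k : ℤ => |(k : ℝ)| ^ (m + 1) * ‖f₀ k‖ ^ 2)
    (hg₀s : Summable fun k : ℤ => |(k : ℝ)| ^ (m + 1) * ‖g₀ k‖ ^ 2) :
    ∃ (M : ℝ) (f g : ℝ → Wiener), IsPath m M f ∧ IsPath m M g ∧
      (∀ t, 0 ≤ t → ‖f t‖ + ‖g t‖ ≤ e * Real.exp (-(P.rate e / 2 * t))) ∧
      (∀ T, 0 < T → ∃ A, FluxPair m e T A f g) ∧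
      ∀ (T : ℝ) (k : ℤ) (η η' : ℝ → ℂ), 0 < T → (∀ t, HasDerivAt η (η' t) t) → Continuous η' →
        η T = 0 →
        (f₀ k * η 0 + (∫ t in Ioo 0 T, f t k * η' t) + ∫ t in Ioo 0 T,
          dsym 1 k * P.J₁ (f t) (g t) (fmul (dsym m) (f t)) (fmul (dsym m) (g t)) k * η t = 0) ∧
        (g₀ k * η 0 + (∫ t in Ioo 0 T, g t k * η' t) + ∫ t in Ioo 0 T,
          dsym 1 k * P.J₂ (f t) (g t) (fmul (dsym m) (f t)) (fmul (dsym m) (g t)) k * η t = 0) := by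
  have hodd : Odd m := by rcases hm with rfl | rfl <;> decide
  have hm1 : 1 ≤ m := hodd.pos
  have hTn : ∀ n : ℕ, (0 : ℝ) < n + 1 := fun n => by positivity
  choose F G hFG using fun n : ℕ => exists_isGalerkin hP hodd n (hTn n) hf₀ hg₀ hf₀r hg₀r he
  -- a subsequence converging at all rational times
  obtain ⟨y, -, φ, hφ, hy⟩ := (isCompact_univ_pi fun _ : ℤ × ℚ =>
    isCompact_closedBall (0 : ℂ × ℂ) e).tendsto_subseq
      (x := fun n p => (F n p.2 p.1, G n p.2 p.1)) fun n p _ => by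
        rw [mem_closedBall_zero_iff]
        exact max_le ((norm_apply_le _ _).trans ((hFG n).norm_f_le _))
          ((norm_apply_le _ _).trans ((hFG n).norm_g_le _))
  have hyq : ∀ (k : ℤ) (q : ℚ), Tendsto (fun n => (F (φ n) q k, G (φ n) q k)) atTop (𝓝 (y (k, q))) :=
    fun k q => (tendsto_pi_nhds.1 hy) (k, q)
  obtain ⟨M₁, hM₁, hbd⟩ := exists_energy_bound hP hm hf₀s hg₀s
  set A := e / P.rate e with hA
  have he0 := hP.nonneg
  have hA0 : 0 ≤ A := div_nonneg he0 hP.rate_pos.le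
  set M := M₁ + A + e with hM
  have hTφ : ∀ T : ℝ, ∀ᶠ n in atTop, T ≤ (φ n : ℝ) + 1 := fun T => by
    have := (tendsto_natCast_atTop_atTop (R := ℝ)).comp hφ.tendsto_atTop
    filter_upwards [this.eventually_ge_atTop T] with n hn
    exact hn.trans (by simp)
  have hcl : ∀ (n : ℕ) (t : ℝ), max 0 (min t ((n : ℝ) + 1)) ∈ Icc (0 : ℝ) (n + 1) := fun n t =>
    ⟨le_max_left _ _, max_le (hTn n).le (min_le_right _ _)⟩
  have hen : ∀ (n : ℕ) (τ : ℤ → ℝ), ∑ k ∈ modes (φ n), |(k : ℝ)| ^ (m + 1) * ‖F (φ n) (τ k) k‖ ^ 2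
      + ∑ k ∈ modes (φ n), |(k : ℝ)| ^ (m + 1) * ‖G (φ n) (τ k) k‖ ^ 2 ≤ M₁ := fun n τ => by
    have := (hbd (hTn (φ n)) (hFG (φ n))).2 (fun k => max 0 (min (τ k) ((φ n : ℝ) + 1)))
      fun k => hcl _ _
    simp_rw [← ((hFG (φ n)).const _).1, ← ((hFG (φ n)).const _).2] at this
    exact this
  have hposS : ∀ (n : ℕ) (τ : ℤ → ℝ) (H : ℕ → ℝ → Wiener),
      0 ≤ ∑ k ∈ modes (φ n), |(k : ℝ)| ^ (m + 1) * ‖H (φ n) (τ k) k‖ ^ 2 := fun n τ H =>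
    Finset.sum_nonneg fun _ _ => by positivity
  have hwt : ∀ T : ℝ, ∀ᶠ n in atTop,
      ∫ t in Ioo 0 T, (wt (m + 1) (F (φ n) t) + wt (m + 1) (G (φ n) t)) ≤ A := fun T => by
    rcases lt_or_ge T 0 with hT | hT
    · simp [Ioo_eq_empty_of_le hT.le, hA0]
    · filter_upwards [hTφ T] with n hn
      exact ((hFG (φ n)).fluxPair hP hodd hT hn).wt_le
  have hdis : ∀ T : ℝ, ∀ᶠ n in atTop, ∫ t in Ioo 0 T,
      (en (φ n) (2 * (m + 1)) (F (φ n) t) + en (φ n) (2 * (m + 1)) (G (φ n) t)) ≤ M₁ := fun T => by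
    filter_upwards [hTφ T] with n hn
    have h1 := (hbd (hTn (φ n)) (hFG (φ n))).1
    rw [intervalIntegral.integral_of_le (hTn _).le, integral_Ioc_eq_integral_Ioo] at h1
    refine (setIntegral_mono_set ?_ (.of_forall fun t => add_nonneg (en_nonneg _ _ _) (en_nonneg _ _ _))
      (LE.le.eventuallyLE (Ioo_subset_Ioo_right hn))).trans h1
    exact ((hFG (φ n)).cont_en _).integrableOn_Icc.mono_set Ioo_subset_Icc_self
  have icc : ∀ {w : ℝ → ℝ} (T : ℝ), Continuous w → IntegrableOn w (Ioo 0 T) := fun T hw =>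
    hw.integrableOn_Icc.mono_set Ioo_subset_Icc_self
  obtain ⟨f, hf, hfl⟩ := exists_path (M := M) hm1 hφ.tendsto_atTop (u := fun n => F (φ n))
    (fun n => (hFG _).cont_f) (fun n => (hFG _).supp_f) (fun n => (hFG _).zero_f)
    (fun n => (hFG _).real_f) (fun n t => ((hFG _).norm_f_le t).trans (by linarith))
    (fun n τ => by linarith [hen n τ, hposS n τ G])
    (fun T => (hwt T).mono fun n hn => by
      have := setIntegral_mono (s := Ioo 0 T) (μ := volume)
        (icc T (continuous_wt (s := m + 1) (hFG (φ n)).supp_f (hFG (φ n)).cont_f))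
        (icc T ((hFG (φ n)).cont_wt (m + 1)))
        fun t => le_add_of_nonneg_right (wt_nonneg _ _)
      linarith)
    (fun T => (hdis T).mono fun n hn => by
      have := setIntegral_mono (s := Ioo 0 T) (μ := volume)
        (icc T (continuous_en (n := φ n) (s := 2 * (m + 1)) (hFG (φ n)).cont_f))
        (icc T ((hFG (φ n)).cont_en (2 * (m + 1))))
        fun t => le_add_of_nonneg_right (en_nonneg _ _ _)
      linarith)
    (fun k η hη => by
      obtain ⟨δ, hδ, h⟩ := exists_modulus hP hodd k hη
      exact ⟨δ, hδ, fun n s t hst => (h (hTn _).le (hFG (φ n)) s t hst).1⟩)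
    (fun k q => ⟨_, (Prod.tendsto_iff _ _).1 (hyq k q) |>.1⟩)
  obtain ⟨g, hg, hgl⟩ := exists_path (M := M) hm1 hφ.tendsto_atTop (u := fun n => G (φ n))
    (fun n => (hFG _).cont_g) (fun n => (hFG _).supp_g) (fun n => (hFG _).zero_g)
    (fun n => (hFG _).real_g) (fun n t => ((hFG _).norm_g_le t).trans (by linarith))
    (fun n τ => by linarith [hen n τ, hposS n τ F])
    (fun T => (hwt T).mono fun n hn => by
      have := setIntegral_mono (s := Ioo 0 T) (μ := volume)
        (icc T (continuous_wt (s := m + 1) (hFG (φ n)).supp_g (hFG (φ n)).cont_g))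
        (icc T ((hFG (φ n)).cont_wt (m + 1)))
        fun t => le_add_of_nonneg_left (wt_nonneg _ _)
      linarith)
    (fun T => (hdis T).mono fun n hn => by
      have := setIntegral_mono (s := Ioo 0 T) (μ := volume)
        (icc T (continuous_en (n := φ n) (s := 2 * (m + 1)) (hFG (φ n)).cont_g))
        (icc T ((hFG (φ n)).cont_en (2 * (m + 1))))
        fun t => le_add_of_nonneg_left (en_nonneg _ _ _)
      linarith)
    (fun k η hη => by
      obtain ⟨δ, hδ, h⟩ := exists_modulus hP hodd k hη
      exact ⟨δ, hδ, fun n s t hst => (h (hTn _).le (hFG (φ n)) s t hst).2⟩)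
    (fun k q => ⟨_, (Prod.tendsto_iff _ _).1 (hyq k q) |>.2⟩)
  have hlim : ∀ t, Tendsto (fun n => ‖F (φ n) t‖ + ‖G (φ n) t‖) atTop (𝓝 (‖f t‖ + ‖g t‖)) := fun t =>
    (hfl t).norm.add (hgl t).norm
  have hnorm : ∀ t, ‖f t‖ + ‖g t‖ ≤ e := fun t =>
    le_of_tendsto (hlim t) (.of_forall fun n => (hFG (φ n)).norm_le t)
  have hflux : ∀ T, 0 < T → FluxPair m e T (M + M) f g := fun T hT => by
    obtain ⟨a1, a2, a3⟩ := hf.integrable_wt T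
    obtain ⟨b1, b2, b3⟩ := hg.integrable_wt T
    refine ⟨hf.cont, hg.cont, fun t => by linarith [hnorm t, norm_nonneg (g t)],
      fun t => by linarith [hnorm t, norm_nonneg (f t)], a1, b1, hf.integrable_fmul (norm_dsym_le m) T,
      hg.integrable_fmul (norm_dsym_le m) T, a2.add b2, ?_⟩
    rw [integral_add a2 b2]
    exact add_le_add a3 b3
  refine ⟨M, f, g, hf, hg, fun t ht => le_of_tendsto (hlim t) ?_, fun T hT => ⟨_, hflux T hT⟩,
    fun T k η η' hT hη hη' hT0 => ?_⟩
  · filter_upwards [hTφ t] with n hn using (hFG (φ n)).decay t ⟨ht, hn⟩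
  · obtain ⟨C, hJ₁, hJ₂⟩ := P.exists_fluxMap e
    have hηc : Continuous η := continuous_iff_continuousAt.2 fun t => (hη t).continuousAt
    have hmono : ∀ᶠ n in atTop, FluxPair m e T (M + M) (F (φ n)) (G (φ n)) := by
      filter_upwards [hTφ T] with n hn
      have := (hFG (φ n)).fluxPair hP hodd hT.le hn
      exact { this with wt_le := this.wt_le.trans (by linarith) }
    have hk : ∀ᶠ n in atTop, k ∈ modes (φ n) := by
      filter_upwards [hφ.tendsto_atTop.eventually_ge_atTop k.natAbs] with n hn
      exact modes_mono hn (natAbs_mem_modes k)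
    obtain ⟨K, hK⟩ := (isCompact_Icc (a := 0) (b := T)).exists_bound_of_continuousOn hη'.continuousOn
    have lin : ∀ (H : ℕ → ℝ → Wiener) (h : ℝ → Wiener) (h₀ : Wiener), (∀ n, Continuous (H n)) →
        (∀ n t, ‖H n t‖ ≤ e) → (∀ n, H n 0 = cut n 1 h₀) →
        (∀ t, Tendsto (fun n => H (φ n) t) atTop (𝓝 (h t))) →
        Tendsto (fun n => H (φ n) 0 k * η 0 + ∫ t in Ioo 0 T, H (φ n) t k * η' t) atTop
          (𝓝 (h₀ k * η 0 + ∫ t in Ioo 0 T, h t k * η' t)) := by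
      intro H h h₀ hc hb h0 hl
      refine Tendsto.add (Tendsto.mul_const _ ?_) (tendsto_integral_filter_of_norm_le_const
        (.of_forall fun n => ((continuous_apply_comp (hc _) k).mul hη').aestronglyMeasurable)
        ⟨e * K, .of_forall fun n => ?_⟩ (.of_forall fun t => ?_))
      · refine tendsto_const_nhds.congr' ?_
        filter_upwards [hk] with n hn
        rw [h0, cut_apply, if_pos hn]; simp
      · filter_upwards [ae_restrict_mem measurableSet_Ioo] with t ht
        rw [norm_mul]
        have h1 := (norm_apply_le _ k).trans (hb (φ n) t)
        have h2 := hK t (Ioo_subset_Icc_self ht)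
        gcongr
      · exact (((coeffL k).continuous.tendsto _).comp (hl t)).mul_const _
    constructor
    · refine FluxPair.mode_equation hJ₁ hmono (hflux T hT) hfl hgl hηc k
        (lin F f f₀ (fun n => (hFG n).cont_f) (fun n => (hFG n).norm_f_le) (fun n => (hFG n).init_f)
          hfl) ?_
      filter_upwards [hTφ T, hk] with n h1 h2
      exact ((hFG (φ n)).mode_equation hT.le h1 h2 hη hη' hT0).1
    · refine FluxPair.mode_equation hJ₂ hmono (hflux T hT) hfl hgl hηc k
        (lin G g g₀ (fun n => (hFG n).cont_g) (fun n => (hFG n).norm_g_le) (fun n => (hFG n).init_g)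
          hgl) ?_
      filter_upwards [hTφ T, hk] with n h1 h2
      exact ((hFG (φ n)).mode_equation hT.le h1 h2 hη hη' hT0).2

end Par

/-! ### Functions with absolutely summable Fourier coefficients -/

instance : IsFiniteMeasure torusMeasure := by unfold torusMeasure; infer_instance

lemma intervalIntegral_eq_torus {E : Type*} [NormedAddCommGroup E] [NormedSpace ℝ E] (f : ℝ → E) :
    ∫ x in (-Real.pi)..Real.pi, f x = ∫ x, f x ∂torusMeasure :=
  intervalIntegral.integral_of_le (by linarith [Real.pi_pos])

lemma fc_eq_integral (u : ℝ → ℝ) (k : ℤ) :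
    fc u k = (1 / (2 * Real.pi) : ℝ) • ∫ x in (-Real.pi)..Real.pi, (u x : ℂ) * chr (-k) x := by
  rw [fc, fourierCoeffOn_eq_integral]
  have h : Real.pi - -Real.pi = 2 * Real.pi := by ring
  congr 1
  · rw [h]
  · refine intervalIntegral.integral_congr fun x _ => ?_
    rw [fourier_coe_apply, smul_eq_mul, mul_comm, chr]
    congr 2
    have : (Real.pi : ℂ) ≠ 0 := by exact_mod_cast Real.pi_ne_zero
    push_cast
    rw [sub_neg_eq_add]
    field_simp
    ring

lemma mean_eq_fc (u : ℝ → ℝ) : (mean u : ℂ) = fc u 0 := by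
  rw [fc_eq_integral, mean]
  simp only [neg_zero, chr_zero, mul_one, intervalIntegral.integral_ofReal, Complex.real_smul]
  push_cast
  ring

/-- The Fourier coefficients of a real function. -/
lemma fc_neg (u : ℝ → ℝ) (k : ℤ) : fc u (-k) = (starRingEnd ℂ) (fc u k) := by
  rw [fc_eq_integral, fc_eq_integral, Complex.real_smul, Complex.real_smul, map_mul,
    Complex.conj_ofReal, intervalIntegral_eq_torus, intervalIntegral_eq_torus, ← integral_conj]
  congr 2
  funext x
  rw [map_mul, Complex.conj_ofReal, ← chr_neg]

namespace Wiener

/-- The real part of the function with the given Fourier coefficients. -/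
def val (u : Wiener) (x : ℝ) : ℝ := (ev u x).re

lemma IsReal.ev_eq {u : Wiener} (h : IsReal u) (x : ℝ) : ev u x = (val u x : ℂ) := by
  have h1 := ev_conjFun u x
  rw [isReal_iff.1 h] at h1
  exact (Complex.conj_eq_iff_re.1 h1.symm).symm

lemma val_sub (u v : Wiener) (x : ℝ) : val (u - v) x = val u x - val v x := by
  simp only [val]
  rw [show ev (u - v) x = ev u x - ev v x from (evHom x).map_sub u v, Complex.sub_re]

lemma continuous_val (u : Wiener) : Continuous (val u) := Complex.continuous_re.comp (continuous_ev u)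

lemma val_periodic (u : Wiener) : Function.Periodic (val u) (2 * Real.pi) := fun x => by
  simp only [val, ev_periodic u x]

lemma abs_val_le (u : Wiener) (x : ℝ) : |val u x| ≤ ‖u‖ :=
  (Complex.abs_re_le_norm _).trans (norm_ev_le u x)

lemma memLp_val (u : Wiener) (p : ℝ≥0∞) : MemLp (val u) p torusMeasure :=
  MemLp.of_bound (continuous_val u).aestronglyMeasurable ‖u‖ (.of_forall (abs_val_le u))

lemma fc_val {u : Wiener} (h : IsReal u) (k : ℤ) : fc (val u) k = u k := by
  rw [fc_eq_integral]
  simp_rw [← h.ev_eq]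
  rw [integral_ev_mul_chr, Complex.real_smul]
  have : (Real.pi : ℂ) ≠ 0 := by exact_mod_cast Real.pi_ne_zero
  push_cast
  field_simp

lemma hSq_val {u : Wiener} (h : IsReal u) {α : ℝ} {p : ℕ} (hα : 2 * α = p) :
    hSq α (val u) = ∑' k : ℤ, |(k : ℝ)| ^ p * ‖u k‖ ^ 2 := by
  simp only [hSq, fc_val h, hα, Real.rpow_natCast]

lemma memHdot_val {u : Wiener} (h : IsReal u) (h0 : u 0 = 0) {α : ℝ} {p : ℕ} (hα : 2 * α = p)
    (hs : Summable fun k : ℤ => |(k : ℝ)| ^ p * ‖u k‖ ^ 2) : MemHdot α (val u) := by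
  refine ⟨val_periodic u, memLp_val u 2, ?_, ?_⟩
  · have := mean_eq_fc (val u)
    rw [fc_val h, h0] at this
    exact_mod_cast this
  · simpa only [fc_val h, hα, Real.rpow_natCast] using hs

/-! ### Synthesis operators -/

section Synth

variable {X : Type*} [TopologicalSpace X]

lemma summable_synth {b : ℤ → X →ᵇ ℂ} (hb : ∀ k, ‖b k‖ ≤ 2) (u : Wiener) :
    Summable fun k => ‖u k • b k‖ :=
  .of_nonneg_of_le (fun _ => norm_nonneg _) (fun k => by
    rw [norm_smul]; exact mul_le_mul_of_nonneg_left (hb k) (norm_nonneg _)) (u.summable_norm.mul_right 2)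

/-- The operator `u ↦ Re ∑ₖ û(k) bₖ` for a bounded family of bounded continuous functions `bₖ`. -/
def synth (b : ℤ → X →ᵇ ℂ) (hb : ∀ k, ‖b k‖ ≤ 2) : Wiener →L[ℝ] (X →ᵇ ℝ) :=
  (Complex.reCLM.compLeftContinuousBounded X).comp <|
    LinearMap.mkContinuous
      ({ toFun := fun u => ∑' k, u k • b k
         map_add' := fun u v => by
          simp only [add_apply, add_smul]
          exact (summable_synth hb u).of_norm.tsum_add (summable_synth hb v).of_norm
         map_smul' := fun c u => by
          simp only [real_smul_apply, mul_smul]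
          exact ((summable_synth hb u).of_norm.tsum_const_smul (c : ℂ)).trans (Complex.coe_smul _ _) } :
        Wiener →ₗ[ℝ] (X →ᵇ ℂ)) 2 fun u => by
      refine (norm_tsum_le_tsum_norm (summable_synth hb u)).trans ?_
      rw [norm_def, ← tsum_mul_left]
      refine Summable.tsum_le_tsum (fun k => ?_) (summable_synth hb u) (u.summable_norm.mul_left 2)
      rw [norm_smul, mul_comm]
      exact mul_le_mul_of_nonneg_right (hb k) (norm_nonneg _)

lemma synth_apply {b : ℤ → X →ᵇ ℂ} (hb : ∀ k, ‖b k‖ ≤ 2) (u : Wiener) (x : X) :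
    synth b hb u x = (∑' k, u k * b k x).re := by
  have h := (BoundedContinuousFunction.evalCLM ℂ x).map_tsum (summable_synth hb u).of_norm
  simp only [BoundedContinuousFunction.evalCLM_apply, BoundedContinuousFunction.smul_apply,
    smul_eq_mul] at h
  rw [← h, synth, ContinuousLinearMap.comp_apply,
    ContinuousLinearMap.compLeftContinuousBounded_apply, LinearMap.mkContinuous_apply]
  rfl

end Synth

/-- The exponentials as bounded continuous functions. -/
def chrB (k : ℤ) : ℝ →ᵇ ℂ :=
  BoundedContinuousFunction.ofNormedAddCommGroup (chr k) (continuous_chr k) 1 fun x => (norm_chr k x).le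

lemma norm_chrB_le (k : ℤ) : ‖chrB k‖ ≤ 2 :=
  (BoundedContinuousFunction.norm_ofNormedAddCommGroup_le _ zero_le_one _).trans one_le_two

/-- `val` as an operator into the bounded continuous functions. -/
def toBCF : Wiener →L[ℝ] (ℝ →ᵇ ℝ) := synth chrB norm_chrB_le

lemma toBCF_apply (u : Wiener) (x : ℝ) : toBCF u x = val u x := synth_apply _ u x

/-- `val` as an operator into `L^∞(𝕋)`. -/
def toLinf : Wiener →L[ℝ] Lp ℝ ⊤ torusMeasure :=
  (BoundedContinuousFunction.toLp ⊤ torusMeasure ℝ).comp toBCF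

lemma coeFn_toLinf (u : Wiener) : toLinf u =ᵐ[torusMeasure] val u := by
  filter_upwards [BoundedContinuousFunction.coeFn_toLp ⊤ torusMeasure ℝ (toBCF u)] with x hx
  rw [← toBCF_apply, ← hx]; rfl

lemma norm_chr_sub_chr_le (k : ℤ) (x y : ℝ) : ‖chr k x - chr k y‖ ≤ |(k : ℝ)| * |x - y| := by
  have h := Convex.norm_image_sub_le_of_norm_hasDerivWithin_le (f := chr k) (s := univ)
    (C := |(k : ℝ)|) (fun x _ => (hasDerivAt_chr k x).hasDerivWithinAt) (fun x _ => by
      rw [norm_mul, norm_mul, norm_chr, Complex.norm_I, Complex.norm_intCast, one_mul, mul_one])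
    convex_univ (mem_univ y) (mem_univ x)
  simpa using h

/-- The Hölder quotients of the exponentials, normalized by the frequency. -/
def holderB (α : ℝ) (h0 : 0 ≤ α) (h1 : α ≤ 1) (k : ℤ) : {p : ℝ × ℝ // p.1 ≠ p.2} →ᵇ ℂ :=
  BoundedContinuousFunction.ofNormedAddCommGroup
    (fun p => (chr k p.1.1 - chr k p.1.2) / (((|p.1.1 - p.1.2| ^ α * |(k : ℝ)| : ℝ)) : ℂ)) (by
      by_cases hk : k = 0
      · subst hk; simpa using continuous_const
      · have hk' : 0 < |(k : ℝ)| := by positivity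
        have hc : Continuous fun p : {p : ℝ × ℝ // p.1 ≠ p.2} => |p.1.1 - p.1.2| ^ α :=
          Continuous.rpow_const (by fun_prop) fun p => .inr h0
        refine Continuous.div (((continuous_chr k).comp (by fun_prop)).sub
          ((continuous_chr k).comp (by fun_prop))) (by fun_prop) fun p => ?_
        have hp : 0 < |p.1.1 - p.1.2| := abs_pos.2 (sub_ne_zero.2 p.2)
        have := Real.rpow_pos_of_pos hp α
        exact_mod_cast (mul_pos this hk').ne') 2 fun p => by
    have hp : 0 < |p.1.1 - p.1.2| := abs_pos.2 (sub_ne_zero.2 p.2)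
    have hpα := Real.rpow_pos_of_pos hp α
    rw [norm_div, Complex.norm_real, Real.norm_of_nonneg (by positivity)]
    by_cases hk : k = 0
    · subst hk; simp
    have hk1 : (1 : ℝ) ≤ |(k : ℝ)| := by exact_mod_cast Int.one_le_abs hk
    rw [div_le_iff₀ (by positivity)]
    rcases le_total |p.1.1 - p.1.2| 1 with h | h
    · refine (norm_chr_sub_chr_le k _ _).trans ?_
      have : |p.1.1 - p.1.2| ≤ |p.1.1 - p.1.2| ^ α := by
        simpa using Real.rpow_le_rpow_of_exponent_ge hp h h1
      have h2 := mul_le_mul_of_nonneg_left this (abs_nonneg (k : ℝ))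
      have h3 : 0 ≤ |p.1.1 - p.1.2| ^ α * |(k : ℝ)| := by positivity
      linarith
    · have h2 : 1 ≤ |p.1.1 - p.1.2| ^ α := Real.one_le_rpow h h0
      have h3 : 1 * 1 ≤ |p.1.1 - p.1.2| ^ α * |(k : ℝ)| := mul_le_mul h2 hk1 zero_le_one (by positivity)
      have h4 := norm_sub_le (chr k p.1.1) (chr k p.1.2)
      rw [norm_chr, norm_chr] at h4
      linarith

lemma norm_holderB_le (α : ℝ) (h0 : 0 ≤ α) (h1 : α ≤ 1) (k : ℤ) : ‖holderB α h0 h1 k‖ ≤ 2 :=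
  BoundedContinuousFunction.norm_ofNormedAddCommGroup_le _ zero_le_two _

lemma holder_apply {α : ℝ} (h0 : 0 ≤ α) (h1 : α ≤ 1) {u w : Wiener}
    (hw : ∀ k : ℤ, w k = ((|(k : ℝ)| : ℝ) : ℂ) * u k) (p : {p : ℝ × ℝ // p.1 ≠ p.2}) :
    synth (holderB α h0 h1) (norm_holderB_le α h0 h1) w p
      = (val u p.1.1 - val u p.1.2) / |p.1.1 - p.1.2| ^ α := by
  rw [synth_apply, val, val, ← Complex.sub_re, ev, ev,
    ← (summable_ev u p.1.1).tsum_sub (summable_ev u p.1.2), ← Complex.div_ofReal_re, ← tsum_div_const]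
  congr 1
  refine tsum_congr fun k => ?_
  change w k * ((chr k p.1.1 - chr k p.1.2) / (((|p.1.1 - p.1.2| ^ α * |(k : ℝ)| : ℝ)) : ℂ)) = _
  rw [hw]
  by_cases hk : k = 0
  · subst hk; simp
  · have hk1 : ((|(k : ℝ)| : ℝ) : ℂ) ≠ 0 := by
      have : (k : ℝ) ≠ 0 := by exact_mod_cast hk
      exact_mod_cast abs_ne_zero.2 this
    push_cast
    field_simp

/-! ### Derivatives -/

lemma integral_chr_mul_deriv {ψ ψ' : ℝ → ℝ} (h : ∀ x, HasDerivAt ψ (ψ' x) x) (hc : Continuous ψ')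
    (hp : Function.Periodic ψ (2 * Real.pi)) (k : ℤ) :
    ∫ x in (-Real.pi)..Real.pi, chr k x * (ψ' x : ℂ)
      = -(Complex.I * k) * ∫ x in (-Real.pi)..Real.pi, chr k x * (ψ x : ℂ) := by
  rw [intervalIntegral.integral_mul_deriv_eq_deriv_mul (u' := fun x => Complex.I * k * chr k x)
    (v := fun x => (ψ x : ℂ)) (fun x _ => hasDerivAt_chr k x) (fun x _ => (h x).ofReal_comp)
    ((continuous_chr k).const_mul _ |>.intervalIntegrable _ _)
    ((Complex.continuous_ofReal.comp hc).intervalIntegrable _ _)]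
  have e1 := chr_periodic k (-Real.pi)
  have e2 := hp (-Real.pi)
  rw [show -Real.pi + 2 * Real.pi = Real.pi by ring] at e1 e2
  rw [e1, e2, sub_self, zero_sub, neg_mul, ← intervalIntegral.integral_const_mul]
  congr 2
  funext x
  ring

lemma periodic_iteratedDeriv {φ : ℝ → ℝ} {c : ℝ} (h : Function.Periodic φ c) (n : ℕ) :
    Function.Periodic (iteratedDeriv n φ) c := fun x => by
  have := iteratedDeriv_comp_add_const n φ c
  rw [funext h] at this
  exact (congrFun this x).symm

lemma integral_chr_mul_iteratedDeriv {φ : ℝ → ℝ} (h : ContDiff ℝ ∞ φ)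
    (hp : Function.Periodic φ (2 * Real.pi)) (k : ℤ) (n : ℕ) :
    ∫ x in (-Real.pi)..Real.pi, chr k x * ((iteratedDeriv n φ x : ℝ) : ℂ)
      = (-1) ^ n * ((Complex.I * k) ^ n * ∫ x in (-Real.pi)..Real.pi, chr k x * (φ x : ℂ)) := by
  induction n with
  | zero => simp
  | succ n ih =>
    rw [integral_chr_mul_deriv (ψ := iteratedDeriv n φ) (fun x => ?_)
      (h.continuous_iteratedDeriv _ (by exact_mod_cast le_top)) (periodic_iteratedDeriv hp n), ih]
    · ring
    · rw [iteratedDeriv_succ]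
      exact ((h.differentiable_iteratedDeriv n (by exact_mod_cast ENat.natCast_lt_top n)) x).hasDerivAt

lemma integral_val_mul (u : Wiener) {ψ : ℝ → ℝ} (hψ : Continuous ψ) :
    ∫ x in (-Real.pi)..Real.pi, val u x * ψ x
      = (∫ x in (-Real.pi)..Real.pi, ev u x * (ψ x : ℂ)).re := by
  have hc : Continuous fun x => ev u x * (ψ x : ℂ) := by
    have := continuous_ev u
    fun_prop
  rw [← Complex.reCLM_apply, ← Complex.reCLM.intervalIntegral_comp_comm (hc.intervalIntegrable _ _)]
  simp [val]

/-- Weak derivatives on the side of the Fourier coefficients. -/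
lemma hasWeakDeriv_val {n : ℕ} {u w : Wiener} (h : ∀ k : ℤ, w k = (Complex.I * k) ^ n * u k) :
    HasWeakDeriv n (val u) (val w) := by
  refine ⟨(memLp_val u 1).integrable le_rfl, (memLp_val w 1).integrable le_rfl, fun φ hφ hp => ?_⟩
  have hc := hφ.continuous
  have hcn : Continuous (iteratedDeriv n φ) := hφ.continuous_iteratedDeriv _ (by exact_mod_cast le_top)
  have h1 := u.hasSum_integral_ev_mul (Complex.continuous_ofReal.comp hcn)
  have h2 := (w.hasSum_integral_ev_mul (Complex.continuous_ofReal.comp hc)).mul_left ((-1) ^ n)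
  simp only [Function.comp_apply] at h1
  simp only [Function.comp_apply] at h2
  have h3 := h1.unique (h2.congr_fun fun k => by rw [integral_chr_mul_iteratedDeriv hφ hp, h]; ring)
  rw [integral_val_mul u hcn, integral_val_mul w hc, h3]
  have : ((-1 : ℂ) ^ n) = (((-1 : ℝ) ^ n : ℝ) : ℂ) := by push_cast; rfl
  rw [this, Complex.re_ofReal_mul]

lemma _root_.ThinFilm.HasWeakDeriv.congr {n : ℕ} {u v u' v' : ℝ → ℝ} (h : HasWeakDeriv n u v)
    (hu : u' =ᵐ[torusMeasure] u) (hv : v' =ᵐ[torusMeasure] v) : HasWeakDeriv n u' v' := by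
  refine ⟨h.1.congr hu.symm, h.2.1.congr hv.symm, fun φ hφ hp => ?_⟩
  have := h.2.2 φ hφ hp
  simp only [intervalIntegral_eq_torus] at this ⊢
  have e1 : ∫ x, u' x * iteratedDeriv n φ x ∂torusMeasure
      = ∫ x, u x * iteratedDeriv n φ x ∂torusMeasure :=
    integral_congr_ae (hu.mono fun x hx => by simp only [hx])
  have e2 : ∫ x, v' x * φ x ∂torusMeasure = ∫ x, v x * φ x ∂torusMeasure :=
    integral_congr_ae (hv.mono fun x hx => by simp only [hx])
  rw [e1, e2, this]

lemma hasWeakDeriv_toLinf {n : ℕ} {u w : Wiener} (h : ∀ k : ℤ, w k = (Complex.I * k) ^ n * u k) :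
    HasWeakDeriv n (toLinf u) (toLinf w) :=
  (hasWeakDeriv_val h).congr (coeFn_toLinf u) (coeFn_toLinf w)

lemma hasDerivAt_val {u w : Wiener} (h : ∀ k : ℤ, w k = (Complex.I * k) * u k) (x : ℝ) :
    HasDerivAt (val u) (val w x) x := by
  have := hasDerivAt_tsum (u := fun k => ‖w k‖) (g := fun k x => u k * chr k x)
    (g' := fun k x => w k * chr k x) (y₀ := 0) w.summable_norm
    (fun k y => by
      refine ((hasDerivAt_chr k y).const_mul (u k)).congr_deriv ?_
      rw [h]; ring)
    (fun k y => by rw [norm_mul, norm_chr, mul_one]) (summable_ev u 0) x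
  exact Complex.reCLM.hasFDerivAt.comp_hasDerivAt x this

lemma norm_isym (j : ℕ) (k : ℤ) : ‖(Complex.I * k : ℂ) ^ j‖ = |(k : ℝ)| ^ j := by
  simp [norm_pow, Complex.norm_intCast]

lemma norm_isym_le {j m : ℕ} (hj : j ≤ m) (k : ℤ) (hk : k ≠ 0) :
    ‖(Complex.I * k : ℂ) ^ j‖ ≤ |(k : ℝ)| ^ m := by
  rw [norm_isym]
  have hk1 : (1 : ℝ) ≤ |(k : ℝ)| := by exact_mod_cast Int.one_le_abs hk
  exact pow_le_pow_right₀ hk1 hj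

/-- The derivatives of a function with `m + 1` absolutely convergent derivatives. -/
lemma iteratedDeriv_val {m : ℕ} {u : Wiener} (h : WS (m + 1) u) (h0 : u 0 = 0) {j : ℕ}
    (hj : j ≤ m + 1) :
    iteratedDeriv j (val u) = val (fmul (fun k : ℤ => (Complex.I * k : ℂ) ^ j) u) := by
  have hs : ∀ j ≤ m + 1, Summable fun k : ℤ => ‖(Complex.I * k : ℂ) ^ j * u k‖ := fun j hj =>
    h.summable_symbol (norm_isym_le hj) h0
  induction j with
  | zero =>
    rw [iteratedDeriv_zero]
    congr 1
    ext k
    rw [fmul_apply (hs 0 hj)]; simp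
  | succ j ih =>
    rw [iteratedDeriv_succ, ih (by lia)]
    funext x
    refine (hasDerivAt_val (fun k => ?_) x).deriv
    rw [fmul_apply (hs _ hj), fmul_apply (hs j (by lia))]
    ring

lemma contDiff_val {m : ℕ} {u : Wiener} (h : WS (m + 1) u) (h0 : u 0 = 0) :
    ContDiff ℝ m (val u) := by
  have hs : ∀ j ≤ m + 1, Summable fun k : ℤ => ‖(Complex.I * k : ℂ) ^ j * u k‖ := fun j hj =>
    h.summable_symbol (norm_isym_le hj) h0
  refine contDiff_nat_iff_iteratedDeriv.2 ⟨fun j hj => ?_, fun j hj => ?_⟩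
  · rw [iteratedDeriv_val h h0 (by lia)]; exact continuous_val _
  · rw [iteratedDeriv_val h h0 (by lia)]
    intro x
    refine (hasDerivAt_val (w := fmul (fun k : ℤ => (Complex.I * k : ℂ) ^ (j + 1)) u)
      (fun k => ?_) x).differentiableAt
    rw [fmul_apply (hs _ (by lia)), fmul_apply (hs j (by lia))]
    ring

end Wiener

open Wiener

namespace Wiener.IsPath

/-! ### Regularity of a path -/

variable {m : ℕ} {M T : ℝ} {u : ℝ → Wiener}

lemma continuous_uncurry_val (h : IsPath m M u) :
    Continuous (Function.uncurry fun t => val (u t)) := by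
  have h1 : Continuous fun p : ℝ × ℝ => toBCF (u p.1) p.2 := by
    have : Continuous fun p : ℝ × ℝ => toBCF (u p.1) :=
      toBCF.continuous.comp (h.cont.comp continuous_fst)
    exact this.eval continuous_snd
  simp only [toBCF_apply] at h1
  exact h1

lemma memLinfty (h : IsPath m M u) : MemLinfty T fun t => val (u t) :=
  MemLp.of_bound h.continuous_uncurry_val.aestronglyMeasurable M
    (.of_forall fun p => (abs_val_le _ _).trans (h.norm_le p.1))

/-- The weighted `ℓ¹` norm of order `m` is controlled by the `ℓ²` norm of order `m + 1`. -/
lemma norm_fmul_sq_le {v : Wiener} (h0 : v 0 = 0)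
    (hs : Summable fun k : ℤ => |(k : ℝ)| ^ (2 * (m + 1)) * ‖v k‖ ^ 2) {c : ℤ → ℂ}
    (hc : ∀ k ≠ 0, ‖c k‖ ≤ |(k : ℝ)| ^ m) :
    ‖fmul c v‖ ^ 2 ≤ (∑' k : ℤ, 1 / (k : ℝ) ^ 2)
      * ∑' k : ℤ, |(k : ℝ)| ^ (2 * (m + 1)) * ‖v k‖ ^ 2 := by
  set Z := ∑' k : ℤ, 1 / (k : ℝ) ^ 2
  set X := ∑' k : ℤ, |(k : ℝ)| ^ (2 * (m + 1)) * ‖v k‖ ^ 2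
  have hX : 0 ≤ X := tsum_nonneg fun _ => by positivity
  have hZ : 0 ≤ Z := tsum_nonneg fun _ => by positivity
  have key : ‖fmul c v‖ ≤ √Z * √X := by
    rw [fmul]
    split_ifs with h
    swap
    · rw [norm_zero]; positivity
    refine norm_le_of_sum_le fun S => ?_
    calc ∑ k ∈ S, ‖c k * v k‖ ≤ ∑ k ∈ S, 1 / |(k : ℝ)| * (|(k : ℝ)| ^ (m + 1) * ‖v k‖) := by
          refine Finset.sum_le_sum fun k _ => ?_
          by_cases hk : k = 0
          · subst hk; simp [h0]
          · have hk1 : 0 < |(k : ℝ)| := abs_pos.2 (by exact_mod_cast hk)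
            rw [norm_mul, ← mul_assoc]
            refine mul_le_mul_of_nonneg_right ((hc k hk).trans_eq ?_) (norm_nonneg _)
            rw [pow_succ]; field_simp
      _ ≤ √(∑ k ∈ S, (1 / |(k : ℝ)|) ^ 2) * √(∑ k ∈ S, (|(k : ℝ)| ^ (m + 1) * ‖v k‖) ^ 2) :=
          Real.sum_mul_le_sqrt_mul_sqrt _ _ _
      _ ≤ √Z * √X := by
          refine mul_le_mul (Real.sqrt_le_sqrt ?_) (Real.sqrt_le_sqrt ?_) (Real.sqrt_nonneg _)
            (Real.sqrt_nonneg _)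
          · refine le_of_eq_of_le (Finset.sum_congr rfl fun k _ => ?_)
              (summable_inv_int_sq.sum_le_tsum S fun _ _ => by positivity)
            rw [div_pow, one_pow, sq_abs]
          · refine le_of_eq_of_le (Finset.sum_congr rfl fun k _ => ?_)
              (hs.sum_le_tsum S fun _ _ => by positivity)
            rw [mul_pow, ← pow_mul, mul_comm (m + 1)]
  calc ‖fmul c v‖ ^ 2 ≤ (√Z * √X) ^ 2 := by gcongr
    _ = Z * X := by rw [mul_pow, Real.sq_sqrt hZ, Real.sq_sqrt hX]

lemma ae_summable_isym (h : IsPath m M u) {j : ℕ} (hj : j ≤ m + 1) (T : ℝ) :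
    ∀ᵐ t ∂volume.restrict (Ioo 0 T), Summable fun k : ℤ => ‖(Complex.I * k : ℂ) ^ j * u t k‖ :=
  (h.integrable_wt T).1.mono fun t ht => ht.summable_symbol (norm_isym_le hj) (h.zero t)

/-- The `L²` in time bound suffices, since the exponent `(ζ + 1) / ζ` is at most `2`. -/
lemma memLqWinfty (h : IsPath m M u) {q : ℝ≥0∞} (hq : q ≤ 2) :
    MemLqWinfty T q m fun t => val (u t) := by
  have hc := norm_isym_le (le_refl m)
  have hi := h.integrable_fmul (norm_isym_le (Nat.le_succ m)) T
  obtain ⟨e1, e2, -⟩ := h.integrable_en T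
  refine ⟨fun t => toLinf (u t), fun t => toLinf (fmul (fun k : ℤ => (Complex.I * k : ℂ) ^ m) (u t)),
    ?_, ?_, ?_⟩
  · exact MemLp.of_bound (toLinf.continuous.comp h.cont).aestronglyMeasurable (‖toLinf‖ * M)
      (.of_forall fun t => toLinf.le_opNorm_of_le (h.norm_le t))
  · refine MemLp.mono_exponent (q := 2) ?_ hq
    have hm := toLinf.continuous.comp_aestronglyMeasurable hi.1
    refine (memLp_two_iff_integrable_sq_norm hm).2 ((e2.const_mul (‖toLinf‖ ^ 2 * ∑' k : ℤ,
      1 / (k : ℝ) ^ 2)).mono' (hm.norm.pow 2) ?_)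
    filter_upwards [e1] with t ht
    rw [norm_pow, norm_norm]
    calc _ ≤ (‖toLinf‖ * ‖fmul (fun k : ℤ => (Complex.I * k : ℂ) ^ m) (u t)‖) ^ 2 := by
          have := toLinf.le_opNorm (fmul (fun k : ℤ => (Complex.I * k : ℂ) ^ m) (u t))
          gcongr
      _ ≤ _ := by
          rw [mul_pow, mul_assoc]
          exact mul_le_mul_of_nonneg_left (norm_fmul_sq_le (h.zero t) ht hc) (by positivity)
  · filter_upwards [h.ae_summable_isym (Nat.le_succ m) T] with t ht
    exact ⟨(coeFn_toLinf _).symm, hasWeakDeriv_toLinf fun k => fmul_apply ht k⟩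

lemma memL1Holder (h : IsPath m M u) {α : ℝ} (h0 : 0 ≤ α) (h1 : α ≤ 1) :
    MemL1Holder T m α fun t => val (u t) := by
  have hc : ∀ k : ℤ, k ≠ 0 → ‖((|(k : ℝ)| : ℝ) : ℂ) * (Complex.I * k : ℂ) ^ m‖ ≤ |(k : ℝ)| ^ (m + 1) :=
    fun k _ => by
    rw [norm_mul, norm_isym, Complex.norm_real, Real.norm_of_nonneg (abs_nonneg _), pow_succ, mul_comm]
  refine ⟨fun t => val (u t), fun j t => toBCF (fmul (fun k : ℤ => (Complex.I * k : ℂ) ^ j) (u t)),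
    fun t => synth (holderB α h0 h1) (norm_holderB_le α h0 h1)
      (fmul (fun k : ℤ => ((|(k : ℝ)| : ℝ) : ℂ) * (Complex.I * k : ℂ) ^ m) (u t)), fun j hj => ?_, ?_, ?_⟩
  · rw [memLp_one_iff_integrable]
    exact toBCF.integrable_comp (h.integrable_fmul (norm_isym_le (hj.trans (Nat.le_succ m))) T)
  · rw [memLp_one_iff_integrable]
    exact (synth (holderB α h0 h1) (norm_holderB_le α h0 h1)).integrable_comp (h.integrable_fmul hc T)
  · filter_upwards [(h.integrable_wt T).1] with t ht
    refine ⟨.rfl, val_periodic _, contDiff_val ht (h.zero t), fun j hj x => ?_, fun p => ?_⟩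
    · rw [toBCF_apply, iteratedDeriv_val ht (h.zero t) (by lia)]
    · rw [iteratedDeriv_val ht (h.zero t) (Nat.le_succ m)]
      refine holder_apply h0 h1 (fun k => ?_) p
      rw [fmul_apply (ht.summable_symbol hc (h.zero t)), fmul_apply (ht.summable_symbol
        (norm_isym_le (Nat.le_succ m)) (h.zero t))]
      ring

lemma val_integral {B : Set ℝ} (hu : IntegrableOn u B) (x : ℝ) :
    val (∫ t in B, u t) x = ∫ t in B, val (u t) x := by
  have := ((BoundedContinuousFunction.evalCLM ℝ x).comp toBCF).integral_comp_comm hu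
  simp only [ContinuousLinearMap.comp_apply, BoundedContinuousFunction.evalCLM_apply,
    toBCF_apply] at this
  exact this.symm

lemma memMeasWinfty (h : IsPath m M u) : MemMeasWinfty T (m + 1) fun t => val (u t) := by
  set w := fun t => fmul (fun k : ℤ => (Complex.I * k : ℂ) ^ (m + 1)) (u t) with hw
  have iu : IntegrableOn u (Icc 0 T) := h.cont.integrableOn_Icc
  have iw : IntegrableOn w (Icc 0 T) :=
    (integrableOn_Icc_iff_integrableOn_Ioo (by simp) (by simp)).2 (h.integrable_fmul (norm_isym_le le_rfl) T)
  have hfin : ∀ v : ℝ → Wiener, IntegrableOn v (Icc 0 T) →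
      ((volume.restrict (Icc 0 T)).withDensityᵥ fun t => toLinf (v t)).variation (Icc 0 T) < ⊤ :=
    fun v hv => by
    have hi := toLinf.integrable_comp hv
    rw [Measure.variation_withDensityᵥ hi]
    refine (measure_mono (subset_univ _)).trans_lt ?_
    rw [withDensity_apply _ MeasurableSet.univ, Measure.restrict_univ]
    exact hi.hasFiniteIntegral
  refine ⟨(volume.restrict (Icc 0 T)).withDensityᵥ fun t => toLinf (u t),
    (volume.restrict (Icc 0 T)).withDensityᵥ fun t => toLinf (w t), hfin u iu, hfin w iw,
    fun B hB hBT => ?_⟩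
  have hval : ∀ v : ℝ → Wiener, IntegrableOn v (Icc 0 T) →
      (volume.restrict (Icc 0 T)).withDensityᵥ (fun t => toLinf (v t)) B
        = toLinf (∫ t in B, v t) := fun v hv => by
    rw [withDensityᵥ_apply (toLinf.integrable_comp hv) hB, Measure.restrict_restrict hB,
      inter_eq_self_of_subset_left hBT]
    exact toLinf.integral_comp_comm (hv.mono_set hBT)
  rw [hval u iu, hval w iw]
  constructor
  · simp_rw [← val_integral (iu.mono_set hBT)]
    exact (coeFn_toLinf _).symm
  · refine hasWeakDeriv_toLinf fun k => ?_
    have e1 := ((coeffL k).restrictScalars ℝ).integral_comp_comm (iw.mono_set hBT)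
    have e2 := ((coeffL k).restrictScalars ℝ).integral_comp_comm (iu.mono_set hBT)
    change ∫ t in B, w t k = (∫ t in B, w t) k at e1
    change ∫ t in B, u t k = (∫ t in B, u t) k at e2
    rw [← e1, ← e2, ← integral_const_mul]
    have hae : ∀ᵐ t ∂volume.restrict (Icc 0 T),
        Summable fun k : ℤ => ‖(Complex.I * k : ℂ) ^ (m + 1) * u t k‖ := by
      rw [← Measure.restrict_congr_set Ioo_ae_eq_Icc]
      exact h.ae_summable_isym le_rfl T
    exact integral_congr_ae ((ae_restrict_of_ae_restrict_of_subset hBT hae).mono fun t ht =>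
      fmul_apply ht k)

lemma memL2Hdot (h : IsPath m M u) {α : ℝ} {p : ℕ} (hα : 2 * α = p) {C : ℝ}
    (hC : ∀ S : Finset ℤ, ∫ t in Ioo 0 T, ∑ k ∈ S, |(k : ℝ)| ^ p * ‖u t k‖ ^ 2 ≤ C) :
    MemL2Hdot T α (fun t => val (u t)) ∧ ∫ t in Ioo 0 T, hSq α (val (u t)) ≤ C := by
  obtain ⟨e1, e2, e3⟩ := integrable_tsum_of_sum_le (μ := volume.restrict (Ioo 0 T))
    (F := fun (k : ℤ) t => |(k : ℝ)| ^ p * ‖u t k‖ ^ 2)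
    (fun k => by
      have := h.continuous_coeff k
      exact ((by fun_prop : Continuous fun t => |(k : ℝ)| ^ p * ‖u t k‖ ^ 2
        ).integrableOn_Icc (a := 0) (b := T)).mono_set Ioo_subset_Icc_self)
    (fun _ _ => by positivity) hC
  refine ⟨⟨fun k => ?_, ?_, ?_⟩, ?_⟩
  · simp only [fc_val (h.real _)]
    exact (h.continuous_coeff k).aestronglyMeasurable
  · filter_upwards [e1] with t ht using memHdot_val (h.real t) (h.zero t) hα ht
  · simp only [hSq_val (h.real _) hα]
    exact e2
  · simpa only [hSq_val (h.real _) hα] using e3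

lemma summable_energy (h : IsPath m M u) (t : ℝ) :
    Summable fun k : ℤ => |(k : ℝ)| ^ (m + 1) * ‖u t k‖ ^ 2 :=
  summable_of_sum_le (fun _ => by positivity) fun S => h.energy S fun _ => t

lemma tsum_energy_le (h : IsPath m M u) (t : ℝ) :
    ∑' k : ℤ, |(k : ℝ)| ^ (m + 1) * ‖u t k‖ ^ 2 ≤ M :=
  (h.summable_energy t).tsum_le_of_sum_le fun S => h.energy S fun _ => t

lemma sum_energy_integral_le (h : IsPath m M u) (hT : 0 ≤ T) (S : Finset ℤ) :
    ∫ t in Ioo 0 T, ∑ k ∈ S, |(k : ℝ)| ^ (m + 1) * ‖u t k‖ ^ 2 ≤ M * T := by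
  have := setIntegral_mono_on (μ := volume) (s := Ioo 0 T)
    (f := fun t => ∑ k ∈ S, |(k : ℝ)| ^ (m + 1) * ‖u t k‖ ^ 2) (g := fun _ => M) ?_ (by simp)
    measurableSet_Ioo fun t _ => h.energy S fun _ => t
  · refine this.trans_eq ?_
    rw [setIntegral_const, Measure.real, Real.volume_Ioo, sub_zero, ENNReal.toReal_ofReal hT,
      smul_eq_mul, mul_comm]
  · have := h.continuous_coeff
    exact (by fun_prop : Continuous fun t => ∑ k ∈ S, |(k : ℝ)| ^ (m + 1) * ‖u t k‖ ^ 2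
      ).integrableOn_Icc.mono_set Ioo_subset_Icc_self

/-- The supremum over time of every single mode still has finite energy. -/
lemma summable_iSup (h : IsPath m M u) :
    Summable fun k : ℤ => |(k : ℝ)| ^ (m + 1) * ⨆ t, ‖u t k‖ ^ 2 := by
  have hbdd : ∀ k, BddAbove (range fun t => ‖u t k‖ ^ 2) := fun k => ⟨M ^ 2, by
    rintro _ ⟨t, rfl⟩
    have := (norm_apply_le _ k).trans (h.norm_le t)
    simp only
    gcongr⟩
  have hex : ∀ k, ∃ τ, ⨆ t, ‖u t k‖ ^ 2 ≤ 2 * ‖u τ k‖ ^ 2 := fun k => by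
    rcases (Real.iSup_nonneg fun t => sq_nonneg ‖u t k‖).eq_or_lt with h0 | hpos
    · exact ⟨0, by rw [← h0]; positivity⟩
    · obtain ⟨τ, hτ⟩ := exists_lt_of_lt_ciSup (half_lt_self hpos)
      exact ⟨τ, by linarith⟩
  choose τ hτ using hex
  refine summable_of_sum_le (c := 2 * M)
    (fun k => mul_nonneg (by positivity) (Real.iSup_nonneg fun t => sq_nonneg _)) fun S => ?_
  have := h.energy S τ
  calc _ ≤ ∑ k ∈ S, 2 * (|(k : ℝ)| ^ (m + 1) * ‖u (τ k) k‖ ^ 2) :=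
        Finset.sum_le_sum fun k _ => by
          have := mul_le_mul_of_nonneg_left (hτ k) (by positivity : 0 ≤ |(k : ℝ)| ^ (m + 1))
          linarith
    _ ≤ 2 * M := by rw [← Finset.mul_sum]; linarith

lemma memCHdot (h : IsPath m M u) {α : ℝ} (hα : 2 * α = (m + 1 : ℕ)) :
    MemCHdot T α fun t => val (u t) := by
  refine ⟨fun t _ => memHdot_val (h.real t) (h.zero t) hα (h.summable_energy t), fun t₀ _ => ?_⟩
  have hreal : ∀ t, IsReal (u t - u t₀) := fun t k => by
    rw [sub_apply, sub_apply, h.real t, h.real t₀, map_sub]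
  have hbdd : ∀ k, BddAbove (range fun t => ‖u t k‖ ^ 2) := fun k => ⟨M ^ 2, by
    rintro _ ⟨t, rfl⟩
    have := (norm_apply_le _ k).trans (h.norm_le t)
    simp only
    gcongr⟩
  have hfun : ∀ t, (fun x => val (u t) x - val (u t₀) x) = val (u t - u t₀) := fun t =>
    funext fun x => (val_sub _ _ x).symm
  simp only [hfun, hSq_val (hreal _) hα]
  refine Tendsto.mono_left ?_ nhdsWithin_le_nhds
  have h0 : (0 : ℝ) = ∑' k : ℤ, |(k : ℝ)| ^ (m + 1) * ‖(u t₀ - u t₀) k‖ ^ 2 := by simp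
  rw [h0]
  refine tendsto_tsum_of_dominated_convergence (h.summable_iSup.mul_left 4) (fun k => ?_)
    (.of_forall fun t k => ?_)
  · have := h.continuous_coeff k
    have hc : Continuous fun t => |(k : ℝ)| ^ (m + 1) * ‖(u t - u t₀) k‖ ^ 2 := by
      simp only [sub_apply]; fun_prop
    exact hc.tendsto t₀
  · rw [Real.norm_of_nonneg (by positivity), sub_apply]
    have h1 := le_ciSup (hbdd k) t
    have h2 := le_ciSup (hbdd k) t₀
    have h3 : ‖u t k - u t₀ k‖ ^ 2 ≤ 4 * ⨆ t, ‖u t k‖ ^ 2 := by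
      have := norm_sub_le (u t k) (u t₀ k)
      calc ‖u t k - u t₀ k‖ ^ 2 ≤ (‖u t k‖ + ‖u t₀ k‖) ^ 2 := by gcongr
        _ ≤ 2 * (‖u t k‖ ^ 2 + ‖u t₀ k‖ ^ 2) := add_sq_le
        _ ≤ _ := by linarith
    calc _ ≤ |(k : ℝ)| ^ (m + 1) * (4 * ⨆ t, ‖u t k‖ ^ 2) := by gcongr
      _ = _ := by ring

/-- Interpolation between the decay of the Wiener norm and the energy bound. -/
lemma hSq_le_exp (h : IsPath m M u) {ε a t s : ℝ} (hε : 0 < ε) (ht : 0 ≤ t) (hs : 0 ≤ s)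
    (hsm : s < ((m : ℝ) + 1) / 2) (ha : ‖u t‖ ≤ a * Real.exp (-(ε * t))) :
    hSq s (val (u t)) ≤ (a ^ 2 + M) * Real.exp (-(ε * (1 - 2 * s / (m + 1)) * t)) := by
  set θ := 2 * s / ((m : ℝ) + 1) with hθ
  have hm1 : (0 : ℝ) < m + 1 := by positivity
  have hθ0 : 0 ≤ θ := by positivity
  have hθ1 : θ < 1 := by rw [hθ, div_lt_one hm1]; linarith
  have hsθ : 2 * s = θ * (m + 1) := by rw [hθ]; field_simp
  have hM : 0 ≤ M := (norm_nonneg _).trans (h.norm_le 0)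
  -- the threshold frequency `N` satisfies `N ^ (m + 1) = exp (ε t)`
  have key : ∀ k : ℤ, |(k : ℝ)| ^ (2 * s) * ‖fc (val (u t)) k‖ ^ 2
      ≤ Real.exp (ε * t * θ) * ‖u t k‖ ^ 2
        + Real.exp (ε * t * (θ - 1)) * (|(k : ℝ)| ^ (m + 1) * ‖u t k‖ ^ 2) := fun k => by
    rw [fc_val (h.real t), ← mul_assoc, ← add_mul]
    by_cases hk : k = 0
    · subst hk; simp [h.zero t]
    refine mul_le_mul_of_nonneg_right ?_ (by positivity)
    have hkp : 0 < |(k : ℝ)| := abs_pos.2 (by exact_mod_cast hk)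
    have hpow : |(k : ℝ)| ^ (2 * s) = (|(k : ℝ)| ^ (m + 1)) ^ θ := by
      rw [hsθ, mul_comm, Real.rpow_mul hkp.le, ← Nat.cast_add_one, Real.rpow_natCast]
    rw [hpow]
    set X := |(k : ℝ)| ^ (m + 1) with hX
    have hX0 : 0 < X := by positivity
    rcases le_total X (Real.exp (ε * t)) with hle | hle
    · have h1 : X ^ θ ≤ Real.exp (ε * t) ^ θ := Real.rpow_le_rpow hX0.le hle hθ0
      rw [← Real.exp_mul] at h1
      have : 0 ≤ Real.exp (ε * t * (θ - 1)) * X := by positivity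
      linarith
    · have h1 : X ^ (θ - 1) ≤ Real.exp (ε * t) ^ (θ - 1) :=
        Real.rpow_le_rpow_of_nonpos (Real.exp_pos _) hle (by linarith)
      rw [← Real.exp_mul] at h1
      have h2 : X ^ θ = X ^ (θ - 1) * X := by
        rw [← Real.rpow_add_one hX0.ne']; congr 1; ring
      rw [h2]
      have h3 := mul_le_mul_of_nonneg_right h1 hX0.le
      have : 0 ≤ Real.exp (ε * t * θ) := (Real.exp_pos _).le
      linarith
  have hsq : ∀ S : Finset ℤ, ∑ k ∈ S, ‖u t k‖ ^ 2 ≤ ‖u t‖ ^ 2 := fun S =>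
    (Finset.sum_sq_le_sq_sum_of_nonneg fun _ _ => norm_nonneg _).trans
      (pow_le_pow_left₀ (Finset.sum_nonneg fun _ _ => norm_nonneg _) ((u t).sum_norm_le S) 2)
  refine tsum_le_of_sum_le' (by positivity) fun S => ?_
  refine (Finset.sum_le_sum fun k _ => key k).trans ?_
  rw [Finset.sum_add_distrib, ← Finset.mul_sum, ← Finset.mul_sum, add_mul]
  refine add_le_add ?_ ?_
  · have h1 : ‖u t‖ ^ 2 ≤ (a * Real.exp (-(ε * t))) ^ 2 := by gcongr
    calc _ ≤ Real.exp (ε * t * θ) * (a * Real.exp (-(ε * t))) ^ 2 :=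
          mul_le_mul_of_nonneg_left ((hsq S).trans h1) (Real.exp_pos _).le
      _ = a ^ 2 * Real.exp (ε * t * θ - ε * t - ε * t) := by
          rw [mul_pow, ← Real.exp_nat_mul, mul_left_comm, ← Real.exp_add]
          congr 2; push_cast; ring
      _ ≤ _ := by
          refine mul_le_mul_of_nonneg_left (Real.exp_le_exp.2 ?_) (by positivity)
          have := mul_nonneg hε.le ht
          linarith
  · rw [mul_comm]
    refine mul_le_mul (h.energy S fun _ => t) (Real.exp_le_exp.2 (by linarith)) (Real.exp_pos _).le hM

end Wiener.IsPath

open Wiener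

/-! ### From the equations of the modes to the weak formulation -/

/-- The Fourier modes of a time dependent test function. -/
def moment (ψ : ℝ → ℝ → ℝ) (k : ℤ) (t : ℝ) : ℂ :=
  ∫ x in (-Real.pi)..Real.pi, chr k x * (ψ t x : ℂ)

lemma continuous_moment {ψ : ℝ → ℝ → ℝ} (h : Continuous (Function.uncurry ψ)) (k : ℤ) :
    Continuous (moment ψ k) := by
  refine intervalIntegral.continuous_parametric_intervalIntegral_of_continuous' ?_ _ _
  exact ((continuous_chr k).comp continuous_snd).mul (Complex.continuous_ofReal.comp h)

lemma exists_norm_moment_le {ψ : ℝ → ℝ → ℝ} (h : Continuous (Function.uncurry ψ)) (T : ℝ) :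
    ∃ K : ℝ, ∀ k, ∀ t ∈ Icc 0 T, ‖moment ψ k t‖ ≤ K := by
  obtain ⟨K, hK⟩ := ((isCompact_Icc (a := (0 : ℝ)) (b := T)).prod
    (isCompact_Icc (a := -Real.pi) (b := Real.pi))).exists_bound_of_continuousOn h.continuousOn
  refine ⟨K * |Real.pi - -Real.pi|, fun k t ht => ?_⟩
  refine intervalIntegral.norm_integral_le_of_norm_le_const fun x hx => ?_
  rw [uIoc_of_le (by linarith [Real.pi_pos])] at hx
  rw [norm_mul, norm_chr, one_mul, Complex.norm_real]
  exact hK (t, x) ⟨ht, hx.1.le, hx.2⟩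

lemma hasDerivAt_moment {φ φ' : ℝ → ℝ → ℝ} (h : ∀ t x, HasDerivAt (fun s => φ s x) (φ' t x) t)
    (hc : Continuous (Function.uncurry φ)) (hc' : Continuous (Function.uncurry φ')) (k : ℤ) (t : ℝ) :
    HasDerivAt (moment φ k) (moment φ' k t) t := by
  obtain ⟨K, hK⟩ := ((isCompact_closedBall t 1).prod
    (isCompact_Icc (a := -Real.pi) (b := Real.pi))).exists_bound_of_continuousOn hc'.continuousOn
  have hcont : ∀ {ψ : ℝ → ℝ → ℝ}, Continuous (Function.uncurry ψ) → ∀ s,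
      Continuous fun x => chr k x * (ψ s x : ℂ) := fun hψ s =>
    (continuous_chr k).mul (Complex.continuous_ofReal.comp (hψ.comp (.prodMk_right s)))
  refine (intervalIntegral.hasDerivAt_integral_of_dominated_loc_of_deriv_le
    (F := fun s x => chr k x * (φ s x : ℂ)) (F' := fun s x => chr k x * (φ' s x : ℂ))
    (bound := fun _ => K) (Metric.closedBall_mem_nhds t one_pos)
    (.of_forall fun s => (hcont hc s).aestronglyMeasurable) ((hcont hc t).intervalIntegrable _ _)
    (hcont hc' t).aestronglyMeasurable (.of_forall fun x hx s hs => ?_) (by simp)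
    (.of_forall fun x _ s _ => (h s x).ofReal_comp.const_mul _)).2
  rw [uIoc_of_le (by linarith [Real.pi_pos])] at hx
  rw [norm_mul, norm_chr, one_mul, Complex.norm_real]
  exact hK (s, x) ⟨hs, hx.1.le, hx.2⟩

/-- Integration in time and space of a function with values in the Wiener algebra, term by term. -/
lemma hasSum_integral_integral {w : ℝ → Wiener} {T : ℝ} (hw : IntegrableOn w (Ioo 0 T))
    {ψ : ℝ → ℝ → ℝ} (hψ : Continuous (Function.uncurry ψ)) :
    HasSum (fun k => (∫ t in Ioo 0 T, w t k * moment ψ k t).re)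
      (∫ t in Ioo 0 T, ∫ x in (-Real.pi)..Real.pi, val (w t) x * ψ t x) := by
  obtain ⟨K, hK⟩ := exists_norm_moment_le hψ T
  have hint : ∀ k, IntegrableOn (fun t => w t k * moment ψ k t) (Ioo 0 T) := fun k => by
    simpa using FluxPair.integrable_mul (continuous_moment hψ k) hw k 1
  have hnorm : ∀ k, IntegrableOn (fun t => ‖w t k‖) (Ioo 0 T) := fun k =>
    ((coeffL k).integrable_comp hw).norm
  have hs : Summable fun k : ℤ => ∫ t in Ioo 0 T, ‖(w t k * moment ψ k t).re‖ := by
    refine summable_of_sum_le (c := (∫ t in Ioo 0 T, ‖w t‖) * |K|)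
      (fun k => integral_nonneg fun _ => norm_nonneg _) fun S => ?_
    calc ∑ k ∈ S, ∫ t in Ioo 0 T, ‖(w t k * moment ψ k t).re‖
        ≤ ∑ k ∈ S, ∫ t in Ioo 0 T, ‖w t k‖ * |K| := by
          refine Finset.sum_le_sum fun k _ => setIntegral_mono_on (hint k).re.norm
            ((hnorm k).mul_const _) measurableSet_Ioo fun t ht => ?_
          refine (Complex.abs_re_le_norm _).trans ?_
          rw [norm_mul]
          exact mul_le_mul_of_nonneg_left ((hK k t (Ioo_subset_Icc_self ht)).trans (le_abs_self K))
            (norm_nonneg _)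
      _ = (∫ t in Ioo 0 T, ∑ k ∈ S, ‖w t k‖) * |K| := by
          rw [integral_finsetSum _ fun k _ => hnorm k, Finset.sum_mul]
          simp_rw [integral_mul_const]
      _ ≤ _ := by
          refine mul_le_mul_of_nonneg_right (setIntegral_mono (integrable_finsetSum _ fun k _ =>
            hnorm k) hw.norm fun t => (w t).sum_norm_le S) (abs_nonneg _)
  have key := hasSum_integral_of_summable_integral_norm
    (F := fun k t => (w t k * moment ψ k t).re) (fun k => (hint k).re) hs
  have e1 : ∀ t, ∑' k, (w t k * moment ψ k t).re
      = ∫ x in (-Real.pi)..Real.pi, val (w t) x * ψ t x := fun t => by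
    have hc : Continuous (ψ t) := hψ.comp (.prodMk_right t)
    rw [integral_val_mul _ hc]
    exact (Complex.reCLM.hasSum ((w t).hasSum_integral_ev_mul
      (Complex.continuous_ofReal.comp hc))).tsum_eq
  have e2 : ∀ k, ∫ t in Ioo 0 T, (w t k * moment ψ k t).re
      = (∫ t in Ioo 0 T, w t k * moment ψ k t).re := fun k =>
    Complex.reCLM.integral_comp_comm (hint k)
  simpa only [e1, e2] using key

/-- If every mode satisfies its equation in the weak sense, then the conservation law holds in the
weak sense. -/
lemma weakConservationLaw {T : ℝ} (hT : 0 < T) {u₀ : Wiener} {u J : ℝ → Wiener}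
    (hu : IntegrableOn u (Ioo 0 T)) (hJ : IntegrableOn J (Ioo 0 T))
    (h : ∀ (k : ℤ) (η η' : ℝ → ℂ), (∀ t, HasDerivAt η (η' t) t) → Continuous η' → η T = 0 →
      u₀ k * η 0 + (∫ t in Ioo 0 T, u t k * η' t) + ∫ t in Ioo 0 T, dsym 1 k * J t k * η t = 0) :
    WeakConservationLaw T (val u₀) (fun t => val (u t)) (fun t => val (J t)) := by
  rintro φ ⟨hφ, hper, T', hT', hzero⟩
  have hd : ∀ p : ℝ × ℝ, HasFDerivAt (Function.uncurry φ) (fderiv ℝ (Function.uncurry φ) p) p :=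
    fun p => (hφ.differentiable (by simp) p).hasFDerivAt
  have hfc : Continuous (fderiv ℝ (Function.uncurry φ)) := hφ.continuous_fderiv (by simp)
  have ht : ∀ t x, HasDerivAt (fun s => φ s x) (fderiv ℝ (Function.uncurry φ) (t, x) (1, 0)) t :=
    fun t x => HasFDerivAt.comp_hasDerivAt (f := fun s : ℝ => (s, x)) t (hd (t, x))
      ((hasDerivAt_id t).prodMk (hasDerivAt_const t x))
  have hx : ∀ t x, HasDerivAt (φ t) (fderiv ℝ (Function.uncurry φ) (t, x) (0, 1)) x :=
    fun t x => HasFDerivAt.comp_hasDerivAt (f := fun y : ℝ => (t, y)) x (hd (t, x))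
      ((hasDerivAt_const x t).prodMk (hasDerivAt_id x))
  have hct : Continuous (Function.uncurry fun t x => deriv (fun s => φ s x) t) := by
    have : (Function.uncurry fun t x => deriv (fun s => φ s x) t)
        = fun p => fderiv ℝ (Function.uncurry φ) p (1, 0) := by
      funext p; exact (ht p.1 p.2).deriv
    rw [this]; fun_prop
  have hcx : Continuous (Function.uncurry fun t x => deriv (φ t) x) := by
    have : (Function.uncurry fun t x => deriv (φ t) x)
        = fun p => fderiv ℝ (Function.uncurry φ) p (0, 1) := by
      funext p; exact (hx p.1 p.2).deriv
    rw [this]; fun_prop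
  have hA : HasSum (fun k => (u₀ k * moment φ k 0).re)
      (∫ x in (-Real.pi)..Real.pi, val u₀ x * φ 0 x) := by
    have hc : Continuous (φ 0) := hφ.continuous.comp (.prodMk_right 0)
    rw [integral_val_mul _ hc]
    exact Complex.reCLM.hasSum (u₀.hasSum_integral_ev_mul (Complex.continuous_ofReal.comp hc))
  have hB := hasSum_integral_integral hu hct
  have hC := hasSum_integral_integral hJ hcx
  have hmom : ∀ k t, moment (fun t x => deriv (φ t) x) k t = -dsym 1 k * moment φ k t := fun k t => by
    rw [moment, integral_chr_mul_deriv (fun x => (hx t x).differentiableAt.hasDerivAt)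
      (hcx.comp (.prodMk_right t)) (hper t), dsym, pow_one, moment]
  have hmode : ∀ k, (u₀ k * moment φ k 0).re
      + (∫ t in Ioo 0 T, u t k * moment (fun t x => deriv (fun s => φ s x) t) k t).re
      = (∫ t in Ioo 0 T, J t k * moment (fun t x => deriv (φ t) x) k t).re := fun k => by
    have h1 := h k (moment φ k) (moment (fun t x => deriv (fun s => φ s x) t) k)
      (hasDerivAt_moment (fun t x => (ht t x).differentiableAt.hasDerivAt) hφ.continuous hct k)
      (continuous_moment hct k) (by simp [moment, hzero T hT'.le])
    have h2 : ∀ t, J t k * moment (fun t x => deriv (φ t) x) k t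
        = -(dsym 1 k * J t k * moment φ k t) := fun t => by rw [hmom]; ring
    simp_rw [h2]
    rw [integral_neg, ← Complex.add_re, eq_neg_of_add_eq_zero_left h1]
  have hI : ∀ v : ℝ → ℝ, ∫ t in (0 : ℝ)..T, v t = ∫ t in Ioo 0 T, v t := fun v => by
    rw [intervalIntegral.integral_of_le hT.le, integral_Ioc_eq_integral_Ioo]
  rw [hI, hI]
  exact (hA.add hB).unique (hC.congr_fun hmode)

lemma WeakConservationLaw.congr {T : ℝ} {u₀ v₀ : ℝ → ℝ} {u J : ℝ → ℝ → ℝ}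
    (h : WeakConservationLaw T u₀ u J) (h₀ : v₀ =ᵐ[torusMeasure] u₀) :
    WeakConservationLaw T v₀ u J := fun φ hφ => by
  rw [← h φ hφ, intervalIntegral_eq_torus, intervalIntegral_eq_torus]
  congr 1
  exact integral_congr_ae (h₀.mono fun x hx => by simp only [hx])

/-! ### The fluxes in physical space -/

section Flux

variable {P : Par} {f g a b : Wiener}

lemma Wiener.IsReal.val_J₁ (hf : IsReal f) (hg : IsReal g) (ha : IsReal a) (hb : IsReal b) (x : ℝ) :
    val (P.J₁ f g a b) x = flux₁ P.ρ P.F P.G (val f x) (val g x) (val a x) (val b x) := by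
  have hev : ∀ {u}, IsReal u → evHom x u = (val u x : ℂ) := fun h => h.ev_eq x
  have hc : ∀ c, evHom x (const c) = c := fun c => ev_const c x
  have h : evHom x (P.J₁ f g a b)
      = (flux₁ P.ρ P.F P.G (val f x) (val g x) (val a x) (val b x) : ℂ) := by
    simp only [Par.J₁, Par.nl₁, Par.w₁₁, Par.w₁₂, n₁₁, n₁₂, mixed, cubic, map_add, map_mul, map_pow,
      map_ofNat, hc, hev hf, hev hg, hev ha, hev hb, flux₁, mix, cub, Par.a₁₁, Par.a₁₂]
    push_cast
    ring
  rw [val, show ev (P.J₁ f g a b) x = _ from h, Complex.ofReal_re]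

lemma Wiener.IsReal.val_J₂ (hf : IsReal f) (hg : IsReal g) (ha : IsReal a) (hb : IsReal b) (x : ℝ) :
    val (P.J₂ f g a b) x = flux₂ P.ρ P.μ P.F P.G (val f x) (val g x) (val a x) (val b x) := by
  have hev : ∀ {u}, IsReal u → evHom x u = (val u x : ℂ) := fun h => h.ev_eq x
  have hc : ∀ c, evHom x (const c) = c := fun c => ev_const c x
  have h : evHom x (P.J₂ f g a b)
      = (flux₂ P.ρ P.μ P.F P.G (val f x) (val g x) (val a x) (val b x) : ℂ) := by
    simp only [Par.J₂, Par.nl₂, Par.w₂₁, Par.w₂₂, n₂₁, n₂₂, mixed, cubic, map_add, map_mul, map_pow,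
      map_ofNat, hc, hev hf, hev hg, hev ha, hev hb, flux₂, mix, cub, Par.a₂₁, Par.a₂₂]
    push_cast
    ring
  rw [val, show ev (P.J₂ f g a b) x = _ from h, Complex.ofReal_re]

end Flux

/-- Joint integrability in time and space. -/
lemma integrable_uncurry_val {w : ℝ → Wiener} {T : ℝ} (hw : IntegrableOn w (Ioo 0 T)) :
    Integrable (Function.uncurry fun t => val (w t)) ((volume.restrict (Ioo 0 T)).prod torusMeasure) := by
  have h1 : AEStronglyMeasurable (fun p : ℝ × ℝ => toBCF (w p.1))
      ((volume.restrict (Ioo 0 T)).prod torusMeasure) :=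
    (toBCF.continuous.comp_aestronglyMeasurable hw.1).comp_fst
  have h2 : AEStronglyMeasurable (fun p : ℝ × ℝ => toBCF (w p.1) p.2)
      ((volume.restrict (Ioo 0 T)).prod torusMeasure) :=
    (continuous_eval : Continuous fun q : (ℝ →ᵇ ℝ) × ℝ => q.1 q.2).comp_aestronglyMeasurable
      (h1.prodMk measurable_snd.aestronglyMeasurable)
  simp only [toBCF_apply] at h2
  exact (hw.norm.comp_fst torusMeasure).mono' h2 (.of_forall fun p => abs_val_le _ _)

open Wiener

/-! ### Initial data -/

/-- A square integrable function is determined by its Fourier coefficients. -/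
lemma ae_eq_of_fc_eq {u v : ℝ → ℝ} (hu : MemLp u 2 torusMeasure) (hv : MemLp v 2 torusMeasure)
    (h : ∀ k, fc u k = fc v k) : u =ᵐ[torusMeasure] v := by
  have hL2 : MemLp (fun x => ((u x - v x : ℝ) : ℂ)) 2 (volume.restrict (Ioc (-Real.pi) Real.pi)) :=
    (hu.sub hv).ofReal
  have hint : ∀ {w : ℝ → ℝ}, MemLp w 2 torusMeasure → ∀ k,
      Integrable (fun x => (w x : ℂ) * chr k x) torusMeasure := fun hw k =>
    (hw.integrable one_le_two).ofReal.mul_bdd (c := 1) (continuous_chr k).aestronglyMeasurable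
      (.of_forall fun x => (norm_chr k x).le)
  have h0 : ∀ k, fc (fun x => u x - v x) k = 0 := fun k => by
    have := h k
    rw [fc_eq_integral, fc_eq_integral, intervalIntegral_eq_torus, intervalIntegral_eq_torus] at this
    rw [fc_eq_integral, intervalIntegral_eq_torus]
    simp only [Complex.ofReal_sub, sub_mul]
    rw [integral_sub (hint hu _) (hint hv _), smul_sub, this, sub_self]
  have hpars := hasSum_sq_fourierCoeffOn (neg_lt_self Real.pi_pos) hL2
  have hz : ∀ k, ‖fourierCoeffOn (neg_lt_self Real.pi_pos) (fun x => ((u x - v x : ℝ) : ℂ)) k‖ ^ 2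
      = 0 := fun k => by
    rw [show fourierCoeffOn (neg_lt_self Real.pi_pos) (fun x => ((u x - v x : ℝ) : ℂ)) k = 0 from h0 k,
      norm_zero, zero_pow two_ne_zero]
  simp only [hz] at hpars
  have hpi : (0 : ℝ) < Real.pi - -Real.pi := by linarith [Real.pi_pos]
  have h1 := (smul_eq_zero.1 (hpars.unique hasSum_zero)).resolve_left (inv_ne_zero hpi.ne')
  rw [intervalIntegral_eq_torus] at h1
  have h1 := (integral_eq_zero_iff_of_nonneg (fun _ => by positivity)
    (show Integrable _ torusMeasure from hL2.norm.integrable_sq)).1 h1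
  filter_upwards [h1] with x hx
  have : ‖((u x - v x : ℝ) : ℂ)‖ ^ 2 = 0 := hx
  rw [sq_eq_zero_iff, norm_eq_zero, Complex.ofReal_eq_zero, sub_eq_zero] at this
  exact this

/-- A function in `Ḣ^{(m+1)/2}`, `m ≥ 1`, comes from an element of the Wiener algebra. -/
lemma MemHdot.exists_wiener {m : ℕ} (hm : 1 ≤ m) {α : ℝ} (hα : 2 * α = (m + 1 : ℕ)) {u : ℝ → ℝ}
    (h : MemHdot α u) :
    ∃ a : Wiener, a 0 = 0 ∧ IsReal a ∧ wienerNorm u = ‖a‖ ∧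
      (Summable fun k : ℤ => |(k : ℝ)| ^ (m + 1) * ‖a k‖ ^ 2) ∧ u =ᵐ[torusMeasure] val a := by
  obtain ⟨-, h2, h3, h4⟩ := h
  simp only [hα, Real.rpow_natCast] at h4
  have h0 : fc u 0 = 0 := by rw [← mean_eq_fc, h3, Complex.ofReal_zero]
  have hs : Summable fun k : ℤ => ‖fc u k‖ := by
    refine .of_nonneg_of_le (fun _ => norm_nonneg _) (fun k => ?_) (summable_inv_int_sq.add h4)
    by_cases hk : k = 0
    · subst hk; simp [h0]
    have hk1 : (1 : ℝ) ≤ |(k : ℝ)| := by exact_mod_cast Int.one_le_abs hk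
    have hpow : |(k : ℝ)| ^ 2 ≤ |(k : ℝ)| ^ (m + 1) := pow_le_pow_right₀ hk1 (by lia)
    have hmul := mul_le_mul_of_nonneg_right hpow (sq_nonneg ‖fc u k‖)
    have hamgm := two_mul_le_add_sq (1 / |(k : ℝ)|) (|(k : ℝ)| * ‖fc u k‖)
    have e1 : 2 * (1 / |(k : ℝ)|) * (|(k : ℝ)| * ‖fc u k‖) = 2 * ‖fc u k‖ := by
      have : |(k : ℝ)| ≠ 0 := by positivity
      field_simp
    rw [e1, mul_pow, div_pow, one_pow, sq_abs (k : ℝ)] at hamgm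
    rw [sq_abs] at hmul
    linarith [norm_nonneg (fc u k)]
  have hr : IsReal (of (fc u) hs) := fun k => fc_neg u k
  refine ⟨of (fc u) hs, h0, hr, ?_, h4, ?_⟩
  · rw [norm_def]; rfl
  · exact ae_eq_of_fc_eq h2 (memLp_val _ 2) fun k => (fc_val hr k).symm

/-! ### The solution in physical space -/

lemma Flow.zeta_eq (flow : Flow) : flow.zeta = 1 ∨ flow.zeta = 3 := by cases flow <;> simp [Flow.zeta]

lemma Flow.sign_mul_isym (flow : Flow) (k : ℤ) :
    (flow.sign : ℂ) * (Complex.I * k) ^ flow.zeta = dsym flow.zeta k := by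
  cases flow
  · simp [Flow.sign, Flow.zeta, dsym]
  · simp only [Flow.sign, Flow.zeta, dsym, mul_pow, Complex.I_pow_three]
    push_cast
    ring

lemma Wiener.IsPath.weakRegularity {flow : Flow} {M : ℝ} {u : ℝ → Wiener}
    (h : IsPath flow.zeta M u) {T : ℝ} (hT : 0 < T) : WeakRegularity flow T fun t => val (u t) := by
  refine ⟨h.memLinfty, h.memLqWinfty ?_, fun α h0 h1 => h.memL1Holder h0 (by linarith),
    h.memMeasWinfty, (h.memL2Hdot (p := flow.zeta + 1) ?_ (h.sum_energy_integral_le hT.le)).1⟩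
  · rw [← ENNReal.ofReal_ofNat]
    refine ENNReal.ofReal_le_ofReal ?_
    rcases flow.zeta_eq with h | h <;> rw [h] <;> norm_num
  · push_cast; ring

lemma isReal_fmul_isym {u : Wiener} (hu : IsReal u) (m : ℕ) :
    IsReal (fmul (fun k : ℤ => (Complex.I * k : ℂ) ^ m) u) := fun k => by
  rw [fmul]
  split_ifs
  · simp only [of_apply, map_mul, map_pow, Complex.conj_I, hu k, map_intCast]
    push_cast
    ring
  · simp

/-- The operator `𝒟`. -/
lemma fmul_dsym_eq (flow : Flow) (u : Wiener) :
    fmul (dsym flow.zeta) u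
      = const flow.sign * fmul (fun k : ℤ => (Complex.I * k : ℂ) ^ flow.zeta) u := by
  have hn : ∀ k : ℤ, ‖dsym flow.zeta k * u k‖ = ‖(Complex.I * k : ℂ) ^ flow.zeta * u k‖ := fun k => by
    rw [norm_mul, norm_mul, norm_dsym, norm_isym]
  by_cases h : Summable fun k : ℤ => ‖(Complex.I * k : ℂ) ^ flow.zeta * u k‖
  · have h' : Summable fun k : ℤ => ‖dsym flow.zeta k * u k‖ := by simpa only [hn] using h
    ext k
    rw [const_mul_apply, fmul_apply h, fmul_apply h', ← flow.sign_mul_isym, mul_assoc]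
  · have h' : ¬ Summable fun k : ℤ => ‖dsym flow.zeta k * u k‖ := by simpa only [hn] using h
    rw [fmul, fmul, dif_neg h, dif_neg h', mul_zero]

lemma val_fmul_dsym (flow : Flow) (u : Wiener) (x : ℝ) :
    val (fmul (dsym flow.zeta) u) x
      = flow.sign * val (fmul (fun k : ℤ => (Complex.I * k : ℂ) ^ flow.zeta) u) x := by
  rw [fmul_dsym_eq, val, ev_mul, ev_const, Complex.re_ofReal_mul, val]

lemma Wiener.IsReal.fmul_dsym {flow : Flow} {u : Wiener} (hu : IsReal u) :
    IsReal (fmul (dsym flow.zeta) u) := fun k => by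
  rw [fmul_dsym_eq, const_mul_apply, const_mul_apply, isReal_fmul_isym hu _ k, map_mul,
    Complex.conj_ofReal]

/-- The solution of the system of modes is a weak solution. -/
lemma isWeakSolution {flow : Flow} {P : Par} {e M A T : ℝ} (hT : 0 < T) {a b : Wiener}
    {f g : ℝ → Wiener} {f₀ g₀ : ℝ → ℝ} (hf : IsPath flow.zeta M f) (hg : IsPath flow.zeta M g)
    (hfg : FluxPair flow.zeta e T A f g) (hf₀ : f₀ =ᵐ[torusMeasure] val a)
    (hg₀ : g₀ =ᵐ[torusMeasure] val b)
    (heq : ∀ (k : ℤ) (η η' : ℝ → ℂ), (∀ t, HasDerivAt η (η' t) t) → Continuous η' → η T = 0 →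
      (a k * η 0 + (∫ t in Ioo 0 T, f t k * η' t) + ∫ t in Ioo 0 T, dsym 1 k *
        P.J₁ (f t) (g t) (fmul (dsym flow.zeta) (f t)) (fmul (dsym flow.zeta) (g t)) k * η t = 0) ∧
      (b k * η 0 + (∫ t in Ioo 0 T, g t k * η' t) + ∫ t in Ioo 0 T, dsym 1 k *
        P.J₂ (f t) (g t) (fmul (dsym flow.zeta) (f t)) (fmul (dsym flow.zeta) (g t)) k * η t = 0)) :
    IsWeakSolution flow P.ρ P.μ P.F P.G T f₀ g₀ (fun t => val (f t)) (fun t => val (g t)) := by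
  obtain ⟨C, hC₁, hC₂⟩ := P.exists_fluxMap e
  have iJ₁ := hfg.integrable_flux hC₁
  have iJ₂ := hfg.integrable_flux hC₂
  have icc : ∀ {w : ℝ → Wiener}, Continuous w → IntegrableOn w (Ioo 0 T) := fun hw =>
    hw.integrableOn_Icc.mono_set Ioo_subset_Icc_self
  set D := fun u : Wiener => fmul (fun k : ℤ => (Complex.I * k : ℂ) ^ flow.zeta) u with hD
  have hJ₁ : ∀ t x, flux₁ P.ρ P.F P.G (val (f t) x) (val (g t) x) (flow.sign * val (D (f t)) x)
      (flow.sign * val (D (g t)) x) = val (P.J₁ (f t) (g t) (fmul (dsym flow.zeta) (f t))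
        (fmul (dsym flow.zeta) (g t))) x := fun t x => by
    rw [IsReal.val_J₁ (hf.real t) (hg.real t) (IsReal.fmul_dsym (hf.real t)) (IsReal.fmul_dsym (hg.real t)),
      val_fmul_dsym, val_fmul_dsym]
  have hJ₂ : ∀ t x, flux₂ P.ρ P.μ P.F P.G (val (f t) x) (val (g t) x) (flow.sign * val (D (f t)) x)
      (flow.sign * val (D (g t)) x) = val (P.J₂ (f t) (g t) (fmul (dsym flow.zeta) (f t))
        (fmul (dsym flow.zeta) (g t))) x := fun t x => by
    rw [IsReal.val_J₂ (hf.real t) (hg.real t) (IsReal.fmul_dsym (hf.real t)) (IsReal.fmul_dsym (hg.real t)),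
      val_fmul_dsym, val_fmul_dsym]
  refine ⟨fun t => val_periodic _, fun t => val_periodic _, fun t => val (D (f t)),
    fun t => val (D (g t)), ?_, ?_, ?_, ?_, ?_⟩
  · rintro u (rfl | rfl | rfl | rfl)
    · exact integrable_uncurry_val (icc hf.cont)
    · exact integrable_uncurry_val (icc hg.cont)
    · exact integrable_uncurry_val (hf.integrable_fmul (norm_isym_le (Nat.le_succ _)) T)
    · exact integrable_uncurry_val (hg.integrable_fmul (norm_isym_le (Nat.le_succ _)) T)
  · filter_upwards [hf.ae_summable_isym (Nat.le_succ _) T, hg.ae_summable_isym (Nat.le_succ _) T]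
      with t h1 h2
    exact ⟨hasWeakDeriv_val (fmul_apply h1), hasWeakDeriv_val (fmul_apply h2)⟩
  · rintro J (rfl | rfl)
    · simp only [hJ₁]; exact integrable_uncurry_val iJ₁
    · simp only [hJ₂]; exact integrable_uncurry_val iJ₂
  · simp only [hJ₁]
    exact (weakConservationLaw hT (icc hf.cont) iJ₁
      fun k η η' h1 h2 h3 => (heq k η η' h1 h2 h3).1).congr hf₀
  · simp only [hJ₂]
    exact (weakConservationLaw hT (icc hg.cont) iJ₂
      fun k η η' h1 h2 h3 => (heq k η η' h1 h2 h3).2).congr hg₀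

lemma eLpNorm_val_le (u : Wiener) : eLpNorm (val u) ⊤ torusMeasure ≤ ENNReal.ofReal ‖u‖ := by
  rw [eLpNorm_exponent_top]
  exact eLpNormEssSup_le_of_ae_bound (.of_forall (abs_val_le u))

end

end ThinFilm

theorem theorem6 (flow : ThinFilm.Flow) (ρ μ : ℝ) (hρ : 0 < ρ) (hμ : 0 < μ)
    (f₀ g₀ : ℝ → ℝ) (F G e ζ : ℝ)
    (hF : F = ThinFilm.mean f₀) (hG : G = ThinFilm.mean g₀)
    (he : e = ThinFilm.calE₀ (ThinFilm.fluct f₀) (ThinFilm.fluct g₀))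
    (hζ : ζ = flow.zeta)
    (hf₀ : ThinFilm.MemHdot ((ζ + 1) / 2) (ThinFilm.fluct f₀))
    (hg₀ : ThinFilm.MemHdot ((ζ + 1) / 2) (ThinFilm.fluct g₀))
    (hsize : e < min F G)
    (hSigma : 0 < min (ThinFilm.Sigma₁ ρ μ F G e) (ThinFilm.Sigma₂ ρ μ F G e))
    (h₁ : 0 < (2 * ρ - 1) * F ^ 3 - 3 / 2 * (ρ - 1) * F ^ 2 * G - 3 * F * G ^ 2 - μ * G ^ 3
      - e * ThinFilm.scrC flow ρ μ F G e)
    (h₂ : 0 < μ * G ^ 3 + 3 * F * G ^ 2 - 3 / 2 * (ρ - 1) * F ^ 2 * G - F ^ 3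
      - e * ThinFilm.scrC flow ρ μ F G e) :
    ∃ f g : ℝ → ℝ → ℝ,
      -- `(f, g)` is a global weak solution in the regularity class of the existence theorem
      (∀ T : ℝ, 0 < T →
        ThinFilm.IsWeakSolution flow ρ μ F G T (ThinFilm.fluct f₀) (ThinFilm.fluct g₀) f g ∧
        ThinFilm.WeakRegularity flow T f ∧ ThinFilm.WeakRegularity flow T g) ∧
      -- exponential decay in the supremum norm
      (∃ ε : ℝ, 0 < ε ∧ ∀ T : ℝ, 0 < T →
        eLpNorm (f T) ⊤ ThinFilm.torusMeasure + eLpNorm (g T) ⊤ ThinFilm.torusMeasure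
          ≤ ENNReal.ofReal (e * Real.exp (-ε * T))) ∧
      -- propagation of Sobolev regularity
      (∀ T : ℝ, 0 < T →
        ThinFilm.MemCHdot T ((ζ + 1) / 2) f ∧ ThinFilm.MemL2Hdot T (ζ + 1) f ∧
        ThinFilm.MemCHdot T ((ζ + 1) / 2) g ∧ ThinFilm.MemL2Hdot T (ζ + 1) g) ∧
      ∃ c₁ c₂ c₃ : ℝ, 0 < c₁ ∧ 0 < c₂ ∧ 0 < c₃ ∧
        -- the energy bound
        (∀ T : ℝ, 0 < T →
          ThinFilm.E ((ζ + 1) / 2) (f T) (g T)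
            + c₁ * ∫ s in (0 : ℝ)..T, ThinFilm.E (ζ + 1) (f s) (g s) ≤ c₂) ∧
        -- exponential decay in Sobolev spaces of lower order
        ∀ s : ℝ, 0 ≤ s → s < (ζ + 1) / 2 →
          ∃ c : ℝ, 0 < c ∧ ∀ T : ℝ, 0 < T →
            ThinFilm.E s (f T) (g T) ≤ c₃ * Real.exp (-c * T) := by
  subst hζ
  set m := flow.zeta with hmdef
  have hm : m = 1 ∨ m = 3 := flow.zeta_eq
  have hm1 : 1 ≤ m := by lia
  have hα : 2 * (((m : ℝ) + 1) / 2) = (m + 1 : ℕ) := by push_cast; ring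
  have hα' : 2 * ((m : ℝ) + 1) = (2 * (m + 1) : ℕ) := by push_cast; ring
  obtain ⟨a, ha0, har, haN, has, hae⟩ := hf₀.exists_wiener hm1 hα
  obtain ⟨b, hb0, hbr, hbN, hbs, hbe⟩ := hg₀.exists_wiener hm1 hα
  have he' : ‖a‖ + ‖b‖ = e := by rw [he, ThinFilm.calE₀, haN, hbN]
  have he0 : 0 ≤ e := by rw [← he']; positivity
  obtain ⟨hF0, hG0⟩ := lt_min_iff.1 (he0.trans_lt hsize)
  obtain ⟨hS₁, hS₂⟩ := lt_min_iff.1 hSigma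
  have hP : (ThinFilm.Par.mk ρ μ F G).Adm e := ⟨⟨hρ, hμ, hF0, hG0⟩, he0, hS₁, hS₂⟩
  obtain ⟨M, f, g, hf, hg, hdecay, hflux, heq⟩ :=
    ThinFilm.Par.exists_solution hP hm ha0 hb0 har hbr he' has hbs
  set δ := (ThinFilm.Par.mk ρ μ F G).rate e / 2 with hδ
  have hδ0 : 0 < δ := half_pos hP.rate_pos
  have hM : 0 ≤ M := (norm_nonneg _).trans (hf.norm_le 0)
  refine ⟨fun t => (f t).val, fun t => (g t).val, fun T hT => ?_, ⟨δ, hδ0, fun T hT => ?_⟩,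
    fun T hT => ?_, 1, 4 * M + 1, 2 * (e ^ 2 + M) + 1, one_pos, by positivity, by positivity,
    fun T hT => ?_, fun s hs hsm => ?_⟩
  · obtain ⟨A, hA⟩ := hflux T hT
    exact ⟨ThinFilm.isWeakSolution (P := ⟨ρ, μ, F, G⟩) hT hf hg hA hae hbe
      fun k η η' => heq T k η η' hT, hf.weakRegularity hT, hg.weakRegularity hT⟩
  · refine (add_le_add (ThinFilm.eLpNorm_val_le _) (ThinFilm.eLpNorm_val_le _)).trans ?_
    rw [← ENNReal.ofReal_add (norm_nonneg _) (norm_nonneg _), neg_mul]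
    exact ENNReal.ofReal_le_ofReal (hdecay T hT.le)
  · exact ⟨hf.memCHdot hα, (hf.memL2Hdot hα' (hf.sum_en T)).1, hg.memCHdot hα,
      (hg.memL2Hdot hα' (hg.sum_en T)).1⟩
  · obtain ⟨f1, f2⟩ := hf.memL2Hdot hα' (hf.sum_en T)
    obtain ⟨g1, g2⟩ := hg.memL2Hdot hα' (hg.sum_en T)
    have hft := hf.tsum_energy_le T
    have hgt := hg.tsum_energy_le T
    rw [← ThinFilm.Wiener.hSq_val (hf.real T) hα] at hft
    rw [← ThinFilm.Wiener.hSq_val (hg.real T) hα] at hgt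
    rw [intervalIntegral.integral_of_le hT.le, integral_Ioc_eq_integral_Ioo]
    simp only [ThinFilm.E]
    rw [integral_add f1.2.2 g1.2.2]
    linarith
  · have hθ : 2 * s / ((m : ℝ) + 1) < 1 := by rw [div_lt_one (by positivity)]; linarith
    refine ⟨δ * (1 - 2 * s / (m + 1)), mul_pos hδ0 (by linarith), fun T hT => ?_⟩
    have hT' := hdecay T hT.le
    have h1 := hf.hSq_le_exp (a := e) hδ0 hT.le hs hsm (by linarith [norm_nonneg (g T)])
    have h2 := hg.hSq_le_exp (a := e) hδ0 hT.le hs hsm (by linarith [norm_nonneg (f T)])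
    have h3 := Real.exp_pos (-(δ * (1 - 2 * s / (m + 1)) * T))
    rw [ThinFilm.E, neg_mul]
    linarith
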